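/- **Setting.** Let $P\subset\mathbb R^d$ be a closed convex cone with $P-P=\mathbb R^d$ and $P\cap(-P)=\{0\}$. Let $(Y,\mathcal B)$ be a measurable space with countably generated $\mathcal B$ and a measurable action of $\mathbb R^d$, written additively, and let $\lambda$ be an $\mathbb R^d$-invariant $\sigma$-finite measure on $Y$. Let $X\in\mathcal B$ satisfy $X+a\subset X$ for $a\in P$ and $\bigcap_{a\in P}(X+a)=\emptyset$. Let $\eta$ be a Poisson process on $Y$ with intensity measure $\lambda$, realised on a probability space $(\Omega,\mathcal F,\mathbb P)$ whose $\sigma$-algebra is generated, up to null sets, by the random variables $\eta(B)$, $B\in\mathcal B$. **Product systems.** A product system over $P$ is a standard Borel space $E$ with a measurable projection $E\to P$ whose fibres $E(a)$, $a\in P$, are non-zero separable Hilbert spaces, together with a measurable associative product $E(a)\times E(b)\to E(a+b)$ that induces unitaries $E(a)\otimes E(b)\to E(a+b)$, such that $E(0)=\mathbb C$ acts by scalars and the measurable sections make $E$ a measurable field of Hilbert spaces. An isomorphism of product systems is a bi-measurable, multiplicative, fibrewise unitary map over $P$. **The product system of the Poisson process.** For $a\in P$ let $\mathcal F_a$ be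 the $\sigma$-algebra generated by the $\eta(B)$ with $B\in\mathcal B$, $B\subset X\setminus(X+a)$, and let $E(a)=L^2(\Omega,\mathcal F_a,\mathbb P)$. For $a\in P$ let $S_a$ be the unitary on $L^2(\Omega,\mathcal F,\mathbb P)$ with $S_a\big(F(\eta(B_1),\dots,\eta(B_n))\big)=F(\eta(B_1+a),\dots,\eta(B_n+a))$. The product on $E=\{(a,f):a\in P,\ f\in E(a)\}\subset P\times L^2(\Omega,\mathcal F,\mathbb P)$ is $(a,f)(b,g)=(a+b,\,f\cdot S_a g)$. **Normalized exponentials.** Fix a measurable $\ell:\mathbb C\setminus\{0\}\to\mathbb C$ with $e^{\ell(z)}=z$ for all $z$ and $\ell(x)=\log x$ for $x>0$. For a square integrable complex simple function $f$ on $X$ that does not take the value $-1$ put $u_f=\ell(1+f)$ and $$\Sigma_f=\frac{e^{\eta(u_f)}}{\mathbb E\big(e^{\eta(u_f)}\big)},\qquad \eta(u)=\int u\,d\eta .$$ For general $f\in L^2(X,\lambda)$ let $\Sigma_f=\lim_n\Sigma_{f_n}$ in $L^2(\Omega,\mathcal F,\mathbb P)$, for any sequence of such simple functions $f_n$ with $f_n\to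 f$ in $L^2(X,\lambda)$. **The CCR flow.** On $H=L^2(X,\lambda)$ let $(V_af)(y)=f(y-a)$ if $y-a\in X$ and $(V_af)(y)=0$ otherwise. Let $\Gamma(K)$ denote the symmetric Fock space of a Hilbert space $K$, with exponential vectors $e(f)$, whose inner products are the exponentials of those of the vectors $f$. Let $W(h)$ be the Weyl operators on $\Gamma(H)$, $W(h)e(g)=e^{-\|h\|^2/2-\langle g|h\rangle}e(g+h)$, where $\langle\cdot|\cdot\rangle$ is linear in the first variable. The CCR flow $\alpha$ of $V$ is the $E_0$-semigroup on $B(\Gamma(H))$ over $P$ with $\alpha_a(W(h))=W(V_ah)$. Its product system has the fibres $\{T\in B(\Gamma(H)):\alpha_a(A)T=TA\text{ for all }A\}$, with the inner product $\langle T|S\rangle 1=S^*T$ and composition of operators as the product. **Statement.** All these objects are well defined: $S_a$ exists and is unique, $\Sigma_f$ is well defined, $V$ is a strongly continuous semigroup of isometries, its CCR flow $\alpha$ exists, and $E$ and the product system of $\alpha$ are product systems over $P$. For $a\in P$ there is a unitary $\kappa_a$ from $\Gamma\big(L^2(X\setminus(X+a))\big)$ onto the fibre over $a$ of the product system of $\alpha$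 such that $\kappa_a(e(f))\,e(g)=e(f+V_ag)$ for $f\in L^2(X\setminus(X+a))$, $g\in H$. Identify $\Gamma\big(L^2(X\setminus(X+a))\big)$ with that fibre through $\kappa_a$. Then there is an isomorphism of product systems from the product system of the CCR flow $\alpha$ onto $E$ that maps $e(f)$ to $\Sigma_f\in E(a)$, for all $a\in P$ and $f\in L^2(X\setminus(X+a))$. -/

import Mathlib

open MeasureTheory ProbabilityTheory Filter Topology
open scoped ENNReal Pointwise ComplexOrder ComplexConjugate

noncomputable section

namespace PoissonProductSystem

universe u v w

/-! ### Symmetric Fock space, exponential vectors and Weyl operators -/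

section FockSpace

variable (H : Type u) [NormedAddCommGroup H] [InnerProductSpace ℂ H]

/-- The exponential kernel `(f, g) ↦ exp ⟪f, g⟫` of a Hilbert space `H` (inner products are linear in
the second variable), each value being regarded as an operator on `ℂ`. -/
def expKernel : Matrix H H (ℂ →L[ℂ] ℂ) :=
  Matrix.of fun f g => Complex.exp (inner ℂ f g) • (1 : ℂ →L[ℂ] ℂ)

theorem inner_pow_posSemidef (k : ℕ) :
    (Matrix.of fun f g : H => (inner ℂ f g) ^ k : Matrix H H ℂ).PosSemidef := by
  induction k with
  | zero =>
    refine ⟨by ext f g; simp, fun c => ?_⟩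
    have : (c.sum fun i xi => c.sum fun j xj => star xi * ((1 : ℂ)) * xj)
        = star (c.sum fun _ a => a) * (c.sum fun _ a => a) := by
      simp only [Finsupp.sum, star_sum, Finset.sum_mul_sum, mul_one]
    simp only [Matrix.of_apply, pow_zero]
    rw [this]
    exact star_mul_self_nonneg _
  | succ k ih =>
    have h1 : (Matrix.of fun f g : H => inner ℂ f g : Matrix H H ℂ).PosSemidef := by
      refine ⟨by ext f g; simp, fun c => ?_⟩
      have : (c.sum fun i xi => c.sum fun j xj => star xi * (inner ℂ i j) * xj)
          = inner ℂ (c.sum fun i a => a • i) (c.sum fun i a => a • i) := by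
        simp only [Finsupp.sum, sum_inner, inner_sum, inner_smul_left, inner_smul_right]
        rw [Finset.sum_comm]
        refine Finset.sum_congr rfl fun i _ => ?_
        rw [Finset.mul_sum]
        refine Finset.sum_congr rfl fun j _ => ?_
        simp only [RCLike.star_def]; ring
      simp only [Matrix.of_apply]
      rw [this, inner_self_eq_norm_sq_to_K]
      have h0 := Complex.zero_le_real.mpr (sq_nonneg ‖c.sum fun i a => a • i‖)
      rw [Complex.ofReal_pow] at h0
      exact h0
    have h2 : (Matrix.of fun f g : H => (inner ℂ f g) ^ (k + 1) : Matrix H H ℂ) =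
        Matrix.hadamard (Matrix.of fun f g : H => (inner ℂ f g) ^ k)
          (Matrix.of fun f g : H => inner ℂ f g) := by
      ext f g
      simp [pow_succ]
    rw [h2]
    exact Matrix.PosSemidef.hadamard ih h1

theorem expKernel_posSemidef : (expKernel H).PosSemidef := by
  have hT := ((RKHS.posSemidef_tfae (K := expKernel H)).out 2 0).mp
  refine hT ⟨?_, fun c => ?_⟩
  · ext f g
    simp [expKernel, Matrix.conjTranspose_apply, ← Complex.exp_conj]
  · have h : HasSum (fun k : ℕ => (((k.factorial : ℝ)⁻¹ : ℝ) : ℂ) *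
        (c.sum fun f a => c.sum fun g b => conj a * (inner ℂ f g) ^ k * b))
        (c.sum fun f a => c.sum fun g b => conj a * Complex.exp (inner ℂ f g) * b) := by
      simp only [Finsupp.sum, Finset.mul_sum]
      refine hasSum_sum fun f _ => hasSum_sum fun g _ => ?_
      have := (NormedSpace.expSeries_div_hasSum_exp (𝔸 := ℂ) (inner ℂ f g)).mul_left
        (conj (c f) * c g)
      rw [← Complex.exp_eq_exp_ℂ] at this
      have e1 : (fun k : ℕ => (((k.factorial : ℝ)⁻¹ : ℝ) : ℂ) *
          (conj (c f) * (inner ℂ f g) ^ k * c g)) =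
          fun k : ℕ => conj (c f) * c g * (inner ℂ f g ^ k / (k.factorial : ℂ)) := by
        ext k; push_cast; ring
      rw [e1, show conj (c f) * Complex.exp (inner ℂ f g) * c g =
        conj (c f) * c g * Complex.exp (inner ℂ f g) by ring]
      exact this
    have h2 := (Complex.hasSum_re h).nonneg (fun k => by
      have := (inner_pow_posSemidef H k).2 c
      simp only [Matrix.of_apply] at this
      rw [Complex.re_ofReal_mul]
      exact mul_nonneg (by positivity) (Complex.le_def.mp this).1)
    have e2 : (c.sum fun f a => c.sum fun g b => inner ℂ ((expKernel H g f) a) b) =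
        c.sum fun f a => c.sum fun g b => conj a * Complex.exp (inner ℂ f g) * b := by
      unfold Finsupp.sum
      refine Finset.sum_congr rfl fun f _ => Finset.sum_congr rfl fun g _ => ?_
      simp [expKernel, ← Complex.exp_conj]
      ring
    rw [e2]
    exact h2

instance : Fact (expKernel H).PosSemidef := ⟨expKernel_posSemidef H⟩

/-- The symmetric Fock space `Γ(H)`, realised as the Hilbert space generated by the exponential
kernel. It is complete, and it carries exponential vectors `e(f)` with
`⟪e(f), e(g)⟫ = exp ⟪f, g⟫` (`inner_expVec`) and dense linear span (`expVec_total`); these two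
properties determine the pair `(Γ(H), e)` up to a unique unitary. -/
abbrev Fock : Type u := RKHS.OfKernel (expKernel H)

variable {H}
/-- The exponential vector `e(f)`, that is `⊕ₙ f^{⊗ n} / √n!` in the tensor picture. -/
def expVec (f : H) : Fock H := RKHS.kerFun (Fock H) f 1

theorem inner_expVec (f g : H) :
    inner ℂ (expVec f) (expVec g) = Complex.exp (inner ℂ f g) := by
  rw [expVec, expVec, ← RKHS.kernel_inner, RKHS.OfKernel.kernel_ofKernel]
  simp [expKernel, ← Complex.exp_conj]

theorem expVec_total :
    (Submodule.span ℂ (Set.range (expVec (H := H)))).topologicalClosure = ⊤ := by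
  rw [← RKHS.kerFun_dense (H := Fock H)]
  congr 1
  apply le_antisymm
  · apply Submodule.span_mono
    rintro _ ⟨f, rfl⟩
    exact ⟨f, 1, rfl⟩
  · rw [Submodule.span_le]
    rintro _ ⟨f, c, rfl⟩
    have : RKHS.kerFun (Fock H) f c = c • expVec f := by
      rw [expVec, ← map_smul]; simp
    rw [this]
    exact Submodule.smul_mem _ _ (Submodule.subset_span ⟨f, rfl⟩)

instance : Nontrivial (Fock H) := ⟨⟨expVec 0, 0, fun h => by
  have := inner_expVec (0 : H) 0
  rw [h] at this
  simp at this⟩⟩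


theorem lift_bound {ι : Type*} {K : Type v} {K' : Type w}
    [NormedAddCommGroup K] [InnerProductSpace ℂ K]
    [NormedAddCommGroup K'] [InnerProductSpace ℂ K']
    (x : ι → K) (y : ι → K')
    (h : ∀ i j, inner ℂ (y i) (y j) = inner ℂ (x i) (x j)) (c : ι →₀ ℂ) :
    ‖Finsupp.linearCombination ℂ y c‖ = ‖Finsupp.linearCombination ℂ x c‖ := by
  rw [← sq_eq_sq₀ (norm_nonneg _) (norm_nonneg _), ← @inner_self_eq_norm_sq ℂ,
    ← @inner_self_eq_norm_sq ℂ]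
  simp only [Finsupp.linearCombination_apply, Finsupp.sum, sum_inner, inner_sum,
    inner_smul_left, inner_smul_right, h]

/-- The value `exp (-‖h‖²/2 - ⟪h, g⟫) e(g + h)` of the Weyl operator `W(h)` at `e(g)`. -/
def weylFun (h g : H) : Fock H :=
  Complex.exp (-((‖h‖ ^ 2 / 2 : ℝ) : ℂ) - inner ℂ h g) • expVec (g + h)

theorem inner_weylFun (h g g' : H) :
    inner ℂ (weylFun h g) (weylFun h g') = inner ℂ (expVec g) (expVec g') := by
  simp only [weylFun, inner_smul_left, inner_smul_right, inner_expVec, ← Complex.exp_conj,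
    ← Complex.exp_add]
  congr 1
  simp only [map_sub, map_neg, Complex.conj_ofReal, inner_conj_symm, inner_add_left,
    inner_add_right, inner_self_eq_norm_sq_to_K]
  push_cast
  simp
  ring

/-- The Weyl operator `W(h)` on `Γ(H)`: the continuous linear extension of
`e(g) ↦ exp (-‖h‖²/2 - ⟪h, g⟫) e(g + h)`, see `weyl_expVec`. -/
def weyl (h : H) : Fock H →L[ℂ] Fock H :=
  (Finsupp.linearCombination ℂ (weylFun h)).extendOfNorm
    (Finsupp.linearCombination ℂ (expVec (H := H)))

theorem weyl_expVec (h g : H) :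
    weyl h (expVec g) =
      Complex.exp (-((‖h‖ ^ 2 / 2 : ℝ) : ℂ) - inner ℂ h g) • expVec (g + h) := by
  have hd : DenseRange (Finsupp.linearCombination ℂ (expVec (H := H))) := by
    have := expVec_total (H := H)
    rw [← Finsupp.range_linearCombination, ← Submodule.dense_iff_topologicalClosure_eq_top] at this
    exact this
  have := LinearMap.extendOfNorm_eq (f := Finsupp.linearCombination ℂ (weylFun h)) hd
    ⟨1, fun c => by rw [one_mul, lift_bound _ _ (inner_weylFun h) c]⟩ (Finsupp.single g 1)
  simpa [weyl, weylFun] using this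

end FockSpace

/-! ### Product systems and their isomorphisms -/

section ProductSystem

/-- The data of a product system over `P`: Hilbert spaces `E(a)`, products `E(a) × E(b) → E(a + b)`
and a σ-algebra on the total space. The laws are in `ProductSystemData.IsProductSystem`. -/
structure ProductSystemData (P : Type u) [AddMonoid P] where
  Fib : P → Type v
  [normed : ∀ a, NormedAddCommGroup (Fib a)]
  [innerProd : ∀ a, InnerProductSpace ℂ (Fib a)]
  mul : ∀ {a b : P}, Fib a → Fib b → Fib (a + b)
  meas : MeasurableSpace (Σ a, Fib a)

attribute [instance] ProductSystemData.normed ProductSystemData.innerProd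

namespace ProductSystemData

variable {P : Type u} [AddMonoid P]

/-- The total space `∐ₐ E(a)`, with the σ-algebra of the product system. -/
def Total (E : ProductSystemData.{u, v} P) : Type (max u v) := Σ a, E.Fib a

instance (E : ProductSystemData.{u, v} P) : MeasurableSpace E.Total := E.meas

/-- A vector of `E(a)`, as a point of the total space. -/
def pt (E : ProductSystemData.{u, v} P) {a : P} (ξ : E.Fib a) : E.Total := ⟨a, ξ⟩

/-- Measurable sections `P → E` of the projection. -/
def IsSection [MeasurableSpace P] (E : ProductSystemData.{u, v} P) (s : ∀ a, E.Fib a) : Prop :=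
  Measurable fun a => E.pt (s a)

/-- The axioms of a product system: a standard Borel total space that is fibred measurably into
non-zero separable Hilbert spaces, with a measurable associative product that induces unitaries
`E(a) ⊗ E(b) → E(a + b)`, for which `E(0) = ℂ` consists of the scalars, and such that the
measurable sections turn `E` into a measurable field of Hilbert spaces. -/
structure IsProductSystem [MeasurableSpace P] (E : ProductSystemData.{u, v} P) : Prop where
  complete : ∀ a, CompleteSpace (E.Fib a)
  separable : ∀ a, TopologicalSpace.SeparableSpace (E.Fib a)
  nontrivial : ∀ a, Nontrivial (E.Fib a)
  standardBorel : StandardBorelSpace E.Total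
  measurable_proj : Measurable fun x : E.Total => x.1
  add_mul : ∀ {a b} (ξ ξ' : E.Fib a) (ζ : E.Fib b),
    E.mul (ξ + ξ') ζ = E.mul ξ ζ + E.mul ξ' ζ
  smul_mul : ∀ {a b} (c : ℂ) (ξ : E.Fib a) (ζ : E.Fib b), E.mul (c • ξ) ζ = c • E.mul ξ ζ
  mul_add : ∀ {a b} (ξ : E.Fib a) (ζ ζ' : E.Fib b),
    E.mul ξ (ζ + ζ') = E.mul ξ ζ + E.mul ξ ζ'
  mul_smul : ∀ {a b} (c : ℂ) (ξ : E.Fib a) (ζ : E.Fib b), E.mul ξ (c • ζ) = c • E.mul ξ ζ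
  inner_mul : ∀ {a b} (ξ ξ' : E.Fib a) (ζ ζ' : E.Fib b),
    inner ℂ (E.mul ξ ζ) (E.mul ξ' ζ') = inner ℂ ξ ξ' * inner ℂ ζ ζ'
  total_mul : ∀ a b, (Submodule.span ℂ
    {x : E.Fib (a + b) | ∃ (ξ : E.Fib a) (ζ : E.Fib b), x = E.mul ξ ζ}).topologicalClosure = ⊤
  mul_assoc : ∀ {a b c} (ξ : E.Fib a) (ζ : E.Fib b) (χ : E.Fib c),
    E.pt (E.mul (E.mul ξ ζ) χ) = E.pt (E.mul ξ (E.mul ζ χ))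
  exists_unit : ∃ e : E.Fib 0, (∀ ξ : E.Fib 0, ∃ c : ℂ, ξ = c • e) ∧
    ∀ a (ξ : E.Fib a), E.pt (E.mul e ξ) = E.pt ξ ∧ E.pt (E.mul ξ e) = E.pt ξ
  measurable_mul : Measurable fun x : E.Total × E.Total => E.pt (E.mul x.1.2 x.2.2)
  measurable_inner : ∀ s t, E.IsSection s → E.IsSection t →
    Measurable fun a => inner ℂ (s a) (t a)
  isSection_of_inner : ∀ s, (∀ t, E.IsSection t → Measurable fun a => inner ℂ (s a) (t a)) →
    E.IsSection s
  exists_fundamental : ∃ s : ℕ → ∀ a, E.Fib a, (∀ n, E.IsSection (s n)) ∧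
    ∀ a, (Submodule.span ℂ (Set.range fun n => s n a)).topologicalClosure = ⊤

/-- Isomorphisms of product systems: unitaries `E(a) → F(a)` that respect the products and are
measurable, together with their inverses, on the total spaces. -/
structure Iso (E : ProductSystemData.{u, v} P) (F : ProductSystemData.{u, w} P) where
  toEquiv : ∀ a, E.Fib a ≃ₗᵢ[ℂ] F.Fib a
  map_mul : ∀ {a b} (ξ : E.Fib a) (ζ : E.Fib b),
    toEquiv (a + b) (E.mul ξ ζ) = F.mul (toEquiv a ξ) (toEquiv b ζ)
  measurable_toFun : Measurable fun x : E.Total => F.pt (toEquiv x.1 x.2)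
  measurable_invFun : Measurable fun y : F.Total => E.pt ((toEquiv y.1).symm y.2)

end ProductSystemData
end ProductSystem

/-! ### E₀-semigroups and their product systems -/

section E0

variable (P : Type u) [AddCommMonoid P] [TopologicalSpace P]
variable (K : Type v) [NormedAddCommGroup K] [InnerProductSpace ℂ K] [CompleteSpace K]

/-- Normality of a linear map on `B(K)`: composed with the vector functionals it gives normal
functionals, i.e. functionals `A ↦ ∑ₙ ⟪xₙ, A yₙ⟫` with `∑ ‖xₙ‖² < ∞` and `∑ ‖yₙ‖² < ∞`. -/
def IsNormalMap {K : Type v} [NormedAddCommGroup K] [InnerProductSpace ℂ K]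
    (φ : (K →L[ℂ] K) → (K →L[ℂ] K)) : Prop :=
  ∀ ξ ζ : K, ∃ x y : ℕ → K, Summable (fun n => ‖x n‖ ^ 2) ∧ Summable (fun n => ‖y n‖ ^ 2) ∧
    ∀ A : K →L[ℂ] K, HasSum (fun n => inner ℂ (x n) (A (y n))) (inner ℂ ξ (φ A ζ))

/-- An E₀-semigroup over `P` on `B(K)`: a weakly continuous semigroup of normal unital
`*`-endomorphisms of `B(K)`. -/
structure E0Semigroup where
  toFun : P → (K →L[ℂ] K) →⋆ₐ[ℂ] (K →L[ℂ] K)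
  map_zero : ∀ A, toFun 0 A = A
  map_add : ∀ a b A, toFun (a + b) A = toFun a (toFun b A)
  normal : ∀ a, IsNormalMap (toFun a)
  continuous : ∀ (A : K →L[ℂ] K) (ξ ζ : K), Continuous fun a => inner ℂ ξ (toFun a A ζ)

variable {P K}
namespace E0Semigroup

/-- The intertwiner space `{T ∈ B(K) : α_a(A) T = T A for all A}`. -/
def fiber (α : E0Semigroup P K) (a : P) : Submodule ℂ (K →L[ℂ] K) where
  carrier := {T | ∀ A, α.toFun a A * T = T * A}
  zero_mem' := fun A => by simp
  add_mem' := fun {S T} hS hT A => by rw [mul_add, add_mul, hS A, hT A]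
  smul_mem' := fun c T hT A => by rw [mul_smul_comm, smul_mul_assoc, hT A]

theorem exists_scalar (α : E0Semigroup P K) {a : P} (S T : α.fiber a) :
    ∃ c : ℂ, star (S : K →L[ℂ] K) * (T : K →L[ℂ] K) = c • 1 := by
  have h : star (S : K →L[ℂ] K) * (T : K →L[ℂ] K) ∈ Subalgebra.center ℂ (K →L[ℂ] K) := by
    rw [Subalgebra.mem_center_iff]
    intro A
    have h1 : star (S : K →L[ℂ] K) * α.toFun a A = A * star (S : K →L[ℂ] K) := by
      have := congrArg star (S.2 (star A))
      simpa [star_mul, ← map_star] using this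
    rw [_root_.mul_assoc, ← T.2 A, ← _root_.mul_assoc, ← _root_.mul_assoc, h1]
  rw [Algebra.IsCentral.center_eq_bot, Algebra.mem_bot] at h
  obtain ⟨c, hc⟩ := h
  exact ⟨c, by rw [← hc, Algebra.algebraMap_eq_smul_one]⟩

/-- The inner product of intertwiners, given by `S* T = ⟪S, T⟫ 1`. -/
def fiberInner (α : E0Semigroup P K) {a : P} (S T : α.fiber a) : ℂ :=
  (α.exists_scalar S T).choose

theorem fiberInner_spec (α : E0Semigroup P K) {a : P} (S T : α.fiber a) :
    star (S : K →L[ℂ] K) * (T : K →L[ℂ] K) = α.fiberInner S T • 1 :=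
  (α.exists_scalar S T).choose_spec

variable [Nontrivial K]

theorem fiberInner_eq (α : E0Semigroup P K) {a : P} (S T : α.fiber a) (c : ℂ)
    (h : star (S : K →L[ℂ] K) * (T : K →L[ℂ] K) = c • 1) : α.fiberInner S T = c := by
  rw [α.fiberInner_spec] at h
  exact smul_left_injective ℂ one_ne_zero h

/-- The intertwiner space with `S* T = ⟪S, T⟫ 1`; the associated norm is the operator norm. -/
instance fiberInnerProductSpace (α : E0Semigroup P K) (a : P) :
    InnerProductSpace ℂ (α.fiber a) where
  inner := α.fiberInner
  norm_sq_eq_re_inner := fun T => by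
    have h := congrArg norm (α.fiberInner_spec T T)
    rw [CStarRing.norm_star_mul_self, norm_smul, norm_one, mul_one] at h
    obtain ⟨v, hv⟩ := exists_ne (0 : K)
    have h2 := congrArg (fun A : K →L[ℂ] K => inner ℂ v (A v)) (α.fiberInner_spec T T)
    simp only [ContinuousLinearMap.star_eq_adjoint, mul_apply_eq_comp,
      ContinuousLinearMap.adjoint_inner_right, smul_apply,
      one_apply_eq_self, inner_smul_right, inner_self_eq_norm_sq_to_K] at h2
    have hv' : (0 : ℝ) < ‖v‖ ^ 2 := by positivity
    have h3 : α.fiberInner T T = ((‖(T : K →L[ℂ] K) v‖ ^ 2 / ‖v‖ ^ 2 : ℝ) : ℂ) := by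
      push_cast
      rw [eq_div_iff (by exact_mod_cast hv'.ne')]
      exact h2.symm
    have h4 : 0 ≤ ‖(T : K →L[ℂ] K) v‖ ^ 2 / ‖v‖ ^ 2 := by positivity
    rw [h3] at h ⊢
    rw [Complex.norm_real, Real.norm_of_nonneg h4] at h
    rw [sq, RCLike.re_eq_complex_re, Complex.ofReal_re]
    exact h
  conj_inner_symm := fun S T => by
    symm
    apply α.fiberInner_eq
    have := congrArg star (α.fiberInner_spec T S)
    simpa [star_mul] using this
  add_left := fun S T R => by
    apply α.fiberInner_eq
    simp only [Submodule.coe_add, star_add, add_mul, α.fiberInner_spec, add_smul]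
  smul_left := fun S T c => by
    apply α.fiberInner_eq
    simp only [Submodule.coe_smul, star_smul, smul_mul_assoc, α.fiberInner_spec, smul_smul]
    rfl

/-- The product system of an E₀-semigroup: the intertwiner spaces with the composition of
operators, the total space carrying the σ-algebra that `P` and the weak operator topology induce. -/
def productSystem [MeasurableSpace P] (α : E0Semigroup P K) : ProductSystemData.{u, v} P where
  Fib a := α.fiber a
  mul {a b} S T := ⟨(S : K →L[ℂ] K) * (T : K →L[ℂ] K), fun A => by
    rw [α.map_add, ← _root_.mul_assoc, S.2, _root_.mul_assoc, T.2, _root_.mul_assoc]⟩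
  meas := MeasurableSpace.comap (fun x => x.1) inferInstance ⊔
    ⨆ (ξ : K) (ζ : K),
      MeasurableSpace.comap (fun x => inner ℂ ξ ((x.2 : K →L[ℂ] K) ζ)) inferInstance
end E0Semigroup
end E0

/-! ### The product system of a Poisson process -/

section Poisson

/-- `η` is a Poisson process with intensity measure `lam`: a random `ℕ ∪ {∞}`-valued σ-finite
measure such that `η(B)` is Poisson distributed with parameter `lam B` (hence `η(B) = ∞` almost
surely if `lam B = ∞`), and completely independent. -/
structure IsPoissonProcess {Y : Type u} [MeasurableSpace Y] {Ω : Type v} [MeasurableSpace Ω]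
    (η : Ω → Measure Y) (lam : Measure Y) (Pr : Measure Ω) : Prop where
  measurable : Measurable η
  sigmaFinite : ∀ ω, SigmaFinite (η ω)
  integerValued : ∀ ω B, MeasurableSet B → ∃ n : ℕ∞, η ω B = n
  law : ∀ B, MeasurableSet B → lam B ≠ ∞ → ∀ k : ℕ,
    Pr {ω | η ω B = k} =
      ENNReal.ofReal ((lam B).toReal ^ k / k.factorial * Real.exp (-(lam B).toReal))
  law_top : ∀ B, MeasurableSet B → lam B = ∞ → ∀ k : ℕ, Pr {ω | η ω B = k} = 0
  indep : ∀ (n : ℕ) (B : Fin n → Set Y), (∀ i, MeasurableSet (B i)) →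
    Pairwise (fun i j => Disjoint (B i) (B j)) → iIndepFun (fun i ω => η ω (B i)) Pr

variable {Y : Type u} [MeasurableSpace Y] {Ω : Type v}

/-- The σ-algebra generated by the random variables `η(B)`, for `B ⊆ D` measurable. -/
@[reducible] def countAlgebra (η : Ω → Measure Y) (D : Set Y) : MeasurableSpace Ω :=
  ⨆ (B : Set Y) (_ : MeasurableSet B ∧ B ⊆ D),
    MeasurableSpace.comap (fun ω => η ω B) inferInstance

variable [MeasurableSpace Ω]

/-- Up to null sets, the σ-algebra of `Ω` is generated by the random variables `η(B)`. -/
def IsGeneratedBy (η : Ω → Measure Y) (Pr : Measure Ω) : Prop :=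
  ∀ A : Set Ω, MeasurableSet A →
    ∃ A' : Set Ω, MeasurableSet[countAlgebra η Set.univ] A' ∧ A =ᵐ[Pr] A'

variable {d : ℕ} [AddAction (EuclideanSpace ℝ (Fin d)) Y]

/-- The set `X \ (X + a)`. -/
def slab (X : Set Y) (a : EuclideanSpace ℝ (Fin d)) : Set Y := X \ (a +ᵥ X)

variable (P : PointedCone ℝ (EuclideanSpace ℝ (Fin d)))

/-- `S c`, for `c ∈ P`, is the unitary on `L²(Ω)` with
`S c (F(η(B₁), …, η(Bₙ))) = F(η(B₁ + c), …, η(Bₙ + c))`. -/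
def IsShift (η : Ω → Measure Y) (Pr : Measure Ω) (S : P → (Lp ℂ 2 Pr ≃ₗᵢ[ℂ] Lp ℂ 2 Pr)) : Prop :=
  ∀ (c : P) (n : ℕ) (B : Fin n → Set Y) (F : (Fin n → ℝ≥0∞) → ℂ),
    (∀ i, MeasurableSet (B i)) → Measurable F →
    ∀ g : Lp ℂ 2 Pr, (g =ᵐ[Pr] fun ω => F fun i => η ω (B i)) →
      (S c g : Ω → ℂ) =ᵐ[Pr] fun ω =>
        F fun i => η ω ((c : EuclideanSpace ℝ (Fin d)) +ᵥ B i)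

variable {P}

/-- `E(a) = L²(Ω, 𝓕_a)`, where `𝓕_a` is generated by the `η(B)` with `B ⊆ X \ (X + a)`, as the
space of those elements of `L²(Ω)` that have an `𝓕_a`-measurable version. (This does not change
if `𝓕_a` is completed.) -/
abbrev poissonFiber (η : Ω → Measure Y) (Pr : Measure Ω) (X : Set Y) (a : P) :
    Submodule ℂ (Lp ℂ 2 Pr) :=
  lpMeas ℂ ℂ (countAlgebra η (slab X (a : EuclideanSpace ℝ (Fin d)))) 2 Pr

open Classical in
/-- The product `f · S_a g` of `f ∈ E(a)` and `g ∈ E(b)`, as an element of `E(a + b)`. -/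
def poissonMul (η : Ω → Measure Y) (Pr : Measure Ω) (X : Set Y)
    (S : P → (Lp ℂ 2 Pr ≃ₗᵢ[ℂ] Lp ℂ 2 Pr)) {a b : P}
    (f : poissonFiber η Pr X a) (g : poissonFiber η Pr X b) : poissonFiber η Pr X (a + b) :=
  if h : ∃ k : poissonFiber η Pr X (a + b),
      ((k : Lp ℂ 2 Pr) : Ω → ℂ) =ᵐ[Pr]
        fun ω => (f : Lp ℂ 2 Pr) ω * (S a (g : Lp ℂ 2 Pr) : Lp ℂ 2 Pr) ω
  then h.choose else 0

/-- The product system of the Poisson process; its total space carries the σ-algebra of a subset of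
`P × L²(Ω)`. -/
def poissonSystem (η : Ω → Measure Y) (Pr : Measure Ω) (X : Set Y)
    (S : P → (Lp ℂ 2 Pr ≃ₗᵢ[ℂ] Lp ℂ 2 Pr)) : ProductSystemData P where
  Fib a := poissonFiber η Pr X a
  mul f g := poissonMul η Pr X S f g
  meas := MeasurableSpace.comap (fun x => (x.1, (x.2 : Lp ℂ 2 Pr)))
    (@Prod.instMeasurableSpace P (Lp ℂ 2 Pr) inferInstance (borel _))

/-- A vector of `E(a)`, as an element of `L²(Ω)`. -/
def poissonVec {η : Ω → Measure Y} {Pr : Measure Ω} {X : Set Y}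
    {S : P → (Lp ℂ 2 Pr ≃ₗᵢ[ℂ] Lp ℂ 2 Pr)} {a : P} (ξ : (poissonSystem η Pr X S).Fib a) :
    Lp ℂ 2 Pr :=
  (show poissonFiber η Pr X a from ξ)

end Poisson

/-! ### Normalized exponentials -/

section Exponentials

variable {Y : Type u} [MeasurableSpace Y] (lam : Measure Y) (X : Set Y)

/-- The square integrable complex simple functions on `X` that avoid the value `-1`, extended by
zero to `Y`. -/
structure SimpleTest where
  toFun : SimpleFunc Y ℂ
  eq_zero : ∀ y ∉ X, toFun y = 0
  memLp : MemLp toFun 2 lam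
  ne_neg_one : ∀ y, toFun y ≠ -1

variable {lam X}

/-- The class in `L²(X, lam)`. -/
def SimpleTest.toL2 (φ : SimpleTest lam X) : Lp ℂ 2 (lam.restrict X) :=
  (φ.memLp.restrict X).toLp φ.toFun

/-- The function `u_f = ℓ(1 + f)`. -/
def SimpleTest.logOne (ℓ : ℂ → ℂ) (φ : SimpleTest lam X) (y : Y) : ℂ := ℓ (1 + φ.toFun y)

variable {Ω : Type v} [MeasurableSpace Ω]

/-- The random variable `exp (η(u_f))`. -/
def SimpleTest.expFun (ℓ : ℂ → ℂ) (η : Ω → Measure Y) (φ : SimpleTest lam X) (ω : Ω) : ℂ :=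
  Complex.exp (∫ y, φ.logOne ℓ y ∂(η ω))

/-- The random variable `exp (η(u_f)) / 𝔼 (exp (η(u_f)))`. -/
def SimpleTest.normExpFun (ℓ : ℂ → ℂ) (η : Ω → Measure Y) (Pr : Measure Ω) (φ : SimpleTest lam X)
    (ω : Ω) : ℂ :=
  φ.expFun ℓ η ω / ∫ ω', φ.expFun ℓ η ω' ∂Pr

open Classical in
/-- `Σ_f ∈ L²(Ω)` for a simple function `f`. -/
def SimpleTest.normExp (ℓ : ℂ → ℂ) (η : Ω → Measure Y) (Pr : Measure Ω) (φ : SimpleTest lam X) :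
    Lp ℂ 2 Pr :=
  if h : MemLp (φ.normExpFun ℓ η Pr) 2 Pr then h.toLp _ else 0

/-- `Σ_f ∈ L²(Ω)` for `f ∈ L²(X, lam)`: the limit of `Σ_φ` along the simple `φ` that converge to
`f` in `L²(X, lam)`. -/
def normExp (ℓ : ℂ → ℂ) (η : Ω → Measure Y) (Pr : Measure Ω) (f : Lp ℂ 2 (lam.restrict X)) :
    Lp ℂ 2 Pr :=
  limUnder (Filter.comap (SimpleTest.toL2 (lam := lam) (X := X)) (𝓝 f))
    (SimpleTest.normExp ℓ η Pr)

/-- The normalized exponentials are well defined: `exp (η(u_φ))` is square integrable with non-zero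
expectation for simple `φ`, the simple `φ` are dense in `L²(X, lam)`, and `Σ_φ → Σ_f` whenever
`φ → f` in `L²(X, lam)`. -/
structure NormExpWellDefined (lam : Measure Y) (X : Set Y) (ℓ : ℂ → ℂ) (η : Ω → Measure Y)
    (Pr : Measure Ω) : Prop where
  memLp : ∀ φ : SimpleTest lam X, MemLp (φ.expFun ℓ η) 2 Pr
  expectation_ne_zero : ∀ φ : SimpleTest lam X, ∫ ω, φ.expFun ℓ η ω ∂Pr ≠ 0
  dense : DenseRange (SimpleTest.toL2 (lam := lam) (X := X))
  tendsto : ∀ f : Lp ℂ 2 (lam.restrict X),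
    Tendsto (SimpleTest.normExp (lam := lam) (X := X) ℓ η Pr)
      (Filter.comap (SimpleTest.toL2 (lam := lam) (X := X)) (𝓝 f)) (𝓝 (normExp ℓ η Pr f))

end Exponentials

/-! ### The isometric representation on `L²(X, lam)` -/

section Translation

open Classical in
/-- The function `y ↦ f(y - a)` if `y - a ∈ X`, and `0` otherwise. -/
def translateFun {Y : Type u} {d : ℕ}
    [AddAction (EuclideanSpace ℝ (Fin d)) Y] (X : Set Y)
    (a : EuclideanSpace ℝ (Fin d)) (f : Y → ℂ) (y : Y) : ℂ :=
  if -a +ᵥ y ∈ X then f (-a +ᵥ y) else 0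

theorem translateFun_eq {Y : Type u} {d : ℕ}
    [AddAction (EuclideanSpace ℝ (Fin d)) Y] (X : Set Y) (a : EuclideanSpace ℝ (Fin d)) (f : Y → ℂ) :
    translateFun X a f = (a +ᵥ X).indicator (f ∘ fun y => -a +ᵥ y) := by
  ext y
  by_cases h : y ∈ a +ᵥ X
  · rw [Set.indicator_of_mem h, translateFun, if_pos (Set.mem_vadd_set_iff_neg_vadd_mem.mp h)]
    rfl
  · rw [Set.indicator_of_notMem h, translateFun,
      if_neg (fun h' => h (Set.mem_vadd_set_iff_neg_vadd_mem.mpr h'))]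

variable {Y : Type u} [MeasurableSpace Y] {d : ℕ} [AddAction (EuclideanSpace ℝ (Fin d)) Y]
  [MeasurableVAdd₂ (EuclideanSpace ℝ (Fin d)) Y] {lam : Measure Y}
  [VAddInvariantMeasure (EuclideanSpace ℝ (Fin d)) Y lam] {X : Set Y}
  {P : PointedCone ℝ (EuclideanSpace ℝ (Fin d))}

theorem translate_measurePreserving (hX : MeasurableSet X) {a : EuclideanSpace ℝ (Fin d)}
    (ha : ∀ x ∈ X, a +ᵥ x ∈ X) :
    MeasurePreserving (fun y : Y => -a +ᵥ y) ((lam.restrict X).restrict (a +ᵥ X))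
      (lam.restrict X) := by
  have h1 : a +ᵥ X = (fun y : Y => -a +ᵥ y) ⁻¹' X := (Set.preimage_vadd_neg a X).symm
  have h2 : MeasurableSet (a +ᵥ X) := by
    rw [h1]; exact (measurable_const_vadd (-a)) hX
  have h3 : a +ᵥ X ⊆ X := by
    rintro _ ⟨x, hx, rfl⟩
    exact ha x hx
  rw [Measure.restrict_restrict h2, Set.inter_eq_left.mpr h3, h1]
  exact (measurePreserving_vadd (-a) lam).restrict_preimage hX

theorem measurableSet_translate (hX : MeasurableSet X) (a : EuclideanSpace ℝ (Fin d)) :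
    MeasurableSet (a +ᵥ X) := by
  rw [← Set.preimage_vadd_neg]; exact (measurable_const_vadd (-a)) hX

theorem translateFun_congr (hX : MeasurableSet X) {a : EuclideanSpace ℝ (Fin d)}
    (ha : ∀ x ∈ X, a +ᵥ x ∈ X) {f g : Y → ℂ} (h : f =ᵐ[lam.restrict X] g) :
    translateFun X a f =ᵐ[lam.restrict X] translateFun X a g := by
  rw [translateFun_eq, translateFun_eq]
  have := (translate_measurePreserving (lam := lam) hX ha).quasiMeasurePreserving.ae_eq_comp h
  rw [Filter.EventuallyEq, ae_restrict_iff' (measurableSet_translate hX a)] at this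
  filter_upwards [this] with y hy
  by_cases h : y ∈ a +ᵥ X
  · rw [Set.indicator_of_mem h, Set.indicator_of_mem h, hy h]
  · rw [Set.indicator_of_notMem h, Set.indicator_of_notMem h]

theorem eLpNorm_translateFun (hX : MeasurableSet X) {a : EuclideanSpace ℝ (Fin d)}
    (ha : ∀ x ∈ X, a +ᵥ x ∈ X) (f : Lp ℂ 2 (lam.restrict X)) :
    eLpNorm (translateFun X a f) 2 (lam.restrict X) = eLpNorm f 2 (lam.restrict X) := by
  rw [translateFun_eq, eLpNorm_indicator_eq_eLpNorm_restrict (measurableSet_translate hX a)]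
  exact eLpNorm_comp_measurePreserving (Lp.aestronglyMeasurable f)
    (translate_measurePreserving hX ha)

theorem memLp_translateFun (hX : MeasurableSet X) {a : EuclideanSpace ℝ (Fin d)}
    (ha : ∀ x ∈ X, a +ᵥ x ∈ X) (f : Lp ℂ 2 (lam.restrict X)) :
    MemLp (translateFun X a f) 2 (lam.restrict X) := by
  rw [translateFun_eq, memLp_indicator_iff_restrict (measurableSet_translate hX a)]
  exact (Lp.memLp f).comp_measurePreserving (translate_measurePreserving hX ha)

/-- The isometry `V_a` of `L²(X, lam)`: `(V_a f)(y) = f(y - a)` if `y - a ∈ X`, and `0` otherwise. -/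
def translation (hX : MeasurableSet X) (hXP : ∀ a ∈ P, ∀ x ∈ X, a +ᵥ x ∈ X) (a : P) :
    Lp ℂ 2 (lam.restrict X) →ₗᵢ[ℂ] Lp ℂ 2 (lam.restrict X) where
  toFun f := (memLp_translateFun hX (hXP a a.2) f).toLp _
  map_add' f g := by
    rw [← MemLp.toLp_add]
    apply MemLp.toLp_congr
    refine (translateFun_congr hX (hXP a a.2) (Lp.coeFn_add f g)).trans (ae_of_all _ fun y => ?_)
    by_cases h : -(a : EuclideanSpace ℝ (Fin d)) +ᵥ y ∈ X <;> simp [translateFun, h]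
  map_smul' c f := by
    rw [RingHom.id_apply, ← MemLp.toLp_const_smul]
    apply MemLp.toLp_congr
    refine (translateFun_congr hX (hXP a a.2) (Lp.coeFn_smul c f)).trans
      (ae_of_all _ fun y => ?_)
    by_cases h : -(a : EuclideanSpace ℝ (Fin d)) +ᵥ y ∈ X <;> simp [translateFun, h]
  norm_map' f := by
    simp only [LinearMap.coe_mk, AddHom.coe_mk, Lp.norm_toLp]
    rw [eLpNorm_translateFun hX (hXP a a.2), Lp.norm_def]

/-- The subspace `L²(X \ (X + a))` of `L²(X, lam)`. -/
def slabL2 (lam : Measure Y) (X : Set Y) (a : EuclideanSpace ℝ (Fin d)) :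
    Submodule ℂ (Lp ℂ 2 (lam.restrict X)) where
  carrier := {f | ∀ᵐ y ∂(lam.restrict X), y ∉ slab X a → f y = 0}
  zero_mem' := by
    filter_upwards [Lp.coeFn_zero ℂ 2 (lam.restrict X)] with y hy _
    rw [hy]; rfl
  add_mem' := fun {f g} hf hg => by
    filter_upwards [hf, hg, Lp.coeFn_add f g] with y h1 h2 h3 hy
    rw [h3, Pi.add_apply, h1 hy, h2 hy, add_zero]
  smul_mem' := fun c f hf => by
    filter_upwards [hf, Lp.coeFn_smul c f] with y h1 h2 hy
    rw [h2, Pi.smul_apply, h1 hy, smul_zero]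

/-- Strongly continuous semigroups of isometries. -/
structure IsIsometricRepresentation {H : Type w} [NormedAddCommGroup H] [InnerProductSpace ℂ H]
    (V : P → (H →ₗᵢ[ℂ] H)) : Prop where
  map_zero : ∀ f, V 0 f = f
  map_add : ∀ a b f, V (a + b) f = V a (V b f)
  continuous : ∀ f, Continuous fun a => V a f

/-- `α` is the CCR flow of `V`: the E₀-semigroup on `B(Γ(H))` with `α_a(W(h)) = W(V_a h)`. -/
def IsCCRFlow {H : Type w} [NormedAddCommGroup H] [InnerProductSpace ℂ H]
    (V : P → (H →ₗᵢ[ℂ] H)) (α : E0Semigroup P (Fock H)) : Prop :=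
  ∀ a h, α.toFun a (weyl h) = weyl (V a h)

end Translation

end PoissonProductSystem

end

open PoissonProductSystem

/-!
The proof computes both product systems on total families of vectors.

*The CCR side.* For an isometry `V` of `H` and `perp V = (ran V)ᗮ`, the operators
`fockMul V ξ` with `fockMul V (e(f)) e(g) = e(f + V g)`, `f ∈ perp V`, satisfy
`(fockMul V ξ)* (fockMul V ζ) = ⟪ξ, ζ⟫ 1` and have jointly total ranges. This gives the normal
endomorphism `fockEndo V` with `fockEndo V (A) (fockMul V ξ) = (fockMul V ξ) A`, hence the CCR flow
`ccrFlow`, and it identifies its intertwiner space at `a` with `Γ(perp (V a))` (`fockFiber`). An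
intertwiner `T` is determined by `T e(0)`, through an explicit formula for its matrix elements
(`inner_fiber_expVec`), so that the total space is a Borel subset of `P × Γ(H)`; here the strong
continuity of `V` and of `V*` enters. For the translations on `L²(X)` both follow from the strong
continuity of the translations of `L²(Y)`, which are measurable by Fubini's theorem and therefore
continuous by Steinhaus' theorem (`continuous_fullTranslation`). The space `perp (V a)` is
`L²(X \ (X + a))` (`slabL2_eq_perp`).

*The Poisson side.* For simple `φ` the Laplace functional
(`IsPoissonProcess.integrable_exp_integral`) gives `⟪Σ_φ, Σ_ψ⟫ = exp ⟪φ, ψ⟫`. Hence there is an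
isometry `J : Γ(L²(X)) → L²(Ω)` with `J e(φ) = Σ_φ` (`exists_expIsometry`), and `Σ_f = J e(f)` for
all `f`. The characters `exp (i ∑ cⱼ η(Bⱼ))` are multiples of normalized exponentials, and
characteristic functions determine finite laws on the space of measures
(`measure_ext_of_characteristic`). So the `Σ_φ` with `φ` supported in `D` are total in `L²` of the
σ-algebra of the counts in `D` (`IsPoissonProcess.isTotal_normExp`), and the law of `η` is invariant
under translations, which gives the shifts `S_a` (`exists_isShift`). Moreover
`S_a J e(f) = J e(V_a f)`.

*The isomorphism.* It is `θ_a T = J (T e(0))`. Functions with disjoint supports have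
`Σ_{f + g} = Σ_f Σ_g`, so `J e(f + V_a g) = J e(f) · S_a J e(g)` for `f ∈ L²(X \ (X + a))`, and by
density in `L¹` the map `θ` is multiplicative (`coeFn_expIsometry_mul`). It is unitary since it maps
the total family of the `fockMul (V a) (e(f))` to the total family of the `Σ_f`. The laws of a
product system are then transported from the CCR side to the Poisson side
(`ProductSystemData.IsProductSystem.of_iso`).
-/

set_option linter.unusedSectionVars false

noncomputable section

namespace PoissonProductSystem

universe u v w

/-! ### Total families in Hilbert spaces -/

section Total

variable {K : Type*} [NormedAddCommGroup K] [InnerProductSpace ℂ K]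
  {K' : Type*} [NormedAddCommGroup K'] [InnerProductSpace ℂ K']

/-- A family of vectors is total if its linear span is dense. -/
def IsTotal {ι : Type*} (x : ι → K) : Prop := Dense (Submodule.span ℂ (Set.range x) : Set K)

theorem isTotal_iff {ι : Type*} {x : ι → K} :
    IsTotal x ↔ (Submodule.span ℂ (Set.range x)).topologicalClosure = ⊤ :=
  Submodule.dense_iff_topologicalClosure_eq_top

theorem IsTotal.clm_ext {ι : Type*} {x : ι → K} (hx : IsTotal x) {F : Type*}
    [NormedAddCommGroup F] [NormedSpace ℂ F] {S T : K →L[ℂ] F} (h : ∀ i, S (x i) = T (x i)) :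
    S = T :=
  ContinuousLinearMap.ext_on hx (by rintro _ ⟨i, rfl⟩; exact h i)

theorem IsTotal.ext_inner {ι : Type*} {x : ι → K} (hx : IsTotal x) {v w : K}
    (h : ∀ i, inner ℂ (x i) v = inner ℂ (x i) w) : v = w := by
  have : innerSL ℂ v = innerSL ℂ w := hx.clm_ext fun i => by
    have := congrArg conj (h i)
    simpa only [inner_conj_symm, innerSL_apply_apply] using this
  refine ext_inner_right ℂ fun u => ?_
  simpa using congrArg (fun T => T u) this

theorem isTotal_of_inner_eq_zero [CompleteSpace K] {ι : Type*} {x : ι → K}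
    (h : ∀ v, (∀ i, inner ℂ (x i) v = 0) → v = 0) : IsTotal x := by
  rw [isTotal_iff, Submodule.topologicalClosure_eq_top_iff, Submodule.eq_bot_iff]
  intro v hv
  exact h v fun i => hv _ (Submodule.subset_span ⟨i, rfl⟩)

theorem IsTotal.of_closure {ι κ : Type*} {x : ι → K} (hx : IsTotal x) {y : κ → K}
    (h : ∀ i, x i ∈ (Submodule.span ℂ (Set.range y)).topologicalClosure) : IsTotal y := by
  rw [isTotal_iff] at hx ⊢
  rw [eq_top_iff, ← hx]
  refine Submodule.topologicalClosure_minimal _ (Submodule.span_le.2 ?_)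
    (Submodule.isClosed_topologicalClosure _)
  rintro _ ⟨i, rfl⟩
  exact h i

theorem IsTotal.mem_of_isClosed {ι : Type*} {x : ι → K} (hx : IsTotal x)
    {p : Submodule ℂ K} (hp : IsClosed (p : Set K)) (h : ∀ i, x i ∈ p) (v : K) : v ∈ p := by
  have : (⊤ : Submodule ℂ K) ≤ p := by
    rw [← isTotal_iff.1 hx]
    exact Submodule.topologicalClosure_minimal _
      (Submodule.span_le.2 (by rintro _ ⟨i, rfl⟩; exact h i)) hp
  exact this trivial

/-- A total family may be replaced along a dense range of parameters. -/
theorem IsTotal.comp_denseRange {ι κ : Type*} [TopologicalSpace ι] {x : ι → K} (hx : IsTotal x)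
    (hc : Continuous x) {r : κ → ι} (hr : DenseRange r) : IsTotal (x ∘ r) :=
  hx.of_closure fun i => by
    have h1 : x i ∈ closure (Set.range (x ∘ r)) := by
      rw [Set.range_comp]
      exact image_closure_subset_closure_image hc ⟨i, hr i, rfl⟩
    rw [← SetLike.mem_coe, Submodule.topologicalClosure_coe]
    exact closure_mono Submodule.subset_span h1

theorem IsTotal.denseRange {ι : Type*} {x : ι → K} (hx : IsTotal x) :
    DenseRange (Finsupp.linearCombination ℂ x) := by
  rw [IsTotal, ← Finsupp.range_linearCombination] at hx
  exact hx

theorem IsTotal.separableSpace {ι : Type*} [Countable ι] {x : ι → K} (hx : IsTotal x) :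
    TopologicalSpace.SeparableSpace K := by
  have := ((Set.countable_range x).isSeparable.span (R := ℂ)).closure
  rw [hx.closure_eq] at this
  exact TopologicalSpace.isSeparable_univ_iff.1 this

/-- Families with equal Gram matrices differ by an isometry. -/
theorem IsTotal.exists_isometry [CompleteSpace K'] {ι : Type*} {x : ι → K} (hx : IsTotal x)
    {y : ι → K'} (h : ∀ i j, inner ℂ (y i) (y j) = inner ℂ (x i) (x j)) :
    ∃ J : K →ₗᵢ[ℂ] K', ∀ i, J (x i) = y i := by
  set f := Finsupp.linearCombination ℂ y
  set e := Finsupp.linearCombination ℂ x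
  have hd : DenseRange e := hx.denseRange
  have key : ∀ c, f.extendOfNorm e (e c) = f c := LinearMap.extendOfNorm_eq hd
    ⟨1, fun c => by rw [one_mul, lift_bound _ _ h c]⟩
  refine ⟨⟨(f.extendOfNorm e).toLinearMap, fun v => ?_⟩, fun i => ?_⟩
  · refine hd.induction_on (p := fun v => ‖(f.extendOfNorm e) v‖ = ‖v‖) v
      (isClosed_eq (by fun_prop) (by fun_prop)) fun c => ?_
    rw [key c, lift_bound _ _ h c]
  · have := key (Finsupp.single i 1)
    simpa [f, e] using this

theorem IsTotal.exists_equiv [CompleteSpace K] [CompleteSpace K'] {ι : Type*} {x : ι → K}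
    (hx : IsTotal x) {y : ι → K'} (hy : IsTotal y)
    (h : ∀ i j, inner ℂ (y i) (y j) = inner ℂ (x i) (x j)) :
    ∃ J : K ≃ₗᵢ[ℂ] K', ∀ i, J (x i) = y i := by
  obtain ⟨J, hJ⟩ := hx.exists_isometry h
  refine ⟨LinearIsometryEquiv.ofSurjective J fun v => ?_, hJ⟩
  have hc : IsClosed (LinearMap.range J.toLinearMap : Set K') := by
    have h2 : (LinearMap.range J.toLinearMap : Set K') = Set.range J := by ext; simp
    rw [h2]; exact J.isometry.isClosedEmbedding.isClosed_range
  obtain ⟨u, hu⟩ := hy.mem_of_isClosed hc (fun i => ⟨x i, hJ i⟩) v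
  exact ⟨u, hu⟩

/-- A map into a separable Hilbert space is measurable if its inner products with the elements of
a total family are. -/
theorem IsTotal.measurable [TopologicalSpace.SeparableSpace K]
    [MeasurableSpace K] [BorelSpace K] {ι : Type*} {x : ι → K} (hx : IsTotal x)
    {α : Type*} [MeasurableSpace α] {f : α → K}
    (h : ∀ i, Measurable fun a => inner ℂ (x i) (f a)) : Measurable f := by
  have : SecondCountableTopology K := UniformSpace.secondCountable_of_separable K
  have hall : ∀ k, Measurable fun a => inner ℂ k (f a) := by
    intro k
    have hk := hx k
    rw [mem_closure_iff_seq_limit] at hk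
    obtain ⟨s, hs, hsk⟩ := hk
    refine measurable_of_tendsto_metrizable (f := fun n a => inner ℂ (s n) (f a)) (fun n => ?_)
      (tendsto_pi_nhds.2 fun a => hsk.inner tendsto_const_nhds)
    refine Submodule.span_induction (p := fun v _ => Measurable fun a => inner ℂ v (f a))
      ?_ ?_ ?_ ?_ (hs n)
    · rintro _ ⟨i, rfl⟩; exact h i
    · simp
    · intro u v _ _ hu hv
      simp only [inner_add_left]; exact hu.add hv
    · intro c u _ hu
      simp only [inner_smul_left]; exact hu.const_mul _
  have hnorm : ∀ c, Measurable fun a => ‖f a - c‖ := by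
    intro c
    refine measurable_of_Iic fun r => ?_
    rcases lt_or_ge r 0 with hr | hr
    · have : (fun a => ‖f a - c‖) ⁻¹' Set.Iic r = ∅ := by
        ext a; simpa using hr.trans_le (norm_nonneg _)
      rw [this]; exact MeasurableSet.empty
    have h1 : (fun a => ‖f a - c‖) ⁻¹' Set.Iic r =
        ⋂ n : ℕ, {a | ‖inner ℂ (TopologicalSpace.denseSeq K n) (f a - c)‖ ≤
          ‖TopologicalSpace.denseSeq K n‖ * r} := by
      ext a
      simp only [Set.mem_preimage, Set.mem_Iic, Set.mem_iInter, Set.mem_ofPred_eq]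
      refine ⟨fun hr n => (norm_inner_le_norm _ _).trans (by gcongr), fun hn => ?_⟩
      have h2 : ∀ k : K, ‖inner ℂ k (f a - c)‖ ≤ ‖k‖ * r := fun k =>
        (TopologicalSpace.denseRange_denseSeq K).induction_on
          (p := fun k => ‖inner ℂ k (f a - c)‖ ≤ ‖k‖ * r) k
          (isClosed_le (by fun_prop) (by fun_prop)) hn
      have h3 := h2 (f a - c)
      rw [inner_self_eq_norm_sq_to_K, norm_pow, RCLike.norm_ofReal, abs_norm, sq] at h3
      rcases (norm_nonneg (f a - c)).eq_or_lt' with h0 | h0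
      · rwa [h0]
      · exact le_of_mul_le_mul_left h3 h0
    rw [h1]
    refine MeasurableSet.iInter fun n => measurableSet_le ?_ measurable_const
    simp only [inner_sub_right]
    exact ((hall _).sub_const _).norm
  refine measurable_of_isOpen fun s hs => ?_
  have hr : ∀ x : s, ∃ r > 0, Metric.ball (x : K) r ⊆ s := fun x =>
    Metric.isOpen_iff.1 hs x x.2
  choose r hr0 hrs using hr
  obtain ⟨T, hT, hTs⟩ := TopologicalSpace.isOpen_iUnion_countable
    (fun x : s => Metric.ball (x : K) (r x)) fun _ => Metric.isOpen_ball
  have h4 : s = ⋃ x ∈ T, Metric.ball (x : K) (r x) := by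
    rw [hTs]
    refine Set.Subset.antisymm (fun x hx => Set.mem_iUnion.2 ⟨⟨x, hx⟩, ?_⟩)
      (Set.iUnion_subset hrs)
    exact Metric.mem_ball_self (hr0 _)
  rw [h4, Set.preimage_iUnion₂]
  refine MeasurableSet.biUnion hT fun x _ => ?_
  have : f ⁻¹' Metric.ball (x : K) (r x) = {a | ‖f a - x‖ < r x} := by
    ext a; simp [dist_eq_norm]
  rw [this]
  exact measurableSet_lt (hnorm _) measurable_const
end Total

/-! ### Second quantisation of an isometry -/

section SecondQuantisation

variable {H : Type u} [NormedAddCommGroup H] [InnerProductSpace ℂ H]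

theorem isTotal_expVec : IsTotal (expVec (H := H)) := isTotal_iff.2 expVec_total

theorem continuous_expVec : Continuous (expVec (H := H)) := by
  rw [continuous_iff_continuousAt]
  intro f
  rw [ContinuousAt, tendsto_iff_norm_sub_tendsto_zero]
  have h1 : ∀ g : H, ‖expVec g - expVec f‖ ^ 2 = (Complex.exp (inner ℂ g g) -
      Complex.exp (inner ℂ g f) - Complex.exp (inner ℂ f g) + Complex.exp (inner ℂ f f)).re := by
    intro g
    rw [← @inner_self_eq_norm_sq ℂ]
    simp only [inner_sub_left, inner_sub_right, inner_expVec]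
    simp
    ring
  have h2 : Tendsto (fun g : H => ‖expVec g - expVec f‖ ^ 2) (𝓝 f) (𝓝 0) := by
    simp only [h1]
    have : Continuous fun g : H => (Complex.exp (inner ℂ g g) -
      Complex.exp (inner ℂ g f) - Complex.exp (inner ℂ f g) + Complex.exp (inner ℂ f f)).re := by
      fun_prop
    convert this.tendsto f using 2
    simp
  have h3 := (Real.continuous_sqrt.tendsto 0).comp h2
  simpa [Function.comp_def] using h3

instance [TopologicalSpace.SeparableSpace H] : TopologicalSpace.SeparableSpace (Fock H) :=
  (isTotal_expVec.comp_denseRange continuous_expVec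
    (TopologicalSpace.denseRange_denseSeq H)).separableSpace

/-- Operators whose products `Tᵢ* Tⱼ` are scalars given by the Gram matrix of a total family
extend linearly and isometrically to the Hilbert space of that family. -/
theorem IsTotal.exists_clm_of_star_mul {E K : Type*} [NormedAddCommGroup E]
    [InnerProductSpace ℂ E] [NormedAddCommGroup K] [InnerProductSpace ℂ K] [CompleteSpace K]
    {ι : Type*} {x : ι → E} (hx : IsTotal x) {T : ι → K →L[ℂ] K}
    (h : ∀ i j, star (T i) * T j = (inner ℂ (x i) (x j) : ℂ) • (1 : K →L[ℂ] K)) :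
    ∃ κ : E →L[ℂ] (K →L[ℂ] K), (∀ i, κ (x i) = T i) ∧
      ∀ ξ ξ', star (κ ξ) * κ ξ' = (inner ℂ ξ ξ' : ℂ) • (1 : K →L[ℂ] K) := by
  set f := Finsupp.linearCombination ℂ T
  set e := Finsupp.linearCombination ℂ x
  have hfe : ∀ c c', star (f c) * f c' = (inner ℂ (e c) (e c') : ℂ) • (1 : K →L[ℂ] K) := by
    intro c c'
    simp only [f, e, Finsupp.linearCombination_apply, Finsupp.sum, sum_inner, inner_sum,
      inner_smul_left, inner_smul_right, star_sum, star_smul, Finset.sum_mul_sum, Finset.sum_smul,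
      smul_mul_smul_comm, h, smul_smul]
    rw [Finset.sum_comm]
    refine Finset.sum_congr rfl fun i _ => ?_
    rw [Finset.mul_sum, Finset.sum_smul]
    refine Finset.sum_congr rfl fun j _ => ?_
    simp only [RCLike.star_def]
    congr 1; ring
  have hd : DenseRange e := hx.denseRange
  have key : ∀ c, f.extendOfNorm e (e c) = f c := LinearMap.extendOfNorm_eq hd ⟨1, fun c => by
    rw [one_mul]
    refine le_of_sq_le_sq ?_ (norm_nonneg _)
    have h1 := congrArg norm (hfe c c)
    rw [CStarRing.norm_star_mul_self, norm_smul, inner_self_eq_norm_sq_to_K, norm_pow,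
      RCLike.norm_ofReal, abs_norm] at h1
    rw [sq, h1]
    exact mul_le_of_le_one_right (by positivity) ContinuousLinearMap.norm_id_le⟩
  refine ⟨f.extendOfNorm e, fun i => ?_, fun ξ ξ' => ?_⟩
  · have := key (Finsupp.single i 1)
    simpa [f, e] using this
  · refine hd.induction_on₂ (p := fun ξ ξ' => star (f.extendOfNorm e ξ) * f.extendOfNorm e ξ' =
      (inner ℂ ξ ξ' : ℂ) • (1 : K →L[ℂ] K)) (isClosed_eq (by fun_prop) (by fun_prop))
      (fun c c' => ?_) ξ ξ'
    rw [key, key, hfe]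

/-- The orthogonal complement of the range of an isometry. -/
def perp (V : H →ₗᵢ[ℂ] H) : Submodule ℂ H := (LinearMap.range V.toLinearMap)ᗮ

theorem mem_perp {V : H →ₗᵢ[ℂ] H} {f : H} : f ∈ perp V ↔ ∀ g, inner ℂ (V g) f = 0 := by
  simp [perp, Submodule.mem_orthogonal]

theorem inner_perp (V : H →ₗᵢ[ℂ] H) (f : perp V) (g : H) : inner ℂ (f : H) (V g) = 0 := by
  rw [← inner_conj_symm, mem_perp.1 f.2, map_zero]

theorem inner_add_isometry (V : H →ₗᵢ[ℂ] H) (f f' : perp V) (g g' : H) :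
    inner ℂ ((f : H) + V g) ((f' : H) + V g') = inner ℂ f f' + inner ℂ g g' := by
  rw [inner_add_left, inner_add_right, inner_add_right, inner_perp, mem_perp.1 f'.2,
    V.inner_map_map, zero_add, add_zero, Submodule.coe_inner]

/-- Multiplied by `exp (-‖f‖² / 2)`, the operator `e(g) ↦ e(f + V g)` preserves the Gram matrix of
the exponential vectors, because `f` is orthogonal to the range of `V`. It therefore extends to
`Γ(H)`. -/
theorem exists_fockMul_expVec (V : H →ₗᵢ[ℂ] H) (f : perp V) : ∃ T : Fock H →L[ℂ] Fock H,
    ∀ g, T (expVec g) = expVec ((f : H) + V g) := by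
  set c : ℂ := Complex.exp (-(inner ℂ f f) / 2) with hc
  have hcc : conj c * c * Complex.exp (inner ℂ f f) = 1 := by
    have : conj (inner ℂ f f : ℂ) = inner ℂ f f := inner_conj_symm _ _
    rw [hc, ← Complex.exp_conj, ← Complex.exp_add, ← Complex.exp_add]
    simp only [map_div₀, map_neg, this, map_ofNat]
    ring_nf
    exact Complex.exp_zero
  obtain ⟨J, hJ⟩ := (isTotal_expVec (H := H)).exists_isometry
    (y := fun g => c • expVec ((f : H) + V g)) fun g g' => by
      rw [inner_smul_left, inner_smul_right, inner_expVec, inner_expVec, inner_add_isometry,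
        Complex.exp_add, ← _root_.mul_assoc, ← _root_.mul_assoc, hcc, one_mul]
  refine ⟨c⁻¹ • J.toContinuousLinearMap, fun g => ?_⟩
  have : c ≠ 0 := Complex.exp_ne_zero _
  simp [hJ, smul_smul, this]

/-- The operators of `exists_fockMul_expVec` have scalar products `T* T'` equal to the inner
products of the exponential vectors, so they extend linearly to `Γ((ran V)ᗮ)`. -/
theorem exists_fockMul (V : H →ₗᵢ[ℂ] H) :
    ∃ κ : Fock (perp V) →L[ℂ] (Fock H →L[ℂ] Fock H),
      (∀ f g, κ (expVec f) (expVec g) = expVec ((f : H) + V g)) ∧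
      ∀ ξ ξ', star (κ ξ) * κ ξ' = (inner ℂ ξ ξ' : ℂ) • (1 : Fock H →L[ℂ] Fock H) := by
  choose T hT using exists_fockMul_expVec V
  obtain ⟨κ, h1, h2⟩ := (isTotal_expVec (H := perp V)).exists_clm_of_star_mul (T := T)
    fun f f' => isTotal_expVec.clm_ext fun g => isTotal_expVec.ext_inner fun g' => by
      simp only [ContinuousLinearMap.star_eq_adjoint, mul_apply_eq_comp,
        ContinuousLinearMap.adjoint_inner_right, smul_apply, one_apply_eq_self, inner_smul_right,
        hT, inner_expVec, inner_add_isometry, Complex.exp_add]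
  exact ⟨κ, fun f g => by rw [h1, hT], h2⟩

variable [CompleteSpace H]

instance (V : H →ₗᵢ[ℂ] H) : CompleteSpace (perp V) := by unfold perp; infer_instance

/-- The adjoint `V*` of an isometry. -/
def coisom (V : H →ₗᵢ[ℂ] H) : H →L[ℂ] H := ContinuousLinearMap.adjoint V.toContinuousLinearMap

theorem inner_coisom_left (V : H →ₗᵢ[ℂ] H) (f g : H) :
    inner ℂ (coisom V f) g = inner ℂ f (V g) := by
  rw [coisom, ContinuousLinearMap.adjoint_inner_left]; rfl

theorem inner_coisom_right (V : H →ₗᵢ[ℂ] H) (f g : H) :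
    inner ℂ g (coisom V f) = inner ℂ (V g) f := by
  rw [coisom, ContinuousLinearMap.adjoint_inner_right]; rfl

/-- The component `h - V V* h` of `h` orthogonal to the range of `V`. -/
def perpPart (V : H →ₗᵢ[ℂ] H) (h : H) : perp V :=
  ⟨h - V (coisom V h), mem_perp.2 fun g => by
    rw [inner_sub_right, V.inner_map_map, inner_coisom_right, sub_self]⟩

theorem perpPart_add (V : H →ₗᵢ[ℂ] H) (h : H) : (perpPart V h : H) + V (coisom V h) = h := by
  simp [perpPart]

theorem coisom_perp (V : H →ₗᵢ[ℂ] H) (f : perp V) : coisom V (f : H) = 0 :=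
  ext_inner_right ℂ fun g => by rw [inner_coisom_left, inner_perp, inner_zero_left]

theorem perpPart_coe (V : H →ₗᵢ[ℂ] H) (f : perp V) : perpPart V (f : H) = f := by
  apply Subtype.ext
  simp [perpPart, coisom_perp]

/-- The linear map from `Γ((ran V)ᗮ)` to the operators on `Γ(H)` that sends `e(f)` to the operator
`e(g) ↦ e(f + V g)`. It corresponds to the unitary `Γ((ran V)ᗮ) ⊗ Γ(H) → Γ(H)`. -/
def fockMul (V : H →ₗᵢ[ℂ] H) : Fock (perp V) →L[ℂ] (Fock H →L[ℂ] Fock H) :=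
  (exists_fockMul V).choose

theorem fockMul_expVec (V : H →ₗᵢ[ℂ] H) (f : perp V) (g : H) :
    fockMul V (expVec f) (expVec g) = expVec ((f : H) + V g) :=
  (exists_fockMul V).choose_spec.1 f g

theorem star_fockMul_mul (V : H →ₗᵢ[ℂ] H) (ξ ξ' : Fock (perp V)) :
    star (fockMul V ξ) * fockMul V ξ' = (inner ℂ ξ ξ' : ℂ) • (1 : Fock H →L[ℂ] Fock H) :=
  (exists_fockMul V).choose_spec.2 ξ ξ'

theorem inner_fockMul (V : H →ₗᵢ[ℂ] H) (ξ ξ' : Fock (perp V)) (v w : Fock H) :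
    inner ℂ (fockMul V ξ v) (fockMul V ξ' w) = inner ℂ ξ ξ' * inner ℂ v w := by
  rw [← ContinuousLinearMap.adjoint_inner_right, ← ContinuousLinearMap.star_eq_adjoint,
    ← mul_apply_eq_comp, star_fockMul_mul, smul_apply, one_apply_eq_self, inner_smul_right]

theorem expVec_eq_fockMul (V : H →ₗᵢ[ℂ] H) (h : H) :
    expVec h = fockMul V (expVec (perpPart V h)) (expVec (coisom V h)) := by
  rw [fockMul_expVec, perpPart_add]

theorem isTotal_fockMul (V : H →ₗᵢ[ℂ] H) :
    IsTotal fun p : perp V × Fock H => fockMul V (expVec p.1) p.2 :=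
  isTotal_expVec.of_closure fun h => Submodule.le_topologicalClosure _
    (Submodule.subset_span ⟨(perpPart V h, expVec (coisom V h)), (expVec_eq_fockMul V h).symm⟩)

theorem clm_ext_fockMul {V : H →ₗᵢ[ℂ] H} {A B : Fock H →L[ℂ] Fock H}
    (h : ∀ f : perp V, A * fockMul V (expVec f) = B * fockMul V (expVec f)) : A = B :=
  (isTotal_fockMul V).clm_ext fun p => congrArg (fun T => T p.2) (h p.1)

/-- An intertwining relation for the operators of `Γ((ran V)ᗮ)` needs to be checked on exponential
vectors only. -/
theorem fockMul_ext {V : H →ₗᵢ[ℂ] H} {A B : Fock H →L[ℂ] Fock H}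
    (h : ∀ f : perp V, A * fockMul V (expVec f) = fockMul V (expVec f) * B)
    (ξ : Fock (perp V)) : A * fockMul V ξ = fockMul V ξ * B := by
  have : ((ContinuousLinearMap.mul ℂ _ A).comp (fockMul V)) =
      (((ContinuousLinearMap.mul ℂ _).flip B).comp (fockMul V)) :=
    isTotal_expVec.clm_ext fun f => by simpa using h f
  simpa using congrArg (fun T => T ξ) this

/-- The ampliation of a unitary is an isometry by comparison of Gram matrices, and every bounded
operator is a linear combination of unitaries. -/
theorem exists_fockEndo (V : H →ₗᵢ[ℂ] H) (A : Fock H →L[ℂ] Fock H) :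
    ∃ B : Fock H →L[ℂ] Fock H,
      ∀ f : perp V, B * fockMul V (expVec f) = fockMul V (expVec f) * A := by
  let S : Submodule ℂ (Fock H →L[ℂ] Fock H) :=
    { carrier := {A | ∃ B : Fock H →L[ℂ] Fock H,
        ∀ f : perp V, B * fockMul V (expVec f) = fockMul V (expVec f) * A}
      zero_mem' := ⟨0, fun f => by simp⟩
      add_mem' := by
        rintro A A' ⟨B, hB⟩ ⟨B', hB'⟩
        exact ⟨B + B', fun f => by rw [add_mul, mul_add, hB, hB']⟩
      smul_mem' := by
        rintro c A ⟨B, hB⟩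
        exact ⟨c • B, fun f => by rw [smul_mul_assoc, mul_smul_comm, hB]⟩ }
  have hU : (unitary (Fock H →L[ℂ] Fock H) : Set (Fock H →L[ℂ] Fock H)) ⊆ S := by
    intro U hU
    obtain ⟨J, hJ⟩ := (isTotal_fockMul V).exists_isometry
      (y := fun p => fockMul V (expVec p.1) (U p.2)) fun p q => by
        rw [inner_fockMul, inner_fockMul]
        congr 1
        rw [← ContinuousLinearMap.adjoint_inner_right, ← ContinuousLinearMap.star_eq_adjoint,
          ← mul_apply_eq_comp, (Unitary.mem_iff.1 hU).1, one_apply_eq_self]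
    exact ⟨J.toContinuousLinearMap, fun f => ContinuousLinearMap.ext fun v => hJ (f, v)⟩
  have h1 : (⊤ : Submodule ℂ (Fock H →L[ℂ] Fock H)) ≤ S := by
    rw [← CStarAlgebra.span_unitary]
    exact Submodule.span_le.2 hU
  exact h1 (x := A) trivial

/-- The operator `1 ⊗ A`, transported by the unitary `Γ((ran V)ᗮ) ⊗ Γ(H) → Γ(H)`. -/
def fockEndoFun (V : H →ₗᵢ[ℂ] H) (A : Fock H →L[ℂ] Fock H) : Fock H →L[ℂ] Fock H :=
  (exists_fockEndo V A).choose

theorem fockEndoFun_mul (V : H →ₗᵢ[ℂ] H) (A : Fock H →L[ℂ] Fock H) (ξ : Fock (perp V)) :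
    fockEndoFun V A * fockMul V ξ = fockMul V ξ * A :=
  fockMul_ext (exists_fockEndo V A).choose_spec ξ

theorem eq_fockEndoFun {V : H →ₗᵢ[ℂ] H} {A B : Fock H →L[ℂ] Fock H}
    (h : ∀ f : perp V, B * fockMul V (expVec f) = fockMul V (expVec f) * A) :
    B = fockEndoFun V A :=
  clm_ext_fockMul fun f => by rw [h, fockEndoFun_mul]

/-- The `*`-endomorphism `A ↦ 1 ⊗ A` of `B(Γ(H))` given by an isometry `V` of `H`. -/
def fockEndo (V : H →ₗᵢ[ℂ] H) : (Fock H →L[ℂ] Fock H) →⋆ₐ[ℂ] (Fock H →L[ℂ] Fock H) where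
  toFun := fockEndoFun V
  map_one' := (eq_fockEndoFun fun f => by rw [one_mul, mul_one]).symm
  map_mul' A B := (eq_fockEndoFun fun f => by
    rw [_root_.mul_assoc, fockEndoFun_mul, ← _root_.mul_assoc, fockEndoFun_mul,
      _root_.mul_assoc]).symm
  map_zero' := (eq_fockEndoFun fun f => by rw [zero_mul, mul_zero]).symm
  map_add' A B := (eq_fockEndoFun fun f => by
    rw [add_mul, mul_add, fockEndoFun_mul, fockEndoFun_mul]).symm
  commutes' c := (eq_fockEndoFun fun f => by
    rw [Algebra.algebraMap_eq_smul_one, smul_mul_assoc, mul_smul_comm, one_mul, mul_one]).symm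
  map_star' A := (eq_fockEndoFun fun f => ContinuousLinearMap.ext fun v =>
    (isTotal_fockMul V).ext_inner fun p => by
      simp only [mul_apply_eq_comp, ContinuousLinearMap.star_eq_adjoint,
        ContinuousLinearMap.adjoint_inner_right]
      rw [← mul_apply_eq_comp, fockEndoFun_mul, mul_apply_eq_comp, inner_fockMul, inner_fockMul,
        ContinuousLinearMap.adjoint_inner_right]).symm

theorem fockEndo_mul (V : H →ₗᵢ[ℂ] H) (A : Fock H →L[ℂ] Fock H) (ξ : Fock (perp V)) :
    fockEndo V A * fockMul V ξ = fockMul V ξ * A := fockEndoFun_mul V A ξ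

theorem fockEndo_apply (V : H →ₗᵢ[ℂ] H) (A : Fock H →L[ℂ] Fock H) (ξ : Fock (perp V))
    (v : Fock H) : fockEndo V A (fockMul V ξ v) = fockMul V ξ (A v) :=
  congrArg (fun T => T v) (fockEndo_mul V A ξ)

theorem eq_fockEndo {V : H →ₗᵢ[ℂ] H} {A B : Fock H →L[ℂ] Fock H}
    (h : ∀ f : perp V, B * fockMul V (expVec f) = fockMul V (expVec f) * A) :
    B = fockEndo V A := eq_fockEndoFun h

theorem fockEndo_weyl (V : H →ₗᵢ[ℂ] H) (h : H) : fockEndo V (weyl h) = weyl (V h) :=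
  (eq_fockEndo fun f => isTotal_expVec.clm_ext fun g => by
    simp only [mul_apply_eq_comp, fockMul_expVec, weyl_expVec, map_smul, V.norm_map,
      inner_add_right, mem_perp.1 f.2, V.inner_map_map, zero_add, map_add]
    rw [_root_.add_assoc]).symm

/-- The matrix elements of the endomorphism `A ↦ 1 ⊗ A` between exponential vectors depend on `V`
only through `V*`. They carry the continuity in the semigroup parameter. -/
theorem inner_fockEndo_expVec (V : H →ₗᵢ[ℂ] H) (A : Fock H →L[ℂ] Fock H) (f g : H) :
    inner ℂ (expVec g) (fockEndo V A (expVec f)) =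
      Complex.exp (inner ℂ g f - inner ℂ (coisom V g) (coisom V f)) *
        inner ℂ (expVec (coisom V g)) (A (expVec (coisom V f))) := by
  have h1 := inner_add_isometry V (perpPart V g) (perpPart V f) (coisom V g) (coisom V f)
  rw [perpPart_add, perpPart_add] at h1
  rw [expVec_eq_fockMul V f, expVec_eq_fockMul V g, fockEndo_apply, inner_fockMul, inner_expVec,
    h1, add_sub_cancel_right]

end SecondQuantisation

section Normality

/-- For uniformly bounded operators, strong continuity needs to be checked on a total family
only. -/
theorem continuous_of_isTotal {K F : Type*} [NormedAddCommGroup K] [InnerProductSpace ℂ K]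
    [NormedAddCommGroup F] [NormedSpace ℂ F] {α : Type*} [TopologicalSpace α]
    {T : α → K →L[ℂ] F} {C : ℝ} (hC : ∀ a, ‖T a‖ ≤ C) {ι : Type*} {x : ι → K} (hx : IsTotal x)
    (h : ∀ i, Continuous fun a => T a (x i)) (v : K) : Continuous fun a => T a v := by
  let S : Submodule ℂ K :=
    { carrier := {v | Continuous fun a => T a v}
      zero_mem' := by simpa using continuous_const
      add_mem' := by
        intro v w hv hw
        simp only [Set.mem_ofPred_eq, map_add] at hv hw ⊢
        exact Continuous.add hv hw
      smul_mem' := by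
        intro c v hv
        simp only [Set.mem_ofPred_eq, map_smul] at hv ⊢
        exact Continuous.const_smul hv c }
  refine hx.mem_of_isClosed (p := S) ?_ h v
  refine isClosed_of_closure_subset fun v hv => ?_
  refine continuous_of_uniform_approx_of_continuous fun u hu => ?_
  obtain ⟨ε, hε, hεu⟩ := Metric.mem_uniformity_dist.1 hu
  obtain ⟨w, hw, hvw⟩ := Metric.mem_closure_iff.1 hv (ε / (|C| + 1)) (by positivity)
  refine ⟨fun a => T a w, hw, fun a => hεu ?_⟩
  rw [dist_eq_norm, ← map_sub]
  rw [dist_eq_norm, lt_div_iff₀ (by positivity)] at hvw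
  calc ‖T a (v - w)‖ ≤ ‖T a‖ * ‖v - w‖ := (T a).le_opNorm _
    _ ≤ (|C| + 1) * ‖v - w‖ := by
        gcongr
        exact ((hC a).trans (le_abs_self C)).trans (by linarith)
    _ < ε := by rwa [mul_comm]

theorem Orthonormal.countable {E : Type*} [NormedAddCommGroup E] [InnerProductSpace ℂ E]
    [TopologicalSpace.SeparableSpace E] {ι : Type*} {v : ι → E} (hv : Orthonormal ℂ v) :
    Countable ι := by
  have h : (Set.univ : Set ι).PairwiseDisjoint fun i => Metric.ball (v i) (1 / 2) := by
    intro i _ j _ hij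
    refine Metric.ball_disjoint_ball ?_
    have h1 : ‖v i - v j‖ * ‖v i - v j‖ = 2 := by
      have := norm_sub_mul_self (𝕜 := ℂ) (v i) (v j)
      rw [hv.2 hij, hv.1, hv.1] at this
      rw [this]
      norm_num
    rw [dist_eq_norm]
    nlinarith [norm_nonneg (v i - v j)]
  exact Set.countable_univ_iff.1 (h.countable_of_isOpen (fun i _ => Metric.isOpen_ball)
    fun i _ => ⟨v i, Metric.mem_ball_self (by norm_num)⟩)

variable {H : Type u} [NormedAddCommGroup H] [InnerProductSpace ℂ H] [CompleteSpace H]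

theorem isTotal_fockMul_of_isTotal (V : H →ₗᵢ[ℂ] H) {ι κ : Type*} {x : ι → Fock (perp V)}
    (hx : IsTotal x) {y : κ → Fock H} (hy : IsTotal y) :
    IsTotal fun p : ι × κ => fockMul V (x p.1) (y p.2) := by
  refine (isTotal_fockMul V).of_closure fun p => ?_
  set S := (Submodule.span ℂ
    (Set.range fun p : ι × κ => fockMul V (x p.1) (y p.2))).topologicalClosure
  have hS : IsClosed (S : Set (Fock H)) := Submodule.isClosed_topologicalClosure _
  have h1 : ∀ j ξ, fockMul V ξ (y j) ∈ S := fun j ξ =>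
    hx.mem_of_isClosed (p := S.comap ((fockMul V).flip (y j)).toLinearMap)
      (hS.preimage ((fockMul V).flip (y j)).continuous)
      (fun i => Submodule.le_topologicalClosure _ (Submodule.subset_span ⟨(i, j), rfl⟩)) ξ
  exact hy.mem_of_isClosed (p := S.comap (fockMul V (expVec p.1)).toLinearMap)
      (hS.preimage (fockMul V (expVec p.1)).continuous) (fun j => h1 j _) p.2

/-- The adjoints of the operators of an orthonormal basis decompose `Γ(H)` as a direct sum of copies
of itself. -/
theorem hasSum_inner_star_fockMul (V : H →ₗᵢ[ℂ] H) {ι : Type*}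
    (b : HilbertBasis ι ℂ (Fock (perp V))) (ξ ζ : Fock H) :
    HasSum (fun i => (inner ℂ (star (fockMul V (b i)) ξ) (star (fockMul V (b i)) ζ) : ℂ))
      (inner ℂ ξ ζ) := by
  obtain ⟨w, c, -⟩ := exists_hilbertBasis ℂ (Fock H)
  have hb : IsTotal b := isTotal_iff.2 b.dense_span
  have hc : IsTotal c := isTotal_iff.2 c.dense_span
  have ho : Orthonormal ℂ fun p : ι × w => fockMul V (b p.1) (c p.2) := by
    classical
    rw [orthonormal_iff_ite]
    intro p q
    rw [inner_fockMul, orthonormal_iff_ite.1 b.orthonormal, orthonormal_iff_ite.1 c.orthonormal,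
      if_congr (Prod.ext_iff (x := p) (y := q)) rfl rfl]
    by_cases h1 : p.1 = q.1 <;> by_cases h2 : p.2 = q.2 <;> simp [h1, h2]
  set B := HilbertBasis.mk ho (isTotal_iff.1 (isTotal_fockMul_of_isTotal V hb hc)).ge
  have h1 := B.hasSum_inner_mul_inner ξ ζ
  refine h1.prod_fiberwise fun i => ?_
  have h2 := c.hasSum_inner_mul_inner (star (fockMul V (b i)) ξ) (star (fockMul V (b i)) ζ)
  convert h2 using 2 with j
  simp only [B, HilbertBasis.coe_mk, ContinuousLinearMap.star_eq_adjoint,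
    ContinuousLinearMap.adjoint_inner_left, ContinuousLinearMap.adjoint_inner_right]

/-- An orthonormal basis of `Γ((ran V)ᗮ)` gives operators `Tᵢ` with `1 ⊗ A = ∑ Tᵢ A Tᵢ*`. The basis
is countable; the definition of normality wants sequences, hence the extension by zero to `ℕ`. -/
theorem isNormalMap_fockEndo [TopologicalSpace.SeparableSpace H] (V : H →ₗᵢ[ℂ] H) :
    IsNormalMap (fockEndo V) := by
  intro ξ ζ
  obtain ⟨w, b, -⟩ := exists_hilbertBasis ℂ (Fock (perp V))
  have : Countable w := Orthonormal.countable b.orthonormal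
  obtain ⟨e, he⟩ := exists_injective_nat w
  have hsum : ∀ ξ : Fock H, Summable fun i => ‖star (fockMul V (b i)) ξ‖ ^ 2 := fun ξ => by
    have := (Complex.hasSum_re (hasSum_inner_star_fockMul V b ξ ξ)).summable
    refine this.congr fun i => ?_
    exact inner_self_eq_norm_sq (𝕜 := ℂ) _
  have hext : ∀ ξ : Fock H, Summable fun n =>
      ‖Function.extend e (fun i => star (fockMul V (b i)) ξ) 0 n‖ ^ 2 := fun ξ => by
    refine ((summable_extend_zero he).2 (hsum ξ)).congr fun n => ?_
    by_cases hn : ∃ i, e i = n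
    · obtain ⟨i, rfl⟩ := hn
      simp [he.extend_apply]
    · simp [Function.extend_apply' _ _ _ hn]
  refine ⟨_, _, hext ξ, hext ζ, fun A => ?_⟩
  have h1 := (hasSum_extend_zero he).2 (hasSum_inner_star_fockMul V b ξ (fockEndo V A ζ))
  convert h1 using 2 with n
  by_cases hn : ∃ i, e i = n
  · obtain ⟨i, rfl⟩ := hn
    simp only [he.extend_apply]
    congr 1
    have := congrArg star (fockEndo_mul V (star A) (b i))
    rw [star_mul, star_mul, star_star, map_star, star_star] at this
    exact (congrArg (fun T => T ζ) this).symm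
  · simp [Function.extend_apply' _ _ _ hn]

end Normality

section Flow
variable {H : Type u} [NormedAddCommGroup H] [InnerProductSpace ℂ H] [CompleteSpace H]

theorem norm_fockEndo_le (V : H →ₗᵢ[ℂ] H) (A : Fock H →L[ℂ] Fock H) : ‖fockEndo V A‖ ≤ ‖A‖ :=
  NonUnitalStarAlgHom.norm_apply_le (fockEndo V) A

variable {d : ℕ} {P : PointedCone ℝ (EuclideanSpace ℝ (Fin d))}

theorem perpPart_zero_eq {V : P → (H →ₗᵢ[ℂ] H)} (hV : IsIsometricRepresentation V)
    (f : perp (V 0)) : f = 0 := by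
  have := mem_perp.1 f.2 (f : H)
  rw [hV.map_zero] at this
  exact Subtype.ext (inner_self_eq_zero.1 this)

theorem fockMul_mul_fockMul {V : P → (H →ₗᵢ[ℂ] H)} (hV : IsIsometricRepresentation V) {a b : P}
    {f : perp (V (a + b))} {f₁ : perp (V a)} {f₂ : perp (V b)} (h : (f : H) = f₁ + V a f₂) :
    fockMul (V a) (expVec f₁) * fockMul (V b) (expVec f₂) = fockMul (V (a + b)) (expVec f) :=
  isTotal_expVec.clm_ext fun g => by
    simp only [mul_apply_eq_comp, fockMul_expVec, map_add, hV.map_add, h, _root_.add_assoc]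

theorem exists_perp_add {V : P → (H →ₗᵢ[ℂ] H)} (hV : IsIsometricRepresentation V) {a b : P}
    (f : perp (V (a + b))) : ∃ (f₁ : perp (V a)) (f₂ : perp (V b)), (f : H) = f₁ + V a f₂ :=
  ⟨perpPart (V a) f, ⟨coisom (V a) f, mem_perp.2 fun g => by
    rw [inner_coisom_right, ← hV.map_add, mem_perp.1 f.2]⟩, (perpPart_add _ _).symm⟩

/-- The CCR flow of a strongly continuous isometric representation. -/
def ccrFlow [TopologicalSpace.SeparableSpace H] (V : P → (H →ₗᵢ[ℂ] H))
    (hV : IsIsometricRepresentation V)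
    (hV' : ∀ f, Continuous fun a => coisom (V a) f) : E0Semigroup P (Fock H) where
  toFun a := fockEndo (V a)
  map_zero A := (eq_fockEndo fun f => by
    have h1 : fockMul (V 0) (expVec f) = 1 := isTotal_expVec.clm_ext fun g => by
      rw [fockMul_expVec, perpPart_zero_eq hV f, hV.map_zero]; simp
    rw [h1, mul_one, one_mul]).symm
  map_add a b A := (eq_fockEndo fun f => by
    obtain ⟨f₁, f₂, h⟩ := exists_perp_add hV f
    rw [← fockMul_mul_fockMul hV h, ← _root_.mul_assoc, fockEndo_mul, _root_.mul_assoc,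
      fockEndo_mul, _root_.mul_assoc]).symm
  normal a := isNormalMap_fockEndo (V a)
  continuous A ξ ζ := by
    have h1 : ∀ f g : H, Continuous fun a => inner ℂ (expVec g) (fockEndo (V a) A (expVec f)) := by
      intro f g
      simp only [inner_fockEndo_expVec]
      have h2 := hV' f
      have h3 := hV' g
      have h4 := continuous_expVec.comp h2
      have h5 := continuous_expVec.comp h3
      simp only [Function.comp_def] at h4 h5
      fun_prop
    have h2 : ∀ (g : H) (ζ : Fock H),
        Continuous fun a => inner ℂ (expVec g) (fockEndo (V a) A ζ) := fun g =>
      continuous_of_isTotal (T := fun a => (innerSL ℂ (expVec g)).comp (fockEndo (V a) A))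
        (C := ‖expVec g‖ * ‖A‖) (fun a => (ContinuousLinearMap.opNorm_comp_le _ _).trans (by
          rw [innerSL_apply_norm]; gcongr; exact norm_fockEndo_le _ _)) isTotal_expVec
          (fun f => h1 f g)
    have h3 := continuous_of_isTotal (T := fun a => innerSL ℂ (fockEndo (V a) A ζ))
        (C := ‖A‖ * ‖ζ‖) (fun a => by
          rw [innerSL_apply_norm]
          exact ((fockEndo (V a) A).le_opNorm ζ).trans (by gcongr; exact norm_fockEndo_le _ _))
        isTotal_expVec (fun g => by
          have := (h2 g ζ).star
          simpa using this) ξ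
    have := h3.star
    simpa using this
end Flow

/-! ### The product system of a CCR flow -/

namespace E0Semigroup

section General

variable {P : Type u} [AddCommMonoid P] [TopologicalSpace P]
  {K : Type v} [NormedAddCommGroup K] [InnerProductSpace ℂ K] [CompleteSpace K]

theorem isClosed_fiber (α : E0Semigroup P K) (a : P) : IsClosed (α.fiber a : Set (K →L[ℂ] K)) := by
  have : (α.fiber a : Set (K →L[ℂ] K)) = ⋂ A, {T | α.toFun a A * T = T * A} := by
    ext T; simp [fiber]
  rw [this]
  exact isClosed_iInter fun A => isClosed_eq (by fun_prop) (by fun_prop)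

instance (α : E0Semigroup P K) (a : P) : CompleteSpace (α.fiber a) :=
  (α.isClosed_fiber a).completeSpace_coe

variable [Nontrivial K]

theorem star_mul_fiber (α : E0Semigroup P K) {a : P} (S T : α.fiber a) :
    star (S : K →L[ℂ] K) * (T : K →L[ℂ] K) = (inner ℂ S T : ℂ) • 1 :=
  α.fiberInner_spec S T

theorem inner_eq_of_star_mul (α : E0Semigroup P K) {a : P} {S T : α.fiber a} {c : ℂ}
    (h : star (S : K →L[ℂ] K) * (T : K →L[ℂ] K) = c • 1) : inner ℂ S T = c :=
  α.fiberInner_eq S T c h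

theorem inner_fiber_apply (α : E0Semigroup P K) {a : P} (S T : α.fiber a) (v w : K) :
    inner ℂ ((S : K →L[ℂ] K) v) ((T : K →L[ℂ] K) w) = inner ℂ S T * inner ℂ v w := by
  rw [← ContinuousLinearMap.adjoint_inner_right, ← ContinuousLinearMap.star_eq_adjoint,
    ← mul_apply_eq_comp, star_mul_fiber, smul_apply, one_apply_eq_self, inner_smul_right]

variable [MeasurableSpace P]

theorem pt_eq_pt (α : E0Semigroup P K) {a b : P} {S : α.fiber a} {T : α.fiber b} (h : a = b)
    (hST : (S : K →L[ℂ] K) = T) :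
    α.productSystem.pt (a := a) S = α.productSystem.pt (a := b) T := by
  subst h
  rw [Subtype.ext hST]

/-- The operator underlying a point of the total space. -/
def op (α : E0Semigroup P K) (x : α.productSystem.Total) : K →L[ℂ] K :=
  ((show α.fiber x.1 from x.2) : K →L[ℂ] K)

/-- Measurability into the total space of the product system of an `E₀`-semigroup amounts to that of
the base point and of all matrix elements of the operator. -/
theorem measurable_total_iff (α : E0Semigroup P K) {β : Type*} [MeasurableSpace β]
    {f : β → α.productSystem.Total} :
    Measurable f ↔ Measurable (fun b => (f b).1) ∧ ∀ ξ ζ : K,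
      Measurable fun b => inner ℂ ξ (α.op (f b) ζ) := by
  have h : (inferInstance : MeasurableSpace α.productSystem.Total) =
      MeasurableSpace.comap (fun x : α.productSystem.Total => x.1) inferInstance ⊔
      ⨆ (ξ : K) (ζ : K), MeasurableSpace.comap (fun x : α.productSystem.Total =>
        inner ℂ ξ (α.op x ζ)) inferInstance := rfl
  simp only [measurable_iff_comap_le]
  rw [show MeasurableSpace.comap f _ = MeasurableSpace.comap f _ from congrArg _ h]
  simp only [MeasurableSpace.comap_sup, MeasurableSpace.comap_iSup, MeasurableSpace.comap_comp,
    sup_le_iff, iSup_le_iff]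
  rfl

end General

end E0Semigroup

/-- Joint continuity from strong continuity and a uniform bound on the norms. -/
theorem continuous_apply_of_norm_le {K F : Type*} [NormedAddCommGroup K] [NormedSpace ℂ K]
    [NormedAddCommGroup F] [NormedSpace ℂ F] {α : Type*} [TopologicalSpace α]
    {T : α → K →L[ℂ] F} {C : ℝ} (hC : ∀ a, ‖T a‖ ≤ C) (hT : ∀ v, Continuous fun a => T a v)
    {u : α → K} (hu : Continuous u) : Continuous fun a => T a (u a) := by
  rw [continuous_iff_continuousAt]
  intro a
  have h1 : Tendsto (fun b => T b (u b - u a)) (𝓝 a) (𝓝 0) := by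
    have h2 : Tendsto (fun b => C * ‖u b - u a‖) (𝓝 a) (𝓝 0) := by
      have : Continuous fun b => C * ‖u b - u a‖ := by fun_prop
      simpa using this.tendsto a
    exact squeeze_zero_norm (fun b => ((T b).le_opNorm _).trans
      (mul_le_mul_of_nonneg_right (hC b) (norm_nonneg _))) h2
  have h3 := h1.add ((hT (u a)).tendsto a)
  simpa [ContinuousAt] using h3

instance {H : Type u} [NormedAddCommGroup H] [InnerProductSpace ℂ H] :
    MeasurableSpace (Fock H) := borel _

instance {H : Type u} [NormedAddCommGroup H] [InnerProductSpace ℂ H] : BorelSpace (Fock H) := ⟨rfl⟩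

section Vacuum

variable {H : Type u} [NormedAddCommGroup H] [InnerProductSpace ℂ H]

theorem inner_vacuum : inner ℂ (expVec (0 : H)) (expVec 0) = 1 := by
  rw [inner_expVec, inner_zero_left, Complex.exp_zero]

variable [CompleteSpace H] (V : H →ₗᵢ[ℂ] H)

/-- The second quantisation `Γ((ran V)ᗮ) → Γ(H)` of the inclusion. -/
def fockIncl : Fock (perp V) →L[ℂ] Fock H := (fockMul V).flip (expVec 0)

theorem fockIncl_apply (ξ : Fock (perp V)) : fockIncl V ξ = fockMul V ξ (expVec 0) := rfl

theorem fockIncl_expVec (f : perp V) : fockIncl V (expVec f) = expVec (f : H) := by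
  rw [fockIncl_apply, fockMul_expVec, map_zero, add_zero]

theorem inner_fockIncl (ξ ζ : Fock (perp V)) :
    inner ℂ (fockIncl V ξ) (fockIncl V ζ) = inner ℂ ξ ζ := by
  rw [fockIncl_apply, fockIncl_apply, inner_fockMul, inner_vacuum, mul_one]

/-- The orthogonal projection of `Γ(H)` onto `Γ((ran V)ᗮ)`. -/
def fockProj : Fock H →L[ℂ] Fock H := (fockIncl V).comp <| ContinuousLinearMap.adjoint (fockIncl V)

theorem adjoint_fockIncl_expVec (h : H) :
    ContinuousLinearMap.adjoint (fockIncl V) (expVec h) = expVec (perpPart V h) :=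
  isTotal_expVec.ext_inner fun f => by
    rw [ContinuousLinearMap.adjoint_inner_right, fockIncl_expVec, inner_expVec, inner_expVec,
      Submodule.coe_inner]
    conv_lhs => rw [← perpPart_add V h, inner_add_right, inner_perp, add_zero]

theorem adjoint_fockIncl_fockIncl (ξ : Fock (perp V)) :
    ContinuousLinearMap.adjoint (fockIncl V) (fockIncl V ξ) = ξ :=
  ext_inner_left ℂ fun ζ => by rw [ContinuousLinearMap.adjoint_inner_right, inner_fockIncl]

theorem fockProj_expVec (h : H) : fockProj V (expVec h) = expVec (perpPart V h : H) := by
  rw [fockProj, ContinuousLinearMap.comp_apply, adjoint_fockIncl_expVec, fockIncl_expVec]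

theorem fockProj_fockIncl (ξ : Fock (perp V)) : fockProj V (fockIncl V ξ) = fockIncl V ξ := by
  rw [fockProj, ContinuousLinearMap.comp_apply, adjoint_fockIncl_fockIncl]

theorem norm_fockProj_le : ‖fockProj V‖ ≤ 1 := by
  have h1 : ‖fockIncl V‖ ≤ 1 := ContinuousLinearMap.opNorm_le_bound _ zero_le_one fun ξ => by
    rw [one_mul]
    refine le_of_sq_le_sq (le_of_eq ?_) (norm_nonneg _)
    rw [← @inner_self_eq_norm_sq ℂ, ← @inner_self_eq_norm_sq ℂ, inner_fockIncl]
  calc ‖fockProj V‖ ≤ ‖fockIncl V‖ * ‖ContinuousLinearMap.adjoint (fockIncl V)‖ :=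
        ContinuousLinearMap.opNorm_comp_le _ _
    _ ≤ 1 := by
        rw [LinearIsometryEquiv.norm_map]
        exact mul_le_one₀ h1 (norm_nonneg _) h1

/-- Vectors orthogonal to the ranges of all `e(f)`, `f ∈ (ran V)ᗮ`, vanish, so an operator killed
by the adjoints of these is zero. -/
theorem eq_zero_of_star_fockMul_mul {V : H →ₗᵢ[ℂ] H} {T : Fock H →L[ℂ] Fock H}
    (h : ∀ f : perp V, star (fockMul V (expVec f)) * T = 0) : T = 0 :=
  ContinuousLinearMap.ext fun v => (isTotal_fockMul V).ext_inner fun p => by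
    have := congrArg (fun A => A v) (h p.1)
    simp only [mul_apply_eq_comp, ContinuousLinearMap.star_eq_adjoint] at this
    rw [← ContinuousLinearMap.adjoint_inner_right, this]
    simp

end Vacuum

/-- A space that is in measurable bijection with a Borel subset of a standard Borel space is
standard Borel. -/
theorem standardBorelSpace_of_leftInverse {α β : Type*} [MeasurableSpace α]
    [MeasurableSpace β] [StandardBorelSpace β] {s : Set β} (hs : MeasurableSet s) {f : α → β}
    {g : β → α} (hf : Measurable f) (hg : Measurable fun b : s => g b) (hfs : ∀ x, f x ∈ s)
    (hgf : ∀ x, g (f x) = x) (hfg : ∀ b ∈ s, f (g b) = b) : StandardBorelSpace α := by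
  let e : α ≃ᵐ s :=
    { toFun := fun x => ⟨f x, hfs x⟩
      invFun := fun b => g b
      left_inv := hgf
      right_inv := fun b => Subtype.ext (hfg b b.2)
      measurable_toFun := hf.subtype_mk
      measurable_invFun := hg }
  have := hs.standardBorel
  let _ := upgradeStandardBorel s
  let _ : TopologicalSpace α := TopologicalSpace.induced e inferInstance
  have h1 : PolishSpace α := e.toEquiv.polishSpace_induced
  have h2 : BorelSpace α := e.measurableEmbedding.borelSpace ⟨rfl⟩
  infer_instance

section CCRSystem

variable {H : Type u} [NormedAddCommGroup H] [InnerProductSpace ℂ H] [CompleteSpace H]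
  [TopologicalSpace.SeparableSpace H]
  {d : ℕ} {P : PointedCone ℝ (EuclideanSpace ℝ (Fin d))} (V : P → (H →ₗᵢ[ℂ] H))
  (hV : IsIsometricRepresentation V) (hV' : ∀ f, Continuous fun a => coisom (V a) f)

/-- An intertwiner orthogonal to the operators `e(g) ↦ e(f + Vₐ g)` for all `f` is zero: these
operators are total in the fibre. -/
theorem isTotal_fiber {a : P} : IsTotal fun f : perp (V a) =>
    (⟨fockMul (V a) (expVec f), fun A => fockEndo_mul (V a) A _⟩ :
      (ccrFlow V hV hV').fiber a) :=
  isTotal_of_inner_eq_zero fun T hT => Subtype.ext <| eq_zero_of_star_fockMul_mul (V := V a)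
    fun f => by
      have := (ccrFlow V hV hV').star_mul_fiber
        ⟨fockMul (V a) (expVec f), fun A => fockEndo_mul (V a) A _⟩ T
      rw [hT f, zero_smul] at this
      exact this

theorem exists_fockFiber (a : P) :
    ∃ κ : Fock (perp (V a)) ≃ₗᵢ[ℂ] (ccrFlow V hV hV').fiber a,
      ∀ ξ, (κ ξ : Fock H →L[ℂ] Fock H) = fockMul (V a) ξ := by
  obtain ⟨κ, hκ⟩ := (isTotal_expVec (H := perp (V a))).exists_equiv (isTotal_fiber V hV hV')
    fun f f' => (ccrFlow V hV hV').inner_eq_of_star_mul (star_fockMul_mul (V a) _ _)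
  refine ⟨κ, fun ξ => ?_⟩
  have : ((ccrFlow V hV hV').fiber a).subtypeL.comp
      (κ.toContinuousLinearEquiv : _ →L[ℂ] (ccrFlow V hV hV').fiber a) = fockMul (V a) :=
    isTotal_expVec.clm_ext fun f => congrArg Subtype.val (hκ f)
  exact congrArg (fun T => T ξ) this

/-- The identification of `Γ((ran Vₐ)ᗮ)` with the space of intertwiners at `a`. -/
def fockFiber (a : P) : Fock (perp (V a)) ≃ₗᵢ[ℂ] (ccrFlow V hV hV').fiber a :=
  (exists_fockFiber V hV hV' a).choose

theorem coe_fockFiber (a : P) (ξ : Fock (perp (V a))) :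
    (fockFiber V hV hV' a ξ : Fock H →L[ℂ] Fock H) = fockMul (V a) ξ :=
  (exists_fockFiber V hV hV' a).choose_spec ξ

variable {V hV hV'}

theorem exists_eq_fockMul {a : P} (T : (ccrFlow V hV hV').fiber a) :
    ∃ ξ, (T : Fock H →L[ℂ] Fock H) = fockMul (V a) ξ :=
  ⟨(fockFiber V hV hV' a).symm T, by
    rw [← coe_fockFiber V hV hV', LinearIsometryEquiv.apply_symm_apply]⟩

theorem inner_apply_vacuum {a : P} (S T : (ccrFlow V hV hV').fiber a) :
    inner ℂ (S.1 (expVec 0)) (T.1 (expVec 0)) = inner ℂ S T := by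
  rw [E0Semigroup.inner_fiber_apply, inner_vacuum, mul_one]

/-- An intertwiner is determined by its value at the vacuum vector, through an explicit formula for
its matrix elements. -/
theorem inner_fiber_expVec {a : P} (T : (ccrFlow V hV hV').fiber a) (h g : H) :
    inner ℂ (expVec h) (T.1 (expVec g)) =
      inner ℂ (expVec h) (T.1 (expVec 0)) * Complex.exp (inner ℂ h (V a g)) := by
  obtain ⟨ξ, hξ⟩ := exists_eq_fockMul T
  rw [hξ]
  have : (innerSL ℂ (expVec h)).comp ((fockMul (V a)).flip (expVec g)) =
      (Complex.exp (inner ℂ h (V a g))) • (innerSL ℂ (expVec h)).comp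
        ((fockMul (V a)).flip (expVec 0)) := isTotal_expVec.clm_ext fun f => by
    simp [fockMul_expVec, inner_expVec, Complex.exp_add, mul_comm]
  have h2 := congrArg (fun T => T ξ) this
  simp only [ContinuousLinearMap.comp_apply, ContinuousLinearMap.flip_apply, innerSL_apply_apply,
    smul_apply, smul_eq_mul] at h2
  rw [h2, mul_comm]

theorem continuous_perpPart (hV : IsIsometricRepresentation V)
    (hV' : ∀ f, Continuous fun a => coisom (V a) f) (h : H) :
    Continuous fun a => (perpPart (V a) h : H) := by
  simp only [perpPart]
  refine continuous_const.sub ?_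
  exact continuous_apply_of_norm_le (T := fun a => (V a).toContinuousLinearMap) (C := 1)
    (fun a => (V a).norm_toContinuousLinearMap_le) hV.continuous (hV' h)

theorem continuous_fockProj (hV : IsIsometricRepresentation V)
    (hV' : ∀ f, Continuous fun a => coisom (V a) f) :
    Continuous fun p : P × Fock H => fockProj (V p.1) p.2 :=
  continuous_apply_of_norm_le (T := fun p : P × Fock H => fockProj (V p.1))
    (fun p => norm_fockProj_le _) (fun v => (continuous_of_isTotal
      (fun a => norm_fockProj_le (V a)) isTotal_expVec (fun h => by
        simp only [fockProj_expVec]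
        exact continuous_expVec.comp (continuous_perpPart hV hV' h)) v).comp continuous_fst)
    continuous_snd

/-- An intertwiner is determined by its value at the vacuum vector, and its values at the other
exponential vectors depend measurably on that value. -/
theorem measurable_op_expVec {β : Type*} [MeasurableSpace β]
    {f : β → (ccrFlow V hV hV').productSystem.Total} (h1 : Measurable fun b => (f b).1)
    (h2 : Measurable fun b => (ccrFlow V hV hV').op (f b) (expVec 0)) (g : H) :
    Measurable fun b => (ccrFlow V hV hV').op (f b) (expVec g) :=
  isTotal_expVec.measurable fun h => by
    have : (fun b => inner ℂ (expVec h) ((ccrFlow V hV hV').op (f b) (expVec g))) = fun b =>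
        inner ℂ (expVec h) ((ccrFlow V hV hV').op (f b) (expVec 0)) *
          Complex.exp (inner ℂ h (V (f b).1 g)) := funext fun b => inner_fiber_expVec _ h g
    rw [this]
    refine (measurable_const.inner h2).mul (Complex.measurable_exp.comp ?_)
    exact ((continuous_const.inner (hV.continuous g)).measurable (α := P)).comp h1

theorem measurable_star_op {β : Type*} [MeasurableSpace β]
    {f : β → (ccrFlow V hV hV').productSystem.Total} (h1 : Measurable fun b => (f b).1)
    (h2 : Measurable fun b => (ccrFlow V hV hV').op (f b) (expVec 0)) (ξ : Fock H) :
    Measurable fun b => star ((ccrFlow V hV hV').op (f b)) ξ :=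
  isTotal_expVec.measurable fun g => by
    simp only [ContinuousLinearMap.star_eq_adjoint, ContinuousLinearMap.adjoint_inner_right]
    exact (measurable_op_expVec h1 h2 g).inner measurable_const

/-- The measurable structure of the product system of a CCR flow is that of a subset of
`P × Γ(H)`. -/
theorem measurable_ccr_iff {β : Type*} [MeasurableSpace β]
    {f : β → (ccrFlow V hV hV').productSystem.Total} :
    Measurable f ↔ Measurable (fun b => (f b).1) ∧
      Measurable fun b => (ccrFlow V hV hV').op (f b) (expVec 0) := by
  rw [E0Semigroup.measurable_total_iff]
  refine and_congr_right fun h1 => ⟨fun h => isTotal_expVec.measurable fun g => h _ _,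
    fun h2 ξ ζ => ?_⟩
  have h5 : Measurable fun b => inner ℂ (star ((ccrFlow V hV hV').op (f b)) ξ) ζ :=
    (measurable_star_op h1 h2 ξ).inner (measurable_const (a := ζ))
  simpa only [ContinuousLinearMap.star_eq_adjoint, ContinuousLinearMap.adjoint_inner_left] using h5

end CCRSystem

section CCRSystem

variable {H : Type u} [NormedAddCommGroup H] [InnerProductSpace ℂ H] [CompleteSpace H]
  [TopologicalSpace.SeparableSpace H]
  {d : ℕ} {P : PointedCone ℝ (EuclideanSpace ℝ (Fin d))} {V : P → (H →ₗᵢ[ℂ] H)}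
  {hV : IsIsometricRepresentation V} {hV' : ∀ f, Continuous fun a => coisom (V a) f}

theorem ccr_isSection_iff {s : ∀ a, (ccrFlow V hV hV').fiber a} :
    (ccrFlow V hV hV').productSystem.IsSection s ↔
      Measurable fun a => (s a).1 (expVec (0 : H)) :=
  (measurable_ccr_iff (f := fun a => (ccrFlow V hV hV').productSystem.pt (a := a) (s a))).trans
    ⟨fun h => h.2, fun h => ⟨measurable_id, h⟩⟩

theorem coe_fockFiber_vacuum (a : P) (ξ : Fock (perp (V a))) :
    (fockFiber V hV hV' a ξ).1 (expVec 0) = fockIncl (V a) ξ := by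
  rw [coe_fockFiber]; rfl

theorem isSection_fockFiber_perpPart (h : H) : (ccrFlow V hV hV').productSystem.IsSection
    fun a => fockFiber V hV hV' a (expVec (perpPart (V a) h)) := by
  refine ccr_isSection_iff.2 ?_
  simp only [coe_fockFiber_vacuum, fockIncl_expVec]
  exact (continuous_expVec.comp (continuous_perpPart hV hV' h)).measurable

theorem ccr_total_ext {x y : (ccrFlow V hV hV').productSystem.Total} (h1 : x.1 = y.1)
    (h2 : (ccrFlow V hV hV').op x (expVec 0) = (ccrFlow V hV hV').op y (expVec 0)) : x = y := by
  obtain ⟨a, T⟩ := x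
  obtain ⟨b, S⟩ := y
  obtain rfl : a = b := h1
  refine E0Semigroup.pt_eq_pt _ rfl (isTotal_expVec.clm_ext fun g => isTotal_expVec.ext_inner
    fun h => ?_)
  rw [inner_fiber_expVec (hV := hV) (hV' := hV') T h g,
    inner_fiber_expVec (hV := hV) (hV' := hV') S h g]
  congr 2

/-- The vector of the total space that corresponds to `ξ ∈ Γ((ran Vₐ)ᗮ)`. -/
def ccrPt (hV : IsIsometricRepresentation V) (hV' : ∀ f, Continuous fun a => coisom (V a) f)
    (a : P) (ξ : Fock (perp (V a))) : (ccrFlow V hV hV').productSystem.Total :=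
  (ccrFlow V hV hV').productSystem.pt (a := a) (fockFiber V hV hV' a ξ)

theorem op_ccrPt (a : P) (ξ : Fock (perp (V a))) :
    (ccrFlow V hV hV').op (ccrPt hV hV' a ξ) (expVec 0) = fockIncl (V a) ξ :=
  coe_fockFiber_vacuum a ξ

theorem exists_eq_ccrPt (x : (ccrFlow V hV hV').productSystem.Total) :
    ∃ a ξ, x = ccrPt hV hV' a ξ :=
  ⟨x.1, (fockFiber V hV hV' x.1).symm x.2,
    ccr_total_ext rfl (congrArg (fun T : (ccrFlow V hV hV').fiber x.1 => T.1 (expVec 0))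
      ((fockFiber V hV hV' x.1).apply_symm_apply x.2).symm)⟩

variable (hV hV')

/-- A point of the total space, as a point of `P × Γ(H)`. -/
def ccrVec (x : (ccrFlow V hV hV').productSystem.Total) : P × Fock H :=
  (x.1, (ccrFlow V hV hV').op x (expVec 0))

theorem ccrVec_ccrPt (a : P) (ξ : Fock (perp (V a))) :
    ccrVec hV hV' (ccrPt hV hV' a ξ) = (a, fockIncl (V a) ξ) :=
  Prod.ext rfl (op_ccrPt a ξ)

theorem fockProj_ccrVec (x : (ccrFlow V hV hV').productSystem.Total) :
    fockProj (V (ccrVec hV hV' x).1) (ccrVec hV hV' x).2 = (ccrVec hV hV' x).2 := by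
  obtain ⟨a, ξ, rfl⟩ := exists_eq_ccrPt x
  rw [ccrVec_ccrPt]
  exact fockProj_fockIncl _ ξ

theorem measurable_ccrVec : Measurable (ccrVec hV hV') :=
  let h := measurable_ccr_iff.1 (measurable_id (α := (ccrFlow V hV hV').productSystem.Total))
  h.1.prodMk h.2

theorem ccrVec_ccrPt_adjoint {p : P × Fock H} (hp : fockProj (V p.1) p.2 = p.2) :
    ccrVec hV hV' (ccrPt hV hV' p.1 (ContinuousLinearMap.adjoint (fockIncl (V p.1)) p.2)) = p := by
  rw [ccrVec_ccrPt]
  exact Prod.ext rfl hp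

theorem measurable_ccrPt_adjoint {β : Type*} [MeasurableSpace β] {f : β → P × Fock H}
    (hf : Measurable f) (h : ∀ b, fockProj (V (f b).1) (f b).2 = (f b).2) :
    Measurable fun b => ccrPt hV hV' (f b).1
      (ContinuousLinearMap.adjoint (fockIncl (V (f b).1)) (f b).2) := by
  have h1 : (fun b => (ccrFlow V hV hV').op (ccrPt hV hV' (f b).1
      (ContinuousLinearMap.adjoint (fockIncl (V (f b).1)) (f b).2)) (expVec 0)) =
      fun b => (f b).2 := funext fun b => (op_ccrPt _ _).trans (h b)
  exact measurable_ccr_iff.2 ⟨hf.fst, by rw [h1]; exact hf.snd⟩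

/-- The total space of the product system of a CCR flow is isomorphic to a closed subset of
`P × Γ(H)`. -/
theorem standardBorelSpace_ccr (hP : IsClosed (P : Set (EuclideanSpace ℝ (Fin d)))) :
    StandardBorelSpace (ccrFlow V hV hV').productSystem.Total := by
  have : PolishSpace P := hP.polishSpace
  have h : IsClosed {p : P × Fock H | fockProj (V p.1) p.2 = p.2} :=
    isClosed_eq (continuous_fockProj hV hV') continuous_snd
  refine standardBorelSpace_of_leftInverse h.measurableSet (f := ccrVec hV hV')
    (g := fun p => ccrPt hV hV' p.1 (ContinuousLinearMap.adjoint (fockIncl (V p.1)) p.2))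
    (measurable_ccrVec hV hV') (measurable_ccrPt_adjoint hV hV' measurable_subtype_coe fun p => p.2)
    (fockProj_ccrVec hV hV') (fun x => ?_) fun p hp => ccrVec_ccrPt_adjoint hV hV' hp
  obtain ⟨a, ξ, rfl⟩ := exists_eq_ccrPt x
  have h1 : ccrVec hV hV' (ccrPt hV hV' a ξ) = (a, fockIncl (V a) ξ) := ccrVec_ccrPt hV hV' a ξ
  rw [h1]
  exact congrArg _ (adjoint_fockIncl_fockIncl _ ξ)

theorem fiber_inner_mul {a b : P} (ξ ξ' : (ccrFlow V hV hV').fiber a)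
    (ζ ζ' : (ccrFlow V hV hV').fiber b) :
    star (ξ.1 * ζ.1) * (ξ'.1 * ζ'.1) =
      (inner ℂ ξ ξ' * inner ℂ ζ ζ' : ℂ) • (1 : Fock H →L[ℂ] Fock H) := by
  rw [star_mul, _root_.mul_assoc, ← _root_.mul_assoc (star ξ.1), E0Semigroup.star_mul_fiber,
    smul_mul_assoc, one_mul, mul_smul_comm, E0Semigroup.star_mul_fiber, smul_smul]

theorem isTotal_mul_fiber {a b : P} {ι : Type*} {x : ι → (ccrFlow V hV hV').fiber (a + b)}
    (hx : ∀ (ξ : (ccrFlow V hV hV').fiber a) (ζ : (ccrFlow V hV hV').fiber b),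
      ∃ i, (x i).1 = ξ.1 * ζ.1) : IsTotal x :=
  isTotal_of_inner_eq_zero fun T hT => Subtype.ext <|
    eq_zero_of_star_fockMul_mul (V := V a) fun f =>
      eq_zero_of_star_fockMul_mul (V := V b) fun g => by
        obtain ⟨i, hi⟩ := hx (fockFiber V hV hV' a (expVec f)) (fockFiber V hV hV' b (expVec g))
        have := (ccrFlow V hV hV').star_mul_fiber (x i) T
        rw [hT i, zero_smul, hi, star_mul, coe_fockFiber, coe_fockFiber] at this
        rw [← _root_.mul_assoc, this]

/-- A section of intertwiners whose inner products with the fundamental sections are measurable has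
measurable values at the vacuum vector. -/
theorem measurable_of_inner_section {s : ∀ a, (ccrFlow V hV hV').fiber a}
    (hs : ∀ h : H, Measurable fun a =>
      (inner ℂ (s a) (fockFiber V hV hV' a (expVec (perpPart (V a) h))) : ℂ)) :
    Measurable fun a => (s a).1 (expVec (0 : H)) := by
  refine isTotal_expVec.measurable fun h => ?_
  have h1 : (fun a => (inner ℂ (expVec h) ((s a).1 (expVec 0)) : ℂ)) = fun a =>
      conj (inner ℂ (s a) (fockFiber V hV hV' a (expVec (perpPart (V a) h))) : ℂ) := by
    funext a
    obtain ⟨ξ, hξ⟩ := (fockFiber V hV hV' a).surjective (s a)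
    rw [← hξ, (fockFiber V hV hV' a).inner_map_map ξ, coe_fockFiber_vacuum,
      ← ContinuousLinearMap.adjoint_inner_left, adjoint_fockIncl_expVec]
    exact (inner_conj_symm _ _).symm
  rw [h1]
  exact Complex.continuous_conj.measurable.comp (hs h)

theorem denseRange_perpPart (a : P) :
    DenseRange fun n => perpPart (V a) (TopologicalSpace.denseSeq H n) := by
  have h1 : Continuous (perpPart (V a)) := by
    unfold perpPart
    refine Continuous.subtype_mk ?_ _
    fun_prop
  have h2 : Function.Surjective (perpPart (V a)) := fun f => ⟨f, perpPart_coe _ _⟩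
  exact h2.denseRange.comp (TopologicalSpace.denseRange_denseSeq H) h1

theorem isTotal_fundamental (a : P) : IsTotal fun n => fockFiber V hV hV' a
    (expVec (perpPart (V a) (TopologicalSpace.denseSeq H n))) := by
  refine isTotal_of_inner_eq_zero fun T hT => ?_
  obtain ⟨ξ, rfl⟩ := (fockFiber V hV hV' a).surjective T
  have h1 := isTotal_expVec.comp_denseRange continuous_expVec (denseRange_perpPart (V := V) a)
  rw [h1.ext_inner (v := ξ) (w := 0) fun n => by
    rw [inner_zero_right, ← hT n, LinearIsometryEquiv.inner_map_map]; rfl, map_zero]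

/-- The intertwiners at `a` form a copy of `Γ((ran Vₐ)ᗮ)`, seen inside `Γ(H)` by evaluation at the
vacuum vector. All measurability conditions reduce to `measurable_ccr_iff`. -/
theorem isProductSystem_ccrFlow (hP : IsClosed (P : Set (EuclideanSpace ℝ (Fin d)))) :
    (ccrFlow V hV hV').productSystem.IsProductSystem where
  complete a := inferInstanceAs (CompleteSpace ((ccrFlow V hV hV').fiber a))
  separable a := (fockFiber V hV hV' a).surjective.denseRange.separableSpace
    (fockFiber V hV hV' a).continuous
  nontrivial a := (fockFiber V hV hV' a).injective.nontrivial
  standardBorel := standardBorelSpace_ccr hV hV' hP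
  measurable_proj := (measurable_ccr_iff.1 measurable_id).1
  add_mul ξ ξ' ζ := Subtype.ext (_root_.add_mul ξ.1 ξ'.1 ζ.1)
  smul_mul c ξ ζ := Subtype.ext (smul_mul_assoc c ξ.1 ζ.1)
  mul_add ξ ζ ζ' := Subtype.ext (_root_.mul_add ξ.1 ζ.1 ζ'.1)
  mul_smul c ξ ζ := Subtype.ext (mul_smul_comm c ξ.1 ζ.1)
  inner_mul ξ ξ' ζ ζ' := E0Semigroup.inner_eq_of_star_mul _ (fiber_inner_mul hV hV' ξ ξ' ζ ζ')
  total_mul a b := by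
    have := isTotal_iff.1 (isTotal_mul_fiber hV hV' (a := a) (b := b)
      (x := fun p : (ccrFlow V hV hV').fiber a × (ccrFlow V hV hV').fiber b =>
        (ccrFlow V hV hV').productSystem.mul p.1 p.2) fun ξ ζ => ⟨(ξ, ζ), rfl⟩)
    refine Eq.trans (congrArg (fun s => (Submodule.span ℂ s).topologicalClosure) ?_) this
    ext T
    exact ⟨fun ⟨ξ, ζ, h⟩ => ⟨(ξ, ζ), h.symm⟩, fun ⟨p, h⟩ => ⟨p.1, p.2, h.symm⟩⟩
  mul_assoc {a b c} ξ ζ χ := E0Semigroup.pt_eq_pt _ (_root_.add_assoc a b c)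
    (_root_.mul_assoc ξ.1 ζ.1 χ.1)
  exists_unit := by
    have hmem : (1 : Fock H →L[ℂ] Fock H) ∈ (ccrFlow V hV hV').fiber 0 := fun A => by
      rw [mul_one, one_mul, (ccrFlow V hV hV').map_zero]
    refine ⟨(⟨1, hmem⟩ : (ccrFlow V hV hV').fiber 0), fun ξ => ?_, fun a ξ => ⟨?_, ?_⟩⟩
    · obtain ⟨c, hc⟩ := (ccrFlow V hV hV').exists_scalar (a := 0) ⟨1, hmem⟩ ξ
      rw [star_one, one_mul] at hc
      exact ⟨c, Subtype.ext hc⟩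
    · exact E0Semigroup.pt_eq_pt _ (zero_add a) (one_mul ξ.1)
    · exact E0Semigroup.pt_eq_pt _ (add_zero a) (mul_one ξ.1)
  measurable_mul := by
    have h1 := measurable_ccr_iff.1
      (measurable_fst (α := (ccrFlow V hV hV').productSystem.Total)
        (β := (ccrFlow V hV hV').productSystem.Total))
    have h2 := measurable_ccr_iff.1
      (measurable_snd (α := (ccrFlow V hV hV').productSystem.Total)
        (β := (ccrFlow V hV hV').productSystem.Total))
    refine measurable_ccr_iff.2 ⟨?_, ?_⟩
    · have : Measurable fun x : P × P => x.1 + x.2 :=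
        ((measurable_subtype_coe.comp measurable_fst).add
          (measurable_subtype_coe.comp measurable_snd)).subtype_mk
      exact this.comp (h1.1.prodMk h2.1)
    · refine isTotal_expVec.measurable fun h => ?_
      have h3 : Measurable fun x : (ccrFlow V hV hV').productSystem.Total ×
          (ccrFlow V hV hV').productSystem.Total =>
          (inner ℂ (star ((ccrFlow V hV hV').op x.1) (expVec h))
            ((ccrFlow V hV hV').op x.2 (expVec 0)) : ℂ) :=
        (measurable_star_op h1.1 h1.2 (expVec h)).inner h2.2
      simp only [ContinuousLinearMap.star_eq_adjoint,
        ContinuousLinearMap.adjoint_inner_left] at h3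
      exact h3
  measurable_inner s t hs ht := by
    have h : Measurable fun a => (inner ℂ ((show (ccrFlow V hV hV').fiber a from s a).1 (expVec 0))
        ((show (ccrFlow V hV hV').fiber a from t a).1 (expVec 0)) : ℂ) :=
      (ccr_isSection_iff.1 hs).inner (ccr_isSection_iff.1 ht)
    exact (funext fun a => inner_apply_vacuum _ _ : _ = fun a => (inner ℂ
      (show (ccrFlow V hV hV').fiber a from s a)
      (show (ccrFlow V hV hV').fiber a from t a) : ℂ)) ▸ h
  isSection_of_inner s hs := ccr_isSection_iff.2 (measurable_of_inner_section hV hV' fun h =>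
    hs _ (isSection_fockFiber_perpPart h))
  exists_fundamental := ⟨fun n a => fockFiber V hV hV' a
    (expVec (perpPart (V a) (TopologicalSpace.denseSeq H n))),
    fun n => isSection_fockFiber_perpPart _, fun a => isTotal_iff.1 (isTotal_fundamental hV hV' a)⟩

end CCRSystem

/-! ### Transport of product systems along isomorphisms -/

namespace ProductSystemData

section Transport

variable {P : Type u} [AddMonoid P] {E : ProductSystemData.{u, v} P}
  {F : ProductSystemData.{u, w} P}

/-- The map of total spaces given by an isomorphism. -/
def Iso.map (θ : E.Iso F) (x : E.Total) : F.Total := F.pt (θ.toEquiv x.1 x.2)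

/-- The inverse of the map of total spaces given by an isomorphism. -/
def Iso.inv (θ : E.Iso F) (y : F.Total) : E.Total := E.pt ((θ.toEquiv y.1).symm y.2)

theorem Iso.map_pt (θ : E.Iso F) {a : P} (ξ : E.Fib a) :
    θ.map (E.pt ξ) = F.pt (θ.toEquiv a ξ) := rfl

theorem Iso.inv_map (θ : E.Iso F) (x : E.Total) : θ.inv (θ.map x) = x :=
  Sigma.ext rfl (heq_of_eq ((θ.toEquiv x.1).symm_apply_apply x.2))

theorem Iso.map_inv (θ : E.Iso F) (y : F.Total) : θ.map (θ.inv y) = y :=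
  Sigma.ext rfl (heq_of_eq ((θ.toEquiv y.1).apply_symm_apply y.2))

theorem Iso.isSection [MeasurableSpace P] (θ : E.Iso F) {s : ∀ a, E.Fib a} (hs : E.IsSection s) :
    F.IsSection fun a => θ.toEquiv a (s a) :=
  θ.measurable_toFun.comp hs

theorem Iso.isSection_symm [MeasurableSpace P] (θ : E.Iso F) {s : ∀ a, F.Fib a}
    (hs : F.IsSection s) : E.IsSection fun a => (θ.toEquiv a).symm (s a) :=
  θ.measurable_invFun.comp hs

theorem Iso.dense_image (θ : E.Iso F) {a : P} {s : Set (E.Fib a)}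
    (hs : (Submodule.span ℂ s).topologicalClosure = ⊤) {t : Set (F.Fib a)}
    (h : θ.toEquiv a '' s ⊆ t) : (Submodule.span ℂ t).topologicalClosure = ⊤ := by
  rw [← Submodule.dense_iff_topologicalClosure_eq_top] at hs ⊢
  have h1 := (θ.toEquiv a).surjective.denseRange.dense_image (θ.toEquiv a).continuous hs
  refine h1.mono ?_
  rintro _ ⟨x, hx, rfl⟩
  have h2 : (θ.toEquiv a).toLinearEquiv.toLinearMap x ∈
      (Submodule.span ℂ s).map (θ.toEquiv a).toLinearEquiv.toLinearMap :=
    Submodule.mem_map_of_mem hx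
  rw [Submodule.map_span] at h2
  exact Submodule.span_mono h h2

/-- The axioms of a product system are invariant under isomorphism. -/
theorem IsProductSystem.of_iso [MeasurableSpace P] (hE : E.IsProductSystem) (θ : E.Iso F) :
    F.IsProductSystem where
  complete a := by
    have := hE.complete a
    exact (completeSpace_congr (e := (θ.toEquiv a).toEquiv)
      (θ.toEquiv a).isometry.isUniformEmbedding).1 this
  separable a := by
    have := hE.separable a
    exact (θ.toEquiv a).surjective.denseRange.separableSpace (θ.toEquiv a).continuous
  nontrivial a := by
    have := hE.nontrivial a
    exact (θ.toEquiv a).injective.nontrivial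
  standardBorel := by
    have := hE.standardBorel
    exact standardBorelSpace_of_leftInverse MeasurableSet.univ (f := θ.inv) (g := θ.map)
      θ.measurable_invFun (θ.measurable_toFun.comp measurable_subtype_coe) (fun _ => trivial)
      θ.map_inv fun x _ => θ.inv_map x
  measurable_proj := hE.measurable_proj.comp θ.measurable_invFun
  add_mul {a b} ξ ξ' ζ := by
    obtain ⟨ξ, rfl⟩ := (θ.toEquiv a).surjective ξ
    obtain ⟨ξ', rfl⟩ := (θ.toEquiv a).surjective ξ'
    obtain ⟨ζ, rfl⟩ := (θ.toEquiv b).surjective ζ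
    rw [← map_add, ← θ.map_mul, hE.add_mul, map_add, θ.map_mul, θ.map_mul]
  smul_mul {a b} c ξ ζ := by
    obtain ⟨ξ, rfl⟩ := (θ.toEquiv a).surjective ξ
    obtain ⟨ζ, rfl⟩ := (θ.toEquiv b).surjective ζ
    rw [← map_smul, ← θ.map_mul, hE.smul_mul, map_smul, θ.map_mul]
  mul_add {a b} ξ ζ ζ' := by
    obtain ⟨ξ, rfl⟩ := (θ.toEquiv a).surjective ξ
    obtain ⟨ζ, rfl⟩ := (θ.toEquiv b).surjective ζ
    obtain ⟨ζ', rfl⟩ := (θ.toEquiv b).surjective ζ'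
    rw [← map_add, ← θ.map_mul, hE.mul_add, map_add, θ.map_mul, θ.map_mul]
  mul_smul {a b} c ξ ζ := by
    obtain ⟨ξ, rfl⟩ := (θ.toEquiv a).surjective ξ
    obtain ⟨ζ, rfl⟩ := (θ.toEquiv b).surjective ζ
    rw [← map_smul, ← θ.map_mul, hE.mul_smul, map_smul, θ.map_mul]
  inner_mul {a b} ξ ξ' ζ ζ' := by
    obtain ⟨ξ, rfl⟩ := (θ.toEquiv a).surjective ξ
    obtain ⟨ξ', rfl⟩ := (θ.toEquiv a).surjective ξ'
    obtain ⟨ζ, rfl⟩ := (θ.toEquiv b).surjective ζ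
    obtain ⟨ζ', rfl⟩ := (θ.toEquiv b).surjective ζ'
    rw [← θ.map_mul, ← θ.map_mul, LinearIsometryEquiv.inner_map_map,
      LinearIsometryEquiv.inner_map_map, LinearIsometryEquiv.inner_map_map, hE.inner_mul]
  total_mul a b := θ.dense_image (hE.total_mul a b) (by
    rintro _ ⟨_, ⟨ξ, ζ, rfl⟩, rfl⟩
    exact ⟨_, _, θ.map_mul ξ ζ⟩)
  mul_assoc {a b c} ξ ζ χ := by
    obtain ⟨ξ, rfl⟩ := (θ.toEquiv a).surjective ξ
    obtain ⟨ζ, rfl⟩ := (θ.toEquiv b).surjective ζ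
    obtain ⟨χ, rfl⟩ := (θ.toEquiv c).surjective χ
    rw [← θ.map_mul, ← θ.map_mul, ← θ.map_mul, ← θ.map_mul, ← θ.map_pt, ← θ.map_pt,
      hE.mul_assoc]
  exists_unit := by
    obtain ⟨e, h1, h2⟩ := hE.exists_unit
    refine ⟨θ.toEquiv 0 e, fun ξ => ?_, fun a ξ => ?_⟩
    · obtain ⟨ξ, rfl⟩ := (θ.toEquiv 0).surjective ξ
      obtain ⟨c, hc⟩ := h1 ξ
      exact ⟨c, by rw [← map_smul, ← hc]⟩
    · obtain ⟨ξ, rfl⟩ := (θ.toEquiv a).surjective ξ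
      rw [← θ.map_mul, ← θ.map_mul, ← θ.map_pt, ← θ.map_pt, ← θ.map_pt, (h2 a ξ).1, (h2 a ξ).2]
      exact ⟨rfl, rfl⟩
  measurable_mul := by
    have h := θ.measurable_toFun.comp (hE.measurable_mul.comp
      ((θ.measurable_invFun.comp measurable_fst).prodMk (θ.measurable_invFun.comp measurable_snd)))
    convert h using 2 with x
    refine congrArg F.pt ?_
    refine Eq.trans ?_ (θ.map_mul _ _).symm
    exact congrArg₂ F.mul ((θ.toEquiv _).apply_symm_apply _).symm
      ((θ.toEquiv _).apply_symm_apply _).symm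
  measurable_inner s t hs ht := by
    have h := hE.measurable_inner _ _ (θ.isSection_symm hs) (θ.isSection_symm ht)
    simpa only [LinearIsometryEquiv.inner_map_map] using h
  isSection_of_inner s hs := by
    have h := hE.isSection_of_inner (fun a => (θ.toEquiv a).symm (s a)) fun t ht => by
      have h1 := hs _ (θ.isSection ht)
      convert h1 using 2 with a
      rw [← (θ.toEquiv a).inner_map_map, LinearIsometryEquiv.apply_symm_apply]
    have h2 := θ.isSection h
    simpa only [LinearIsometryEquiv.apply_symm_apply] using h2
  exists_fundamental := by
    obtain ⟨s, h1, h2⟩ := hE.exists_fundamental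
    refine ⟨fun n a => θ.toEquiv a (s n a), fun n => θ.isSection (h1 n), fun a =>
      θ.dense_image (h2 a) ?_⟩
    rintro _ ⟨_, ⟨n, rfl⟩, rfl⟩
    exact ⟨n, rfl⟩

end Transport

end ProductSystemData

/-! ### Translations on `L²` -/

-- needed for the separability of `L²` over a countably generated σ-algebra
instance : Fact ((2 : ℝ≥0∞) ≠ ∞) := ⟨by norm_num⟩

theorem indicator_ae_congr {α β : Type*} [MeasurableSpace α] [Zero β] {μ : Measure α} {X : Set α}
    (hX : MeasurableSet X) {f g : α → β} (h : f =ᵐ[μ.restrict X] g) :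
    X.indicator f =ᵐ[μ] X.indicator g := by
  rw [Filter.EventuallyEq, ae_restrict_iff' hX] at h
  filter_upwards [h] with y hy
  by_cases hyX : y ∈ X
  · rw [Set.indicator_of_mem hyX, Set.indicator_of_mem hyX, hy hyX]
  · rw [Set.indicator_of_notMem hyX, Set.indicator_of_notMem hyX]

theorem isTotal_id {K : Type*} [NormedAddCommGroup K] [InnerProductSpace ℂ K] :
    IsTotal (fun g : K => g) := by
  rw [IsTotal, Set.range_id', Submodule.span_univ]
  exact dense_univ

section Translations

variable {Y : Type u} [MeasurableSpace Y] {d : ℕ} [AddAction (EuclideanSpace ℝ (Fin d)) Y]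
  [MeasurableVAdd₂ (EuclideanSpace ℝ (Fin d)) Y] {lam : Measure Y}
  [VAddInvariantMeasure (EuclideanSpace ℝ (Fin d)) Y lam]

variable (lam) in
/-- The unitary `(U_a f)(y) = f(y - a)` on `L²(Y, lam)`. -/
def fullTranslation (a : EuclideanSpace ℝ (Fin d)) : Lp ℂ 2 lam →ₗᵢ[ℂ] Lp ℂ 2 lam :=
  Lp.compMeasurePreservingₗᵢ ℂ (fun y => -a +ᵥ y) (measurePreserving_vadd (-a) lam)

theorem coeFn_fullTranslation (a : EuclideanSpace ℝ (Fin d)) (f : Lp ℂ 2 lam) :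
    fullTranslation lam a f =ᵐ[lam] fun y => f (-a +ᵥ y) :=
  Lp.coeFn_compMeasurePreserving f (measurePreserving_vadd (-a) lam)

theorem fullTranslation_add (a b : EuclideanSpace ℝ (Fin d)) (f : Lp ℂ 2 lam) :
    fullTranslation lam (a + b) f = fullTranslation lam a (fullTranslation lam b f) := by
  refine Lp.ext ?_
  filter_upwards [coeFn_fullTranslation (a + b) f,
    coeFn_fullTranslation a (fullTranslation lam b f),
    (measurePreserving_vadd (-a) lam).quasiMeasurePreserving.ae (coeFn_fullTranslation b f)]
    with y h1 h2 h3
  rw [h1, h2, h3, vadd_vadd, neg_add_rev]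

theorem fullTranslation_zero (f : Lp ℂ 2 lam) :
    fullTranslation lam (0 : EuclideanSpace ℝ (Fin d)) f = f := by
  refine Lp.ext ?_
  filter_upwards [coeFn_fullTranslation (0 : EuclideanSpace ℝ (Fin d)) f] with y h1
  rw [h1, neg_zero, zero_vadd]

theorem measurable_fullTranslation [SigmaFinite lam] [MeasurableSpace.CountablyGenerated Y]
    [MeasurableSpace (Lp ℂ 2 lam)] [BorelSpace (Lp ℂ 2 lam)] (f : Lp ℂ 2 lam) :
    Measurable fun a : EuclideanSpace ℝ (Fin d) => fullTranslation lam a f := by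
  refine isTotal_id.measurable fun g => ?_
  have h1 : ∀ a : EuclideanSpace ℝ (Fin d), (inner ℂ g (fullTranslation lam a f) : ℂ) =
      ∫ y, conj (g y) * f (-a +ᵥ y) ∂lam := fun a => by
    rw [L2.inner_def]
    refine integral_congr_ae ?_
    filter_upwards [coeFn_fullTranslation a f] with y hy
    rw [hy, RCLike.inner_apply, mul_comm]
  simp only [h1]
  have h2 : StronglyMeasurable fun p : EuclideanSpace ℝ (Fin d) × Y =>
      conj (g p.2) * f (-p.1 +ᵥ p.2) := by
    refine Measurable.stronglyMeasurable ?_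
    have hg := (Lp.stronglyMeasurable g).measurable
    have hf := (Lp.stronglyMeasurable f).measurable
    exact (Complex.continuous_conj.measurable.comp (hg.comp measurable_snd)).mul
      (hf.comp (measurable_fst.neg.vadd measurable_snd))
  exact h2.integral_prod_right.measurable

/-- Strong continuity: the orbit of `f` lies in a separable space, so that a ball around some point
of it is visited on a set of positive measure, and the differences of the elements of such a set
form a neighbourhood of zero (Steinhaus). -/
theorem continuous_fullTranslation [SigmaFinite lam] [MeasurableSpace.CountablyGenerated Y]
    (f : Lp ℂ 2 lam) : Continuous fun a : EuclideanSpace ℝ (Fin d) => fullTranslation lam a f := by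
  let _ : MeasurableSpace (Lp ℂ 2 lam) := borel _
  have _ : BorelSpace (Lp ℂ 2 lam) := ⟨rfl⟩
  have hdiff : ∀ a b : EuclideanSpace ℝ (Fin d),
      ‖fullTranslation lam a f - fullTranslation lam b f‖ =
        ‖fullTranslation lam (a - b) f - f‖ := by
    intro a b
    rw [← (fullTranslation lam b).norm_map (fullTranslation lam (a - b) f - f), map_sub,
      ← fullTranslation_add, add_sub_cancel]
  have key : ∀ ε > 0, ∀ᶠ a : EuclideanSpace ℝ (Fin d) in 𝓝 0,
      ‖fullTranslation lam a f - f‖ < ε := by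
    intro ε hε
    let A : ℕ → Set (EuclideanSpace ℝ (Fin d)) := fun n =>
      (fun a => fullTranslation lam a f) ⁻¹'
        Metric.ball (TopologicalSpace.denseSeq (Lp ℂ 2 lam) n) (ε / 2)
    have hA : ∀ n, MeasurableSet (A n) := fun n =>
      measurable_fullTranslation f Metric.isOpen_ball.measurableSet
    have hU : ⋃ n, A n = Set.univ := by
      refine Set.eq_univ_of_forall fun a => Set.mem_iUnion.2 ?_
      obtain ⟨_, ⟨n, rfl⟩, hn⟩ := Metric.mem_closure_iff.1
        ((TopologicalSpace.denseRange_denseSeq (Lp ℂ 2 lam)) (fullTranslation lam a f)) (ε / 2)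
        (by positivity)
      exact ⟨n, hn⟩
    obtain ⟨n, hn⟩ : ∃ n, 0 < volume (A n) := by
      by_contra! h0
      have : volume (⋃ n, A n) = 0 := measure_iUnion_null fun n => nonpos_iff_eq_zero.1 (h0 n)
      rw [hU] at this
      exact (NeZero.ne (volume : Measure (EuclideanSpace ℝ (Fin d))))
        (Measure.measure_univ_eq_zero.1 this)
    have h3 := Measure.sub_mem_nhds_zero_of_addHaar_pos volume (A n) (hA n) hn
    filter_upwards [h3] with c hc
    obtain ⟨a, ha, b, hb, rfl⟩ := hc
    rw [← hdiff, ← dist_eq_norm]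
    calc dist (fullTranslation lam a f) (fullTranslation lam b f) ≤ _ :=
          dist_triangle_right _ _ (TopologicalSpace.denseSeq (Lp ℂ 2 lam) n)
      _ < ε / 2 + ε / 2 := add_lt_add ha hb
      _ = ε := add_halves ε
  rw [continuous_iff_continuousAt]
  intro b
  rw [ContinuousAt, Metric.tendsto_nhds]
  intro ε hε
  have h4 : Tendsto (fun a => a - b) (𝓝 b) (𝓝 0) := by
    have : Continuous fun a : EuclideanSpace ℝ (Fin d) => a - b := by fun_prop
    simpa using this.tendsto b
  filter_upwards [h4.eventually (key ε hε)] with a ha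
  rwa [dist_eq_norm, hdiff]

variable {X : Set Y}

/-- Extension by zero, `L²(X, lam) → L²(Y, lam)`. -/
def extendL2 (hX : MeasurableSet X) : Lp ℂ 2 (lam.restrict X) →ₗᵢ[ℂ] Lp ℂ 2 lam where
  toFun f := ((memLp_indicator_iff_restrict hX).2 (Lp.memLp f)).toLp _
  map_add' f g := by
    rw [← MemLp.toLp_add]
    apply MemLp.toLp_congr
    refine (indicator_ae_congr hX (Lp.coeFn_add f g)).trans ?_
    rw [Set.indicator_add']
  map_smul' c f := by
    rw [RingHom.id_apply, ← MemLp.toLp_const_smul]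
    apply MemLp.toLp_congr
    refine (indicator_ae_congr hX (Lp.coeFn_smul c f)).trans ?_
    exact Filter.EventuallyEq.of_eq (Set.indicator_const_smul X c f)
  norm_map' f := by
    simp only [LinearMap.coe_mk, AddHom.coe_mk, Lp.norm_toLp]
    rw [eLpNorm_indicator_eq_eLpNorm_restrict hX, Lp.norm_def]

theorem extendL2_apply (hX : MeasurableSet X) (f : Lp ℂ 2 (lam.restrict X)) :
    extendL2 hX f = ((memLp_indicator_iff_restrict hX).2 (Lp.memLp f)).toLp _ := rfl

theorem coeFn_extendL2 (hX : MeasurableSet X) (f : Lp ℂ 2 (lam.restrict X)) :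
    extendL2 hX f =ᵐ[lam] X.indicator f := by
  rw [extendL2_apply]
  exact MemLp.coeFn_toLp _

variable {P : PointedCone ℝ (EuclideanSpace ℝ (Fin d))} (hX : MeasurableSet X)
  (hXP : ∀ a ∈ P, ∀ x ∈ X, a +ᵥ x ∈ X)

theorem coeFn_translation (a : P) (f : Lp ℂ 2 (lam.restrict X)) :
    translation (lam := lam) hX hXP a f =ᵐ[lam.restrict X]
      translateFun X (a : EuclideanSpace ℝ (Fin d)) f :=
  MemLp.coeFn_toLp (memLp_translateFun hX (hXP a a.2) f)

omit [MeasurableSpace Y] [MeasurableVAdd₂ (EuclideanSpace ℝ (Fin d)) Y] in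
theorem vadd_set_subset (hXP : ∀ a ∈ P, ∀ x ∈ X, a +ᵥ x ∈ X) (a : P) :
    (a : EuclideanSpace ℝ (Fin d)) +ᵥ X ⊆ X := by
  rintro _ ⟨x, hx, rfl⟩
  exact hXP a a.2 x hx

theorem extendL2_translation (a : P) (f : Lp ℂ 2 (lam.restrict X)) :
    extendL2 hX (translation (lam := lam) hX hXP a f) =
      fullTranslation lam (a : EuclideanSpace ℝ (Fin d)) (extendL2 hX f) := by
  refine Lp.ext ?_
  filter_upwards [coeFn_extendL2 hX (translation (lam := lam) hX hXP a f),
    indicator_ae_congr hX (coeFn_translation (lam := lam) hX hXP a f),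
    coeFn_fullTranslation (a : EuclideanSpace ℝ (Fin d)) (extendL2 hX f),
    (measurePreserving_vadd (-(a : EuclideanSpace ℝ (Fin d))) lam).quasiMeasurePreserving.ae
      (coeFn_extendL2 hX f)] with y h1 h2 h3 h4
  rw [h1, h2, h3, h4]
  have h5 : X.indicator (translateFun X (a : EuclideanSpace ℝ (Fin d)) f) =
      translateFun X (a : EuclideanSpace ℝ (Fin d)) f := by
    rw [translateFun_eq, Set.indicator_indicator, Set.inter_eq_right.2 (vadd_set_subset hXP a)]
  rw [h5]
  rfl

theorem coisom_translation (a : P) (f : Lp ℂ 2 (lam.restrict X)) :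
    coisom (translation (lam := lam) hX hXP a) f =
      ContinuousLinearMap.adjoint (extendL2 (lam := lam) hX).toContinuousLinearMap
        (fullTranslation lam (-(a : EuclideanSpace ℝ (Fin d))) (extendL2 hX f)) :=
  ext_inner_right ℂ fun g => by
    rw [inner_coisom_left, ContinuousLinearMap.adjoint_inner_left, ← (extendL2 hX).inner_map_map,
      extendL2_translation, ← (fullTranslation lam (a : EuclideanSpace ℝ (Fin d))).inner_map_map
        (fullTranslation lam _ _), ← fullTranslation_add, add_neg_cancel, fullTranslation_zero]
    rfl

theorem isIsometricRepresentation_translation [SigmaFinite lam]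
    [MeasurableSpace.CountablyGenerated Y] :
    IsIsometricRepresentation (translation (lam := lam) (P := P) hX hXP) where
  map_zero f := (extendL2 (lam := lam) hX).injective (by
    rw [extendL2_translation]; exact fullTranslation_zero _)
  map_add a b f := (extendL2 (lam := lam) hX).injective (by
    rw [extendL2_translation, extendL2_translation, extendL2_translation]
    exact fullTranslation_add _ _ _)
  continuous f := by
    rw [(extendL2 (lam := lam) hX).isometry.isEmbedding.continuous_iff]
    have h := (continuous_fullTranslation (extendL2 (lam := lam) hX f)).comp
      (continuous_subtype_val (p := fun a => a ∈ P))
    exact h.congr fun a => (extendL2_translation hX hXP a f).symm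

theorem continuous_coisom_translation [SigmaFinite lam] [MeasurableSpace.CountablyGenerated Y]
    (f : Lp ℂ 2 (lam.restrict X)) :
    Continuous fun a : P => coisom (translation (lam := lam) hX hXP a) f := by
  simp only [coisom_translation]
  refine (ContinuousLinearMap.continuous _).comp ?_
  exact (continuous_fullTranslation (extendL2 (lam := lam) hX f)).comp
    (continuous_subtype_val (p := fun a => a ∈ P)).neg

theorem memLp_indicator_vadd (hX : MeasurableSet X) (a : P) (f : Lp ℂ 2 (lam.restrict X)) :
    MemLp (((a : EuclideanSpace ℝ (Fin d)) +ᵥ X).indicator f) 2 (lam.restrict X) :=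
  (Lp.memLp f).indicator (measurableSet_translate hX _)

/-- The range of the translation by `a` contains all functions supported in `X + a`. -/
theorem exists_translation_eq_indicator (a : P) (f : Lp ℂ 2 (lam.restrict X)) :
    ∃ g, translation (lam := lam) hX hXP a g = (memLp_indicator_vadd hX a f).toLp _ := by
  have h1 : MeasurePreserving (fun y : Y => (a : EuclideanSpace ℝ (Fin d)) +ᵥ y) (lam.restrict X)
      ((lam.restrict X).restrict ((a : EuclideanSpace ℝ (Fin d)) +ᵥ X)) := by
    have h2 := (measurePreserving_vadd (a : EuclideanSpace ℝ (Fin d)) lam).restrict_preimage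
      (measurableSet_translate hX (a : EuclideanSpace ℝ (Fin d)))
    rw [Measure.restrict_restrict (measurableSet_translate hX _),
      Set.inter_eq_left.2 (vadd_set_subset hXP a)]
    convert h2 using 2
    ext y
    simp
  have h3 : MemLp (fun y : Y => f ((a : EuclideanSpace ℝ (Fin d)) +ᵥ y)) 2 (lam.restrict X) :=
    ((Lp.memLp f).restrict _).comp_measurePreserving h1
  refine ⟨h3.toLp _, Lp.ext ?_⟩
  refine (coeFn_translation hX hXP a _).trans ((translateFun_congr hX (hXP a a.2)
    h3.coeFn_toLp).trans (Filter.EventuallyEq.trans ?_ (MemLp.coeFn_toLp _).symm))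
  rw [translateFun_eq]
  refine Filter.EventuallyEq.of_eq (congrArg _ ?_)
  ext y
  simp

/-- The functions supported in `X \ (X + a)` are those orthogonal to the range of the translation by
`a`. -/
theorem slabL2_eq_perp (a : P) :
    slabL2 lam X (a : EuclideanSpace ℝ (Fin d)) = perp (translation (lam := lam) hX hXP a) := by
  ext f
  rw [mem_perp]
  constructor
  · intro hf g
    rw [L2.inner_def]
    refine integral_eq_zero_of_ae ?_
    filter_upwards [show ∀ᵐ y ∂lam.restrict X, _ from hf, coeFn_translation hX hXP a g,
      ae_restrict_mem hX] with y h1 h2 hyX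
    by_cases hy : y ∈ (a : EuclideanSpace ℝ (Fin d)) +ᵥ X
    · rw [h1 fun h => h.2 hy, inner_zero_right]; rfl
    · rw [h2, translateFun_eq, Set.indicator_of_notMem hy, inner_zero_left]; rfl
  · intro hf
    obtain ⟨g, hg⟩ := exists_translation_eq_indicator (lam := lam) hX hXP a f
    have h1 := hf g
    have h2 : inner ℂ ((memLp_indicator_vadd hX a f).toLp _) f =
        (inner ℂ ((memLp_indicator_vadd hX a f).toLp _)
          ((memLp_indicator_vadd hX a f).toLp _) : ℂ) := by
      rw [L2.inner_def, L2.inner_def]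
      refine integral_congr_ae ?_
      filter_upwards [(memLp_indicator_vadd hX a f).coeFn_toLp] with y hy
      rw [hy]
      by_cases hy : y ∈ (a : EuclideanSpace ℝ (Fin d)) +ᵥ X
      · rw [Set.indicator_of_mem hy]
      · rw [Set.indicator_of_notMem hy, inner_zero_left, inner_zero_left]
    rw [hg, h2, inner_self_eq_zero] at h1
    have h3 := (memLp_indicator_vadd hX a f).coeFn_toLp
    rw [h1] at h3
    change ∀ᵐ y ∂lam.restrict X, _
    filter_upwards [h3, Lp.coeFn_zero ℂ 2 (lam.restrict X), ae_restrict_mem hX] with y h4 h5 hyX hy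
    have hya : y ∈ (a : EuclideanSpace ℝ (Fin d)) +ᵥ X := by
      by_contra h
      exact hy ⟨hyX, h⟩
    rw [h5, Set.indicator_of_mem hya] at h4
    exact h4.symm

end Translations

/-! ### Exponential functionals of a Poisson process -/

section PoissonExponentials

variable {Y : Type u} [MeasurableSpace Y]

theorem integrable_comp_simpleFunc {α : Type*} {m : Measure Y} (p : SimpleFunc Y α) {k : α → ℂ}
    (hk : ∀ x, k x ≠ 0 → m (p ⁻¹' {x}) ≠ ∞) : Integrable (fun y => k (p y)) m ∧
      ∫ y, k (p y) ∂m = ∑ x ∈ p.range, (m (p ⁻¹' {x})).toReal * k x := by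
  classical
  have h1 : (fun y => k (p y)) =
      fun y => ∑ x ∈ p.range, (p ⁻¹' {x}).indicator (fun _ => k x) y := by
    funext y
    rw [Finset.sum_eq_single (p y)]
    · simp
    · intro x _ hx
      exact Set.indicator_of_notMem (fun h => hx h.symm) _
    · intro h
      exact absurd (p.mem_range_self y) h
  have h2 : ∀ x ∈ p.range, Integrable ((p ⁻¹' {x}).indicator fun _ => k x) m := by
    intro x _
    by_cases hx : k x = 0
    · simp [hx]
    · exact (integrable_indicator_iff (p.measurableSet_fiber x)).2
        (integrableOn_const (hk x hx))
  rw [h1]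
  refine ⟨integrable_finsetSum _ h2, ?_⟩
  rw [integral_finsetSum _ h2]
  refine Finset.sum_congr rfl fun x _ => ?_
  rw [integral_indicator_const _ (p.measurableSet_fiber x), Complex.real_smul]
  rfl

/-- The number of points in `s` of an integer valued measure, with the junk value `0` if it is
infinite. -/
def count (m : Measure Y) (s : Set Y) : ℕ := ⌊(m s).toReal⌋₊

theorem measurable_count {s : Set Y} (hs : MeasurableSet s) :
    Measurable fun m : Measure Y => count m s :=
  Nat.measurable_floor.comp (Measure.measurable_coe hs).ennreal_toReal

theorem count_eq {m : Measure Y} {s : Set Y} (hm : ∃ n : ℕ∞, m s = n) (hs : m s ≠ ∞) :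
    ((count m s : ℕ) : ℝ) = (m s).toReal := by
  obtain ⟨n, hn⟩ := hm
  have : n ≠ ⊤ := by rintro rfl; exact hs (by simpa using hn)
  lift n to ℕ using this
  rw [count, hn]
  simp

/-- The exponential of the integral of a simple function against an integer-valued measure is a
finite product of powers of counts; the logarithm has disappeared. -/
theorem exp_integral_comp_simpleFunc {α : Type*} {m : Measure Y} (p : SimpleFunc Y α) {k : α → ℂ}
    (hm : ∀ B, MeasurableSet B → ∃ n : ℕ∞, m B = n) (hk : ∀ x, k x ≠ 0 → m (p ⁻¹' {x}) ≠ ∞) :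
    Complex.exp (∫ y, k (p y) ∂m) = ∏ x ∈ p.range, Complex.exp (k x) ^ count m (p ⁻¹' {x}) := by
  rw [(integrable_comp_simpleFunc p hk).2, Complex.exp_sum]
  refine Finset.prod_congr rfl fun x _ => ?_
  by_cases hx : k x = 0
  · simp [hx]
  · rw [← count_eq (hm _ (p.measurableSet_fiber x)) (hk x hx), ← Complex.exp_nat_mul]
    simp

variable {Ω : Type v} [MeasurableSpace Ω] {η : Ω → Measure Y} {lam : Measure Y} {Pr : Measure Ω}
  [IsProbabilityMeasure Pr]

namespace IsPoissonProcess

theorem measurable_eval (hη : IsPoissonProcess η lam Pr) {B : Set Y} (hB : MeasurableSet B) :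
    Measurable fun ω => η ω B := (Measure.measurable_coe hB).comp hη.measurable

theorem ae_ne_top (hη : IsPoissonProcess η lam Pr) {B : Set Y} (hB : MeasurableSet B)
    (hB' : lam B ≠ ∞) : ∀ᵐ ω ∂Pr, η ω B ≠ ∞ := by
  have h1 : Pr (⋃ k : ℕ, {ω | η ω B = k}) = 1 := by
    rw [measure_iUnion (f := fun k : ℕ => {ω | η ω B = k}) (fun i j hij =>
      Set.disjoint_left.2 fun ω h1 h2 => hij (by
        simp only [Set.mem_ofPred_eq] at h1 h2
        rw [h1] at h2
        exact_mod_cast h2)) fun k => hη.measurable_eval hB (measurableSet_singleton _)]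
    simp only [hη.law B hB hB']
    rw [← ENNReal.ofReal_tsum_of_nonneg (fun n => by positivity)]
    · have := (hasSum_one_poissonMeasure (lam B).toNNReal).tsum_eq
      rw [← ENNReal.ofReal_one, ← this]
      congr 2
      ext k
      rw [ENNReal.coe_toNNReal_eq_toReal]; ring
    · refine (hasSum_one_poissonMeasure (lam B).toNNReal).summable.congr fun k => ?_
      rw [ENNReal.coe_toNNReal_eq_toReal]; ring
  have h2 := (prob_compl_eq_zero_iff (μ := Pr) (MeasurableSet.iUnion fun k : ℕ =>
    hη.measurable_eval hB (measurableSet_singleton (k : ℝ≥0∞)))).2 h1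
  rw [ae_iff]
  refine measure_mono_null (fun ω hω => ?_) h2
  simp only [ne_eq, not_not, Set.mem_ofPred_eq] at hω
  simp [hω]

theorem map_count (hη : IsPoissonProcess η lam Pr) {B : Set Y} (hB : MeasurableSet B)
    (hB' : lam B ≠ ∞) :
    Pr.map (fun ω => count (η ω) B) = poissonMeasure (lam B).toNNReal := by
  have hmeas : Measurable fun ω => count (η ω) B := (measurable_count hB).comp hη.measurable
  refine Measure.ext_of_singleton fun k => ?_
  rw [Measure.map_apply hmeas (measurableSet_singleton k), poissonMeasure_singleton]
  have h1 : (fun ω => count (η ω) B) ⁻¹' {k} =ᵐ[Pr] {ω | η ω B = k} := by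
    filter_upwards [hη.ae_ne_top hB hB'] with ω hω
    apply propext
    have h2 := count_eq (hη.integerValued ω B hB) hω
    change count (η ω) B = k ↔ η ω B = k
    rw [← ENNReal.ofReal_toReal hω, ← h2]
    constructor
    · rintro rfl; simp
    · intro h; simpa using h
  rw [measure_congr h1, hη.law B hB hB']
  congr 1
  rw [ENNReal.coe_toNNReal_eq_toReal]; ring

/-- The probability generating function of the Poisson distribution. For `w = 1` the measure of `B`
may be infinite. -/
theorem integral_pow_count (hη : IsPoissonProcess η lam Pr) {B : Set Y} (hB : MeasurableSet B)
    {w : ℂ} (hw : w ≠ 1 → lam B ≠ ∞) :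
    ∫ ω, w ^ count (η ω) B ∂Pr = Complex.exp ((lam B).toReal * (w - 1)) := by
  by_cases h1 : w = 1
  · simp [h1]
  have hmeas : Measurable fun ω => count (η ω) B := (measurable_count hB).comp hη.measurable
  have h2 : ∫ ω, w ^ count (η ω) B ∂Pr = ∫ n, w ^ n ∂poissonMeasure (lam B).toNNReal := by
    rw [← hη.map_count hB (hw h1), integral_map hmeas.aemeasurable
      (measurable_of_countable _).aestronglyMeasurable]
  rw [h2, integral_poissonMeasure]
  set r : ℝ := (lam B).toReal with hr
  have h3 := (NormedSpace.expSeries_div_hasSum_exp ((r : ℂ) * w)).mul_left (Complex.exp (-r))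
  rw [← Complex.exp_eq_exp_ℂ, ← Complex.exp_add] at h3
  have h4 : Complex.exp (r * (w - 1)) = Complex.exp (-r + r * w) := by congr 1; ring
  rw [h4, ← h3.tsum_eq]
  refine tsum_congr fun n => ?_
  rw [ENNReal.coe_toNNReal_eq_toReal, ← hr, Complex.real_smul]
  push_cast
  ring

/-- The joint generating function of the counts of the fibres of a simple function, by
independence. -/
theorem integral_prod_pow_count (hη : IsPoissonProcess η lam Pr) {α : Type*} (p : SimpleFunc Y α)
    {w : α → ℂ} (hw : ∀ x, w x ≠ 1 → lam (p ⁻¹' {x}) ≠ ∞) :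
    ∫ ω, ∏ x ∈ p.range, w x ^ count (η ω) (p ⁻¹' {x}) ∂Pr =
      Complex.exp (∑ x ∈ p.range, (lam (p ⁻¹' {x})).toReal * (w x - 1)) := by
  let e := p.range.equivFin
  have h1 := hη.indep _ (fun i => p ⁻¹' {((e.symm i : p.range) : α)})
    (fun i => p.measurableSet_fiber _) fun i j hij => Set.disjoint_left.2 fun y h1 h2 => hij (by
      simp only [Set.mem_preimage, Set.mem_singleton_iff] at h1 h2
      exact e.symm.injective (Subtype.ext (h1.symm.trans h2)))
  have h2 := h1.precomp e.injective
  simp only [Equiv.symm_apply_apply] at h2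
  have h3 : Measurable fun t : ℝ≥0∞ => ⌊t.toReal⌋₊ :=
    Nat.measurable_floor.comp measurable_id.ennreal_toReal
  have h4 := h2.integral_fun_prod_comp (f := fun (x : p.range) (t : ℝ≥0∞) => w x ^ ⌊t.toReal⌋₊)
    (fun x => (hη.measurable_eval (p.measurableSet_fiber _)).aemeasurable) fun x =>
    ((measurable_of_countable fun n : ℕ => w x ^ n).comp h3).aestronglyMeasurable
  rw [Complex.exp_sum, ← Finset.prod_coe_sort p.range]
  have h5 : ∀ ω, ∏ x ∈ p.range, w x ^ count (η ω) (p ⁻¹' {x}) =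
      ∏ x : p.range, w x ^ ⌊(η ω (p ⁻¹' {(x : α)})).toReal⌋₊ := fun ω =>
    (Finset.prod_coe_sort p.range fun x => w x ^ count (η ω) (p ⁻¹' {x})).symm
  simp only [h5]
  rw [h4]
  exact Finset.prod_congr rfl fun x _ =>
    hη.integral_pow_count (p.measurableSet_fiber _) (hw x)

theorem integrable_prod_pow_count (hη : IsPoissonProcess η lam Pr) {α : Type*}
    (p : SimpleFunc Y α) {w : α → ℂ} (hw : ∀ x, w x ≠ 1 → lam (p ⁻¹' {x}) ≠ ∞) :
    Integrable (fun ω => ∏ x ∈ p.range, w x ^ count (η ω) (p ⁻¹' {x})) Pr := by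
  have hmeas : ∀ w : α → ℂ,
      Measurable fun ω => ∏ x ∈ p.range, w x ^ count (η ω) (p ⁻¹' {x}) := fun w =>
    Finset.measurable_prod _ fun x _ => (measurable_of_countable fun n : ℕ => w x ^ n).comp
      ((measurable_count (p.measurableSet_fiber x)).comp hη.measurable)
  -- the product of the absolute values has a non-zero integral, hence is integrable
  have h1 : Integrable
      (fun ω => ∏ x ∈ p.range, ((‖w x‖ : ℝ) : ℂ) ^ count (η ω) (p ⁻¹' {x})) Pr := by
    by_contra h
    have h2 := hη.integral_prod_pow_count p (w := fun x => ((‖w x‖ : ℝ) : ℂ)) fun x hx =>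
      hw x fun h => hx (by simp [h])
    rw [integral_undef h] at h2
    exact Complex.exp_ne_zero _ h2.symm
  refine h1.mono (hmeas w).aestronglyMeasurable (ae_of_all _ fun ω => le_of_eq ?_)
  simp [norm_prod]

theorem ae_exp_integral (hη : IsPoissonProcess η lam Pr) {α : Type*} (p : SimpleFunc Y α)
    {k : α → ℂ} (hk : ∀ x, k x ≠ 0 → lam (p ⁻¹' {x}) ≠ ∞) :
    ∀ᵐ ω ∂Pr, Integrable (fun y => k (p y)) (η ω) ∧ Complex.exp (∫ y, k (p y) ∂(η ω)) =
      ∏ x ∈ p.range, Complex.exp (k x) ^ count (η ω) (p ⁻¹' {x}) := by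
  have h1 : ∀ x ∈ p.range, ∀ᵐ ω ∂Pr, k x ≠ 0 → η ω (p ⁻¹' {x}) ≠ ∞ := fun x _ => by
    by_cases hx : k x = 0
    · simp [hx]
    · filter_upwards [hη.ae_ne_top (p.measurableSet_fiber x) (hk x hx)] with ω hω _ using hω
  filter_upwards [(ae_ball_iff p.range.countable_toSet).2 h1] with ω hω
  have h2 : ∀ x, k x ≠ 0 → η ω (p ⁻¹' {x}) ≠ ∞ := fun x hx => by
    by_cases hr : x ∈ p.range
    · exact hω x hr hx
    · rw [(SimpleFunc.preimage_eq_empty_iff p x).2 (by simpa using hr)]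
      simp
  exact ⟨(integrable_comp_simpleFunc p h2).1,
    exp_integral_comp_simpleFunc p (hη.integerValued ω) h2⟩

/-- The Laplace functional of a Poisson process. -/
theorem integrable_exp_integral (hη : IsPoissonProcess η lam Pr) {α : Type*} (p : SimpleFunc Y α)
    {k : α → ℂ} (hk : ∀ x, k x ≠ 0 → lam (p ⁻¹' {x}) ≠ ∞) :
    Integrable (fun ω => Complex.exp (∫ y, k (p y) ∂(η ω))) Pr ∧
    ∫ ω, Complex.exp (∫ y, k (p y) ∂(η ω)) ∂Pr =
      Complex.exp (∫ y, (Complex.exp (k (p y)) - 1) ∂lam) := by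
  have h0 : ∀ x, Complex.exp (k x) ≠ 1 → lam (p ⁻¹' {x}) ≠ ∞ := fun x hx =>
    hk x fun h => hx (by rw [h, Complex.exp_zero])
  have h1 : (fun ω => Complex.exp (∫ y, k (p y) ∂(η ω))) =ᵐ[Pr]
      fun ω => ∏ x ∈ p.range, Complex.exp (k x) ^ count (η ω) (p ⁻¹' {x}) := by
    filter_upwards [hη.ae_exp_integral p hk] with ω hω using hω.2
  refine ⟨(hη.integrable_prod_pow_count p h0).congr h1.symm, ?_⟩
  rw [integral_congr_ae h1, hη.integral_prod_pow_count p h0,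
    (integrable_comp_simpleFunc p (k := fun x => Complex.exp (k x) - 1)
      fun x hx => h0 x (sub_ne_zero.1 hx)).2]

end IsPoissonProcess

end PoissonExponentials

/-! ### Normalized exponentials of simple functions -/

section NormalizedExponentials

variable {Y : Type u} [MeasurableSpace Y] {lam : Measure Y} {X : Set Y}

namespace SimpleTest

theorem measure_fiber_ne_top (φ : SimpleTest lam X) {z : ℂ} (hz : z ≠ 0) :
    lam (φ.toFun ⁻¹' {z}) ≠ ∞ :=
  ((SimpleFunc.memLp_iff (by norm_num) (by norm_num)).1 φ.memLp z hz).ne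

theorem integrable (φ : SimpleTest lam X) : Integrable φ.toFun lam :=
  (integrable_comp_simpleFunc φ.toFun (k := fun z => z) fun _ hz => φ.measure_fiber_ne_top hz).1

theorem integrable_conj_mul (φ ψ : SimpleTest lam X) :
    Integrable (fun y => conj (φ.toFun y) * ψ.toFun y) lam := by
  have h := MemLp.integrable_mul (p := 2) (q := 2) φ.memLp.star ψ.memLp
  exact h

theorem measure_pair_ne_top (φ ψ : SimpleTest lam X) {z : ℂ × ℂ} (hz : z ≠ 0) :
    lam (φ.toFun.pair ψ.toFun ⁻¹' {z}) ≠ ∞ := by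
  by_cases h : z.1 = 0
  · have h2 : z.2 ≠ 0 := fun h2 => hz (Prod.ext h h2)
    exact ne_top_of_le_ne_top (ψ.measure_fiber_ne_top h2)
      (measure_mono fun y hy => congrArg Prod.snd hy)
  · exact ne_top_of_le_ne_top (φ.measure_fiber_ne_top h)
      (measure_mono fun y hy => congrArg Prod.fst hy)

theorem inner_toL2 (φ ψ : SimpleTest lam X) :
    inner ℂ φ.toL2 ψ.toL2 = ∫ y, conj (φ.toFun y) * ψ.toFun y ∂lam := by
  rw [L2.inner_def, ← setIntegral_eq_integral_of_forall_compl_eq_zero (s := X) (μ := lam)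
    (f := fun y => conj (φ.toFun y) * ψ.toFun y)]
  · refine integral_congr_ae ?_
    filter_upwards [MemLp.coeFn_toLp (φ.memLp.restrict X), MemLp.coeFn_toLp (ψ.memLp.restrict X)]
      with y h1 h2
    rw [toL2, toL2, h1, h2, RCLike.inner_apply, mul_comm]
  · intro y hy
    rw [φ.eq_zero y hy, map_zero, zero_mul]

end SimpleTest

theorem dist_toLp_le {α : Type*} [MeasurableSpace α] {μ : Measure α} {f g h : α → ℂ}
    (hf : MemLp f 2 μ) (hg : MemLp g 2 μ) (hh : MemLp h 2 μ) {c : ℝ}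
    (hle : ∀ᵐ y ∂μ, ‖f y - g y‖ ≤ c * ‖h y‖) : dist (hf.toLp f) (hg.toLp g) ≤ c * ‖hh.toLp h‖ := by
  rw [dist_eq_norm, ← MemLp.toLp_sub]
  refine Lp.norm_le_mul_norm_of_ae_le_mul ?_
  filter_upwards [MemLp.coeFn_toLp (hf.sub hg), MemLp.coeFn_toLp hh, hle] with y h1 h2 h3
  rw [h1, h2]
  exact h3

theorem SimpleTest.denseRange_toL2 (hX : MeasurableSet X) :
    DenseRange (SimpleTest.toL2 (lam := lam) (X := X)) := by
  intro f
  rw [Metric.mem_closure_iff]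
  intro ε hε
  obtain ⟨g, hg1, hg2⟩ := (Lp.memLp f).exists_simpleFunc_eLpNorm_sub_lt (by norm_num)
    (ε := ENNReal.ofReal (ε / 2)) (by simpa using hε)
  -- values `-1` are moved by `δ`
  set δ : ℝ := ε / 2 / (‖hg2.toLp g‖ + 1) with hδ
  have hδ0 : 0 < δ := by positivity
  let w : ℂ → ℂ := fun z => if z = -1 then -1 + δ else z
  have hw : ∀ z, ‖z - w z‖ ≤ δ * ‖z‖ := fun z => by
    by_cases hz : z = -1
    · simp [w, hz, abs_of_pos hδ0]
    · simp only [w, hz, if_false, sub_self, norm_zero]; positivity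
  have hw1 : ∀ z, w z ≠ -1 := fun z => by
    by_cases hz : z = -1
    · simp [w, hz, hδ0.ne']
    · simp [w, hz]
  have hwm : Measurable w :=
    Measurable.ite (measurableSet_singleton _) measurable_const measurable_id
  have hg3 : MemLp (g.map w) 2 (lam.restrict X) := by
    have h1 : MemLp (fun y => g y - g.map w y) 2 (lam.restrict X) :=
      hg2.of_le_mul (c := δ) (g.measurable.sub (g.map w).measurable).aestronglyMeasurable
        (ae_of_all _ fun y => hw _)
    convert hg2.sub h1 using 1
    ext y; simp
  let p : SimpleFunc Y ℂ := SimpleFunc.piecewise X hX (g.map w) 0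
  have hp : ⇑p = X.indicator (g.map w) := by
    funext y
    by_cases hy : y ∈ X <;> simp [p, hy]
  let φ : SimpleTest lam X :=
    { toFun := p
      eq_zero := fun y hy => by rw [hp, Set.indicator_of_notMem hy]
      memLp := by rw [hp]; exact (memLp_indicator_iff_restrict hX).2 hg3
      ne_neg_one := fun y => by
        rw [hp]
        by_cases hy : y ∈ X
        · rw [Set.indicator_of_mem hy]; exact hw1 _
        · rw [Set.indicator_of_notMem hy]; norm_num }
  refine ⟨φ.toL2, ⟨φ, rfl⟩, ?_⟩
  have h1 : dist (hg2.toLp g) φ.toL2 ≤ δ * ‖hg2.toLp g‖ := by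
    refine dist_toLp_le _ _ _ ?_
    filter_upwards [ae_restrict_mem hX] with y hy
    change ‖g y - p y‖ ≤ _
    rw [hp, Set.indicator_of_mem hy]
    exact hw _
  have h2 : dist f (hg2.toLp g) < ε / 2 := by
    have h3 := Lp.toLp_coeFn f (Lp.memLp f)
    rw [← h3, dist_eq_norm, ← MemLp.toLp_sub, Lp.norm_toLp]
    exact (ENNReal.toReal_lt_of_lt_ofReal hg1)
  have h4 : δ * ‖hg2.toLp g‖ ≤ ε / 2 := by
    rw [hδ, div_mul_eq_mul_div, div_le_iff₀ (by positivity)]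
    nlinarith [norm_nonneg (hg2.toLp g)]
  calc dist f φ.toL2 ≤ _ := dist_triangle _ (hg2.toLp g) _
    _ < ε / 2 + ε / 2 := add_lt_add_of_lt_of_le h2 (h1.trans h4)
    _ = ε := add_halves ε

variable {Ω : Type v} [MeasurableSpace Ω] {Pr : Measure Ω} [IsProbabilityMeasure Pr]
  {η : Ω → Measure Y} {ℓ : ℂ → ℂ}

namespace SimpleTest

variable (hη : IsPoissonProcess η lam Pr) (hℓ : ∀ z, z ≠ 0 → Complex.exp (ℓ z) = z)
  (hℓ1 : ℓ 1 = 0)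

include hℓ in
theorem exp_logOne (φ : SimpleTest lam X) (y : Y) :
    Complex.exp (φ.logOne ℓ y) = 1 + φ.toFun y :=
  hℓ _ fun h => φ.ne_neg_one y (by linear_combination h)

include hη hℓ1

theorem ae_integrable_logOne (φ : SimpleTest lam X) :
    ∀ᵐ ω ∂Pr, Integrable (φ.logOne ℓ) (η ω) := by
  filter_upwards [hη.ae_exp_integral φ.toFun (k := fun z => ℓ (1 + z)) fun z hz =>
    φ.measure_fiber_ne_top fun h => hz (by rw [h, add_zero, hℓ1])] with ω hω using hω.1

include hℓ

theorem integral_expFun (φ : SimpleTest lam X) : Integrable (φ.expFun ℓ η) Pr ∧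
    ∫ ω, φ.expFun ℓ η ω ∂Pr = Complex.exp (∫ y, φ.toFun y ∂lam) := by
  obtain ⟨h1, h2⟩ := hη.integrable_exp_integral φ.toFun (k := fun z => ℓ (1 + z)) fun z hz =>
    φ.measure_fiber_ne_top fun h => hz (by rw [h, add_zero, hℓ1])
  refine ⟨h1, h2.trans ?_⟩
  congr 1
  refine integral_congr_ae (ae_of_all _ fun y => ?_)
  change Complex.exp (φ.logOne ℓ y) - 1 = _
  rw [φ.exp_logOne hℓ, add_sub_cancel_left]

/-- `E(conj e^{η(u_φ)} · e^{η(u_ψ)})` is again the expectation of an exponential, that of the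
functional with `(1 + conj φ)(1 + ψ) - 1 = conj φ + ψ + conj φ · ψ`. -/
theorem integral_conj_expFun_mul (φ ψ : SimpleTest lam X) :
    Integrable (fun ω => conj (φ.expFun ℓ η ω) * ψ.expFun ℓ η ω) Pr ∧
    ∫ ω, conj (φ.expFun ℓ η ω) * ψ.expFun ℓ η ω ∂Pr =
      conj (Complex.exp (∫ y, φ.toFun y ∂lam)) * Complex.exp (∫ y, ψ.toFun y ∂lam) *
        Complex.exp (inner ℂ φ.toL2 ψ.toL2) := by
  obtain ⟨h1, h2⟩ := hη.integrable_exp_integral (φ.toFun.pair ψ.toFun)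
    (k := fun z => conj (ℓ (1 + z.1)) + ℓ (1 + z.2)) fun z hz =>
    φ.measure_pair_ne_top ψ fun h => hz (by simp [h, hℓ1])
  have h3 : (fun ω => conj (φ.expFun ℓ η ω) * ψ.expFun ℓ η ω) =ᵐ[Pr] fun ω => Complex.exp
      (∫ y, (conj (ℓ (1 + (φ.toFun.pair ψ.toFun y).1)) + ℓ (1 + (φ.toFun.pair ψ.toFun y).2))
        ∂(η ω)) := by
    filter_upwards [φ.ae_integrable_logOne hη hℓ1, ψ.ae_integrable_logOne hη hℓ1] with ω i1 i2
    rw [expFun, expFun, ← Complex.exp_conj, ← integral_conj, ← Complex.exp_add, ← integral_add _ i2]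
    · rfl
    · exact (RCLike.conjCLE (K := ℂ)).toContinuousLinearMap.integrable_comp i1
  refine ⟨h1.congr h3.symm, ?_⟩
  rw [integral_congr_ae h3, h2, inner_toL2, ← Complex.exp_conj, ← Complex.exp_add,
    ← Complex.exp_add, ← integral_conj]
  have i1 : Integrable (fun y => conj (φ.toFun y)) lam :=
    (RCLike.conjCLE (K := ℂ)).toContinuousLinearMap.integrable_comp φ.integrable
  rw [← integral_add i1 ψ.integrable, ← integral_add (f := fun y => conj (φ.toFun y) + ψ.toFun y)
    (i1.add ψ.integrable) (φ.integrable_conj_mul ψ)]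
  congr 1
  refine integral_congr_ae (ae_of_all _ fun y => ?_)
  change Complex.exp (conj (φ.logOne ℓ y) + ψ.logOne ℓ y) - 1 = _
  rw [Complex.exp_add, Complex.exp_conj, φ.exp_logOne hℓ, ψ.exp_logOne hℓ, map_add, map_one]
  ring

theorem memLp_expFun (φ : SimpleTest lam X) : MemLp (φ.expFun ℓ η) 2 Pr := by
  rw [memLp_two_iff_integrable_sq_norm (φ.integral_expFun hη hℓ hℓ1).1.aestronglyMeasurable]
  have h := (φ.integral_conj_expFun_mul hη hℓ hℓ1 φ).1.norm
  refine h.congr (ae_of_all _ fun ω => ?_)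
  simp [sq]

theorem memLp_normExpFun (φ : SimpleTest lam X) : MemLp (φ.normExpFun ℓ η Pr) 2 Pr := by
  have := (φ.memLp_expFun hη hℓ hℓ1).const_mul (∫ ω', φ.expFun ℓ η ω' ∂Pr)⁻¹
  refine this.ae_eq (ae_of_all _ fun ω => ?_)
  simp only [normExpFun]
  ring

theorem normExp_eq (φ : SimpleTest lam X) :
    φ.normExp ℓ η Pr = (φ.memLp_normExpFun hη hℓ hℓ1).toLp _ :=
  dif_pos (φ.memLp_normExpFun hη hℓ hℓ1)

theorem coeFn_normExp (φ : SimpleTest lam X) :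
    φ.normExp ℓ η Pr =ᵐ[Pr] fun ω =>
      Complex.exp (-∫ y, φ.toFun y ∂lam) * φ.expFun ℓ η ω := by
  rw [φ.normExp_eq hη hℓ hℓ1]
  filter_upwards [MemLp.coeFn_toLp (φ.memLp_normExpFun hη hℓ hℓ1)] with ω hω
  rw [hω, normExpFun, (φ.integral_expFun hη hℓ hℓ1).2, Complex.exp_neg]
  ring

/-- The normalized exponentials have the Gram matrix of the exponential vectors. -/
theorem inner_normExp (φ ψ : SimpleTest lam X) :
    inner ℂ (φ.normExp ℓ η Pr) (ψ.normExp ℓ η Pr) =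
      inner ℂ (expVec φ.toL2) (expVec ψ.toL2) := by
  have h1 : inner ℂ (φ.normExp ℓ η Pr) (ψ.normExp ℓ η Pr) =
      ∫ ω, (conj (Complex.exp (-∫ y, φ.toFun y ∂lam)) * Complex.exp (-∫ y, ψ.toFun y ∂lam)) *
        (conj (φ.expFun ℓ η ω) * ψ.expFun ℓ η ω) ∂Pr := by
    rw [L2.inner_def]
    refine integral_congr_ae ?_
    filter_upwards [φ.coeFn_normExp hη hℓ hℓ1, ψ.coeFn_normExp hη hℓ hℓ1] with ω e1 e2
    rw [e1, e2, RCLike.inner_apply, map_mul]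
    ring
  rw [h1, integral_const_mul, (φ.integral_conj_expFun_mul hη hℓ hℓ1 ψ).2, inner_expVec,
    ← Complex.exp_conj, ← Complex.exp_conj, map_neg]
  simp only [← Complex.exp_add]
  congr 1
  ring

/-- If `φ` and `ψ` have disjoint supports, then `Σ_{φ + ψ} = Σ_φ Σ_ψ`. -/
theorem coeFn_normExp_add (φ ψ χ : SimpleTest lam X) (hχ : ∀ y, χ.toFun y = φ.toFun y + ψ.toFun y)
    (h : ∀ y, φ.toFun y = 0 ∨ ψ.toFun y = 0) :
    χ.normExp ℓ η Pr =ᵐ[Pr] fun ω => φ.normExp ℓ η Pr ω * ψ.normExp ℓ η Pr ω := by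
  filter_upwards [φ.coeFn_normExp hη hℓ hℓ1, ψ.coeFn_normExp hη hℓ hℓ1,
    χ.coeFn_normExp hη hℓ hℓ1, φ.ae_integrable_logOne hη hℓ1, ψ.ae_integrable_logOne hη hℓ1]
    with ω e1 e2 e3 i1 i2
  have h1 : χ.logOne ℓ = φ.logOne ℓ + ψ.logOne ℓ := by
    funext y
    rcases h y with h | h <;> simp [logOne, hχ, h, hℓ1]
  have h2 : ∫ y, χ.toFun y ∂lam = ∫ y, φ.toFun y ∂lam + ∫ y, ψ.toFun y ∂lam := by
    rw [← integral_add φ.integrable ψ.integrable]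
    exact integral_congr_ae (ae_of_all _ hχ)
  rw [e1, e2, e3, h2, expFun, h1, expFun, expFun]
  simp only [Pi.add_apply]
  rw [integral_add i1 i2, neg_add, Complex.exp_add, Complex.exp_add]
  ring

end SimpleTest

/-- The unitary extension of `e(φ) ↦ Σ_φ` to the Fock space. -/
theorem exists_expIsometry (hη : IsPoissonProcess η lam Pr)
    (hℓ : ∀ z, z ≠ 0 → Complex.exp (ℓ z) = z) (hℓ1 : ℓ 1 = 0) (hX : MeasurableSet X) :
    ∃ J : Fock (Lp ℂ 2 (lam.restrict X)) →ₗᵢ[ℂ] Lp ℂ 2 Pr,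
      ∀ φ : SimpleTest lam X, J (expVec φ.toL2) = φ.normExp ℓ η Pr :=
  ((isTotal_expVec (H := Lp ℂ 2 (lam.restrict X))).comp_denseRange continuous_expVec
    (SimpleTest.denseRange_toL2 hX)).exists_isometry fun φ ψ => φ.inner_normExp hη hℓ hℓ1 ψ

section

variable {J : Fock (Lp ℂ 2 (lam.restrict X)) →ₗᵢ[ℂ] Lp ℂ 2 Pr}
  (hJ : ∀ φ : SimpleTest lam X, J (expVec φ.toL2) = φ.normExp ℓ η Pr)
include hJ

theorem tendsto_normExp_comap (f : Lp ℂ 2 (lam.restrict X)) :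
    Tendsto (SimpleTest.normExp (lam := lam) (X := X) ℓ η Pr)
      (Filter.comap (SimpleTest.toL2 (lam := lam) (X := X)) (𝓝 f)) (𝓝 (J (expVec f))) := by
  have h1 : SimpleTest.normExp (lam := lam) (X := X) ℓ η Pr =
      (fun g => J (expVec g)) ∘ SimpleTest.toL2 := funext fun φ => (hJ φ).symm
  rw [h1]
  exact ((J.continuous.comp continuous_expVec).tendsto f).comp tendsto_comap

theorem normExp_eq_expIsometry (hX : MeasurableSet X) (f : Lp ℂ 2 (lam.restrict X)) :
    normExp ℓ η Pr f = J (expVec f) := by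
  have : (Filter.comap (SimpleTest.toL2 (lam := lam) (X := X)) (𝓝 f)).NeBot :=
    comap_neBot_iff_frequently.2
      (mem_closure_iff_frequently.1 (SimpleTest.denseRange_toL2 hX f))
  exact (tendsto_normExp_comap hJ f).limUnder_eq

end

theorem normExpWellDefined (hη : IsPoissonProcess η lam Pr)
    (hℓ : ∀ z, z ≠ 0 → Complex.exp (ℓ z) = z) (hℓ1 : ℓ 1 = 0) (hX : MeasurableSet X) :
    NormExpWellDefined lam X ℓ η Pr where
  memLp φ := φ.memLp_expFun hη hℓ hℓ1
  expectation_ne_zero φ := by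
    rw [(φ.integral_expFun hη hℓ hℓ1).2]; exact Complex.exp_ne_zero _
  dense := SimpleTest.denseRange_toL2 hX
  tendsto f := by
    obtain ⟨J, hJ⟩ := exists_expIsometry hη hℓ hℓ1 hX
    rw [normExp_eq_expIsometry hJ hX]
    exact tendsto_normExp_comap hJ f

end NormalizedExponentials

/-! ### Uniqueness of the law of a random measure -/

section Uniqueness

variable {Y : Type u} [MeasurableSpace Y] (lam : Measure Y)

theorem measurableSpace_measure_eq_iSup [SigmaFinite lam] :
    (Measure.instMeasurableSpace : MeasurableSpace (Measure Y)) =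
      ⨆ B ∈ {B : Set Y | MeasurableSet B ∧ lam B ≠ ∞},
        MeasurableSpace.comap (fun m : Measure Y => m B) inferInstance := by
  refine le_antisymm (iSup₂_le fun B hB => ?_) (iSup₂_le fun B hB => le_iSup₂
    (f := fun (s : Set Y) (_ : MeasurableSet s) =>
      MeasurableSpace.comap (fun m : Measure Y => m s) (borel ℝ≥0∞)) B hB.1)
  have h1 : (fun m : Measure Y => m B) = fun m => ⨆ n, m (B ∩ spanningSets lam n) := by
    funext m
    rw [← Monotone.measure_iUnion, ← Set.inter_iUnion, iUnion_spanningSets, Set.inter_univ]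
    exact fun i j hij => Set.inter_subset_inter_right _ (monotone_spanningSets lam hij)
  refine Measurable.comap_le ?_
  rw [h1]
  refine Measurable.iSup fun n => ?_
  have h2 : B ∩ spanningSets lam n ∈ {B : Set Y | MeasurableSet B ∧ lam B ≠ ∞} :=
    ⟨hB.inter (measurableSet_spanningSets lam n), ne_top_of_le_ne_top
      (measure_spanningSets_lt_top lam n).ne (measure_mono Set.inter_subset_right)⟩
  exact (comap_measurable _).mono (le_iSup₂ (f := fun (s : Set Y)
    (_ : s ∈ {B : Set Y | MeasurableSet B ∧ lam B ≠ ∞}) =>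
      MeasurableSpace.comap (fun m : Measure Y => m s) inferInstance) _ h2) le_rfl

/-- A finite law on the space of measures is determined by the characteristic functions of the
finite families `(m(B))_B`, where the `B` have finite measure. -/
theorem measure_ext_of_characteristic [SigmaFinite lam] {μ ν : Measure (Measure Y)}
    [IsFiniteMeasure μ] [IsFiniteMeasure ν]
    (hμ : ∀ B, MeasurableSet B → lam B ≠ ∞ → ∀ᵐ m ∂μ, m B ≠ ∞)
    (hν : ∀ B, MeasurableSet B → lam B ≠ ∞ → ∀ᵐ m ∂ν, m B ≠ ∞)
    (h : ∀ (t : Finset (Set Y)) (c : Set Y → ℝ), (∀ B ∈ t, MeasurableSet B ∧ lam B ≠ ∞) →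
      ∫ m, Complex.exp ((∑ B ∈ t, c B * (m B).toReal : ℝ) * Complex.I) ∂μ =
      ∫ m, Complex.exp ((∑ B ∈ t, c B * (m B).toReal : ℝ) * Complex.I) ∂ν) : μ = ν := by
  classical
  -- the laws of finite families agree
  have key : ∀ t : Finset (Set Y), (∀ B ∈ t, MeasurableSet B ∧ lam B ≠ ∞) →
      μ.map (fun m (B : t) => (m B).toReal) = ν.map (fun m (B : t) => (m B).toReal) := by
    intro t ht
    have hm : Measurable fun (m : Measure Y) (B : t) => (m B).toReal :=
      measurable_pi_lambda _ fun B => (Measure.measurable_coe (ht B B.2).1).ennreal_toReal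
    refine Measure.ext_of_charFunDual ?_
    funext L
    have hL : ∀ x : t → ℝ, L x = ∑ B : t, L (Pi.single B 1) * x B := fun x => by
      conv_lhs => rw [← Finset.univ_sum_single x]
      rw [map_sum]
      refine Finset.sum_congr rfl fun B _ => ?_
      have : (Pi.single B (x B) : t → ℝ) = x B • Pi.single B 1 := by
        rw [← Pi.single_smul]; simp
      rw [this, map_smul, smul_eq_mul, mul_comm]
    have hLm : Continuous fun x : t → ℝ => Complex.exp (L x * Complex.I) := by fun_prop
    rw [charFunDual_apply, charFunDual_apply,
      integral_map hm.aemeasurable hLm.aestronglyMeasurable,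
      integral_map hm.aemeasurable hLm.aestronglyMeasurable]
    have h1 := h t (fun B => if hB : B ∈ t then L (Pi.single ⟨B, hB⟩ 1) else 0) ht
    have h2 : ∀ m : Measure Y, L (fun B : t => (m B).toReal) = ∑ B ∈ t,
        (if hB : B ∈ t then L (Pi.single ⟨B, hB⟩ 1) else 0) * (m B).toReal := fun m => by
      rw [hL, ← Finset.sum_coe_sort t]
      exact Finset.sum_congr rfl fun B _ => by rw [dif_pos B.2]
    simp only [h2]
    exact h1
  have hcyl : ∀ (κ : Measure (Measure Y)),
      (∀ B, MeasurableSet B → lam B ≠ ∞ → ∀ᵐ m ∂κ, m B ≠ ∞) →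
      ∀ (t : Finset (Set Y)) (C : Set Y → Set ℝ≥0∞),
      (∀ B ∈ t, MeasurableSet B ∧ lam B ≠ ∞) → (∀ B ∈ t, MeasurableSet (C B)) →
      κ (⋂ B ∈ t, (fun m : Measure Y => m B) ⁻¹' C B) =
        κ.map (fun m (B : t) => (m B).toReal)
          (Set.univ.pi fun B : t => ENNReal.ofReal ⁻¹' C B) := by
    intro κ hκ t C ht hC
    have hm : Measurable fun (m : Measure Y) (B : t) => (m B).toReal :=
      measurable_pi_lambda _ fun B => (Measure.measurable_coe (ht B B.2).1).ennreal_toReal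
    rw [Measure.map_apply hm (MeasurableSet.univ_pi fun B =>
      ENNReal.measurable_ofReal (hC B B.2))]
    refine measure_congr ?_
    filter_upwards [(ae_ball_iff t.countable_toSet).2 fun B hB => hκ B (ht B hB).1 (ht B hB).2]
      with m hm'
    apply propext
    change m ∈ (⋂ B ∈ t, (fun m : Measure Y => m B) ⁻¹' C B) ↔
      m ∈ (fun (m : Measure Y) (B : t) => (m B).toReal) ⁻¹'
        (Set.univ.pi fun B : t => ENNReal.ofReal ⁻¹' C B)
    simp only [Set.mem_iInter, Set.mem_preimage, Set.mem_univ_pi, Subtype.forall]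
    exact forall₂_congr fun B hB => by rw [ENNReal.ofReal_toReal (hm' B hB)]
  refine ext_of_generate_finite _ ((measurableSpace_measure_eq_iSup lam).trans
    (generateFrom_piiUnionInter_measurableSet
      (fun B : Set Y => MeasurableSpace.comap (fun m : Measure Y => m B) inferInstance) _).symm)
    (isPiSystem_piiUnionInter _ (fun B => @MeasurableSpace.isPiSystem_measurableSet _
      (MeasurableSpace.comap (fun m : Measure Y => m B) inferInstance)) _) ?_ ?_
  · rintro s ⟨t, ht, f, hf, rfl⟩
    choose! C hC using hf
    have h1 : ⋂ B ∈ t, f B = ⋂ B ∈ t, (fun m : Measure Y => m B) ⁻¹' C B :=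
      Set.iInter₂_congr fun B hB => (hC B hB).2.symm
    rw [h1, hcyl μ hμ t C ht fun B hB => (hC B hB).1, hcyl ν hν t C ht fun B hB => (hC B hB).1,
      key t ht]
  · have := hcyl μ hμ ∅ (fun _ => Set.univ) (by simp) (by simp)
    have h2 := hcyl ν hν ∅ (fun _ => Set.univ) (by simp) (by simp)
    rw [key ∅ (by simp)] at this
    simpa using this.trans h2.symm

end Uniqueness

section Characteristic

variable {Y : Type u} [MeasurableSpace Y] {lam : Measure Y} {D : Set Y}

theorem exists_simpleFunc_sum_indicator {ι : Type*} (t : Finset ι) (c : ι → ℝ) (s : ι → Set Y)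
    (hs : ∀ i ∈ t, MeasurableSet (s i)) :
    ∃ p : SimpleFunc Y ℝ, ∀ y, p y = ∑ i ∈ t, (s i).indicator (fun _ => c i) y := by
  classical
  induction t using Finset.induction_on with
  | empty => exact ⟨0, fun y => by simp⟩
  | insert i t hi ih =>
    obtain ⟨p, hp⟩ := ih fun j hj => hs j (Finset.mem_insert_of_mem hj)
    refine ⟨SimpleFunc.piecewise (s i) (hs i (Finset.mem_insert_self _ _))
      (SimpleFunc.const Y (c i)) 0 + p, fun y => ?_⟩
    rw [Finset.sum_insert hi, SimpleFunc.coe_add, Pi.add_apply, hp]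
    congr 1

variable {ι : Type*} {t : Finset ι} {c : ι → ℝ} {s : ι → Set Y}
  {p : SimpleFunc Y ℝ}

theorem measure_preimage_ne_top_of_sum_indicator (hs' : ∀ i ∈ t, lam (s i) ≠ ∞)
    (hp : ∀ y, p y = ∑ i ∈ t, (s i).indicator (fun _ => c i) y) {x : ℝ} (hx : x ≠ 0) :
    lam (p ⁻¹' {x}) ≠ ∞ := by
  have h1 : p ⁻¹' {x} ⊆ ⋃ i ∈ t, s i := by
    intro y hy
    by_contra h
    simp only [Set.mem_iUnion, not_exists] at h
    refine hx ?_
    rw [← (show p y = x from hy), hp]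
    exact Finset.sum_eq_zero fun i hi => Set.indicator_of_notMem (h i hi) _
  refine ne_top_of_le_ne_top ?_ ((measure_mono h1).trans (measure_biUnion_finset_le _ _))
  exact (ENNReal.sum_lt_top.2 fun i hi => (hs' i hi).lt_top).ne

theorem integral_sum_indicator {m : Measure Y} (hs : ∀ i ∈ t, MeasurableSet (s i))
    (hm : ∀ i ∈ t, m (s i) ≠ ∞)
    (hp : ∀ y, p y = ∑ i ∈ t, (s i).indicator (fun _ => c i) y) :
    ∫ y, (p y : ℂ) * Complex.I ∂m = (∑ i ∈ t, c i * (m (s i)).toReal : ℝ) * Complex.I := by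
  rw [integral_mul_const]
  congr 1
  rw [integral_complex_ofReal]
  congr 1
  simp only [hp]
  rw [integral_finsetSum _ fun i hi => (integrable_indicator_iff (hs i hi)).2
    (integrableOn_const (hm i hi))]
  refine Finset.sum_congr rfl fun i hi => ?_
  rw [integral_indicator_const _ (hs i hi), smul_eq_mul, mul_comm]
  rfl

variable {Ω : Type v} [MeasurableSpace Ω] {η : Ω → Measure Y} {Pr : Measure Ω}
  [IsProbabilityMeasure Pr]

theorem IsPoissonProcess.ae_exp_sum (hη : IsPoissonProcess η lam Pr)
    (hs : ∀ i ∈ t, MeasurableSet (s i)) (hs' : ∀ i ∈ t, lam (s i) ≠ ∞)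
    (hp : ∀ y, p y = ∑ i ∈ t, (s i).indicator (fun _ => c i) y) :
    ∀ᵐ ω ∂Pr, Complex.exp ((∑ i ∈ t, c i * (η ω (s i)).toReal : ℝ) * Complex.I) =
      Complex.exp (∫ y, (p y : ℂ) * Complex.I ∂(η ω)) := by
  filter_upwards [(ae_ball_iff t.countable_toSet).2
    fun i hi => hη.ae_ne_top (hs i hi) (hs' i hi)] with ω hω
  rw [integral_sum_indicator hs hω hp]

/-- The characteristic function of a finite family of counts. -/
theorem IsPoissonProcess.integral_exp_sum (hη : IsPoissonProcess η lam Pr)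
    (hs : ∀ i ∈ t, MeasurableSet (s i)) (hs' : ∀ i ∈ t, lam (s i) ≠ ∞)
    (hp : ∀ y, p y = ∑ i ∈ t, (s i).indicator (fun _ => c i) y) :
    ∫ ω, Complex.exp ((∑ i ∈ t, c i * (η ω (s i)).toReal : ℝ) * Complex.I) ∂Pr =
      Complex.exp (∫ y, (Complex.exp ((p y : ℂ) * Complex.I) - 1) ∂lam) := by
  rw [integral_congr_ae (hη.ae_exp_sum hs hs' hp)]
  exact (hη.integrable_exp_integral p (k := fun x : ℝ => (x : ℂ) * Complex.I) fun x hx =>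
    measure_preimage_ne_top_of_sum_indicator hs' hp fun h => hx (by simp [h])).2

/-- The characters `exp (i ∑ cᵢ η(sᵢ))` are multiples of normalized exponentials: they belong to
`φ = exp (i h) - 1` with `h = ∑ cᵢ 1_{sᵢ}`. -/
theorem IsPoissonProcess.exists_expFun_eq_exp_sum (hη : IsPoissonProcess η lam Pr) {ℓ : ℂ → ℂ}
    (hℓ : ∀ z, z ≠ 0 → Complex.exp (ℓ z) = z) (hℓ1 : ℓ 1 = 0) (t : Finset ι) (c : ι → ℝ)
    (s : ι → Set Y) (hs : ∀ i ∈ t, MeasurableSet (s i)) (hs' : ∀ i ∈ t, lam (s i) ≠ ∞)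
    (hsD : ∀ i ∈ t, s i ⊆ D) :
    ∃ φ : SimpleTest lam D, φ.expFun ℓ η =ᵐ[Pr] fun ω =>
      Complex.exp ((∑ i ∈ t, c i * (η ω (s i)).toReal : ℝ) * Complex.I) := by
  obtain ⟨p, hp⟩ := exists_simpleFunc_sum_indicator t c s hs
  have h0 : ∀ x, x ≠ 0 → lam (p ⁻¹' {x}) ≠ ∞ := fun x hx =>
    measure_preimage_ne_top_of_sum_indicator hs' hp hx
  let q : SimpleFunc Y ℂ := p.map fun x : ℝ => Complex.exp ((x : ℂ) * Complex.I) - 1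
  have hq : ∀ y, q y = Complex.exp ((p y : ℂ) * Complex.I) - 1 := fun y => rfl
  have hq0 : ∀ y, p y = 0 → q y = 0 := fun y h => by rw [hq, h]; simp
  have hqm : MemLp q 2 lam := by
    refine SimpleFunc.memLp_of_finite_measure_preimage _ fun z hz => ?_
    have h1 : q ⁻¹' {z} ⊆ ⋃ i ∈ t, s i := by
      intro y hy
      by_contra h
      simp only [Set.mem_iUnion, not_exists] at h
      refine hz ?_
      rw [← (show q y = z from hy)]
      refine hq0 y ?_
      rw [hp]
      exact Finset.sum_eq_zero fun i hi => Set.indicator_of_notMem (h i hi) _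
    exact ((measure_mono h1).trans (measure_biUnion_finset_le _ _)).trans_lt
      (ENNReal.sum_lt_top.2 fun i hi => (hs' i hi).lt_top)
  let φ : SimpleTest lam D :=
    { toFun := q
      eq_zero := fun y hy => hq0 y (by
        rw [hp]
        exact Finset.sum_eq_zero fun i hi => Set.indicator_of_notMem (fun h => hy (hsD i hi h)) _)
      memLp := hqm
      ne_neg_one := fun y h => Complex.exp_ne_zero ((p y : ℂ) * Complex.I) (by
        rw [hq] at h; linear_combination h) }
  refine ⟨φ, ?_⟩
  filter_upwards [hη.ae_exp_sum hs hs' hp,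
    hη.ae_exp_integral p (k := fun x : ℝ => (x : ℂ) * Complex.I) fun x hx =>
      h0 x fun h => hx (by simp [h]),
    hη.ae_exp_integral p (k := fun x : ℝ => ℓ (Complex.exp ((x : ℂ) * Complex.I))) fun x hx =>
      h0 x fun h => hx (by simp [h, hℓ1])] with ω e1 e2 e3
  rw [e1, e2.2]
  have h4 : φ.expFun ℓ η ω = Complex.exp (∫ y, ℓ (Complex.exp ((p y : ℂ) * Complex.I)) ∂(η ω)) := by
    rw [SimpleTest.expFun]
    congr 1
    refine integral_congr_ae (ae_of_all _ fun y => ?_)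
    change ℓ (1 + q y) = _
    rw [hq, add_sub_cancel]
  rw [h4, e3.2]
  exact Finset.prod_congr rfl fun x _ => by rw [hℓ _ (Complex.exp_ne_zero _)]

end Characteristic

/-! ### Totality of the normalized exponentials -/

section Totality

variable {Y : Type u} [MeasurableSpace Y] {lam : Measure Y} {D : Set Y}
  {Ω : Type v} [MeasurableSpace Ω] {η : Ω → Measure Y} {Pr : Measure Ω} [IsProbabilityMeasure Pr]

theorem IsPoissonProcess.countAlgebra_le (hη : IsPoissonProcess η lam Pr) (D : Set Y) :
    countAlgebra η D ≤ ‹MeasurableSpace Ω› :=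
  iSup₂_le fun _ hB => (hη.measurable_eval hB.1).comap_le

theorem measurable_eval_countAlgebra {B : Set Y} (hB : MeasurableSet B) (hBD : B ⊆ D) :
    Measurable[countAlgebra η D] fun ω => η ω B := by
  exact (comap_measurable fun ω => η ω B).mono
    (le_iSup₂ (f := fun (B : Set Y) (_ : MeasurableSet B ∧ B ⊆ D) =>
      MeasurableSpace.comap (fun ω => η ω B) inferInstance) B ⟨hB, hBD⟩) le_rfl

theorem measurable_restrict_measure (hη : Measurable η) (hD : MeasurableSet D) :
    Measurable fun ω => (η ω).restrict D := by
  refine Measure.measurable_of_measurable_coe _ fun B hB => ?_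
  simp only [Measure.restrict_apply hB]
  exact (Measure.measurable_coe (hB.inter hD)).comp hη

theorem countAlgebra_le_comap (D : Set Y) :
    countAlgebra η D ≤ MeasurableSpace.comap (fun ω => (η ω).restrict D) inferInstance := by
  refine iSup₂_le fun B hB => ?_
  have h1 : (fun ω => η ω B) = (fun m : Measure Y => m B) ∘ fun ω => (η ω).restrict D := by
    funext ω
    simp [Measure.restrict_apply hB.1, Set.inter_eq_left.2 hB.2]
  rw [h1, ← MeasurableSpace.comap_comp]
  exact MeasurableSpace.comap_mono (Measure.measurable_coe hB.1).comap_le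

theorem integrable_exp_I_mul {g : Ω → ℝ} (hg : Measurable g) {u : Ω → ℂ} (hu : Integrable u Pr) :
    Integrable (fun ω => u ω * Complex.exp (g ω * Complex.I)) Pr :=
  hu.mul_bdd (c := 1) (Complex.measurable_exp.comp
      ((Complex.measurable_ofReal.comp hg).mul_const _)).aestronglyMeasurable
    (ae_of_all _ fun _ => (Complex.norm_exp_ofReal_mul_I _).le)

theorem conj_exp_ofReal_mul_I (x : ℝ) :
    conj (Complex.exp (x * Complex.I)) = Complex.exp ((-x : ℝ) * Complex.I) := by
  rw [← Complex.exp_conj, map_mul, Complex.conj_I, Complex.conj_ofReal]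
  push_cast
  ring_nf

/-- If `u` is orthogonal to all characters `exp (i ∑ c_B η(B ∩ D))`, then the images under
`η ↦ η|_D` of the measures `u⁺ Pr` and `u⁻ Pr` have the same characteristic functionals, so they
coincide, and `u` integrates to zero over the events of the σ-algebra of the counts in `D`. -/
theorem IsPoissonProcess.setIntegral_eq_zero_of_characteristic [SigmaFinite lam]
    (hη : IsPoissonProcess η lam Pr) (hD : MeasurableSet D) {u : Ω → ℝ} (hu : Integrable u Pr)
    (h : ∀ (t : Finset (Set Y)) (c : Set Y → ℝ), (∀ B ∈ t, MeasurableSet B ∧ lam B ≠ ∞) →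
      ∫ ω, (u ω : ℂ) * Complex.exp ((∑ B ∈ t, c B * (η ω (B ∩ D)).toReal : ℝ) * Complex.I) ∂Pr = 0)
    {A : Set Ω} (hA : MeasurableSet[countAlgebra η D] A) : ∫ ω in A, u ω ∂Pr = 0 := by
  have hR := measurable_restrict_measure hη.measurable hD
  have f1 : IsFiniteMeasure (Pr.withDensity fun ω => ENNReal.ofReal (u ω)) :=
    isFiniteMeasure_withDensity_ofReal hu.hasFiniteIntegral
  have f2 : IsFiniteMeasure (Pr.withDensity fun ω => ENNReal.ofReal (-u ω)) :=
    isFiniteMeasure_withDensity_ofReal hu.neg.hasFiniteIntegral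
  have hfin : ∀ f : Ω → ℝ≥0∞, ∀ B, MeasurableSet B → lam B ≠ ∞ →
      ∀ᵐ m ∂((Pr.withDensity f).map fun ω => (η ω).restrict D), m B ≠ ∞ := by
    intro f B hB hB'
    have hm : MeasurableSet {m : Measure Y | m B ≠ ∞} :=
      (Measure.measurable_coe hB) (measurableSet_singleton ∞).compl
    rw [ae_map_iff hR.aemeasurable hm]
    refine (withDensity_absolutelyContinuous Pr f).ae_le ?_
    filter_upwards [hη.ae_ne_top (hB.inter hD)
      (ne_top_of_le_ne_top hB' (measure_mono Set.inter_subset_left))] with ω hω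
    rwa [Measure.restrict_apply hB]
  have hint : ∀ g : Ω → ℝ, AEMeasurable g Pr → ∀ (t : Finset (Set Y)) (c : Set Y → ℝ),
      (∀ B ∈ t, MeasurableSet B ∧ lam B ≠ ∞) →
      ∫ m, Complex.exp ((∑ B ∈ t, c B * (m B).toReal : ℝ) * Complex.I)
        ∂((Pr.withDensity fun ω => ENNReal.ofReal (g ω)).map fun ω => (η ω).restrict D) =
      ∫ ω, ((ENNReal.ofReal (g ω)).toReal : ℂ) *
        Complex.exp ((∑ B ∈ t, c B * (η ω (B ∩ D)).toReal : ℝ) * Complex.I) ∂Pr := by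
    intro g hg t c ht
    have hm : Measurable fun m : Measure Y =>
        Complex.exp ((∑ B ∈ t, c B * (m B).toReal : ℝ) * Complex.I) :=
      Complex.measurable_exp.comp ((Complex.measurable_ofReal.comp
        (Finset.measurable_sum _ fun B hB =>
          ((Measure.measurable_coe (ht B hB).1).ennreal_toReal.const_mul _))).mul_const _)
    rw [integral_map hR.aemeasurable hm.aestronglyMeasurable,
      integral_withDensity_eq_integral_toReal_smul₀ hg.ennreal_ofReal
        (ae_of_all _ fun _ => ENNReal.ofReal_lt_top)]
    refine integral_congr_ae (ae_of_all _ fun ω => ?_)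
    have h1 : ∑ B ∈ t, c B * ((η ω).restrict D B).toReal =
        ∑ B ∈ t, c B * (η ω (B ∩ D)).toReal :=
      Finset.sum_congr rfl fun B hB => by rw [Measure.restrict_apply (ht B hB).1]
    simp only [h1, Complex.real_smul]
  have hEq : (Pr.withDensity fun ω => ENNReal.ofReal (u ω)).map (fun ω => (η ω).restrict D) =
      (Pr.withDensity fun ω => ENNReal.ofReal (-u ω)).map (fun ω => (η ω).restrict D) := by
    refine measure_ext_of_characteristic lam (hfin _) (hfin _) fun t c ht => ?_
    rw [hint u hu.aemeasurable t c ht, hint (fun ω => -u ω) hu.neg.aemeasurable t c ht,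
      ← sub_eq_zero]
    have hm : Measurable fun ω => ∑ B ∈ t, c B * (η ω (B ∩ D)).toReal :=
      Finset.measurable_sum _ fun B hB =>
        ((hη.measurable_eval ((ht B hB).1.inter hD)).ennreal_toReal.const_mul _)
    have hi : ∀ g : Ω → ℝ, Integrable g Pr →
        Integrable (fun ω => ((ENNReal.ofReal (g ω)).toReal : ℂ)) Pr := fun g hg => by
      have : (fun ω => (ENNReal.ofReal (g ω)).toReal) = fun ω => max (g ω) 0 := by
        funext ω; rw [ENNReal.toReal_ofReal_eq_iff.2 (le_max_right _ _) |>.symm,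
          ENNReal.ofReal_max]; simp
      refine Integrable.ofReal (𝕜 := ℂ) (f := fun ω => (ENNReal.ofReal (g ω)).toReal) ?_
      rw [this]
      exact hg.pos_part
    rw [← integral_sub (integrable_exp_I_mul hm (hi u hu))
      (integrable_exp_I_mul hm (hi (fun ω => -u ω) hu.neg)), ← h t c ht]
    refine integral_congr_ae (ae_of_all _ fun ω => ?_)
    simp only
    rw [← sub_mul, ← Complex.ofReal_sub]
    congr 2
    rcases le_total 0 (u ω) with h0 | h0
    · rw [ENNReal.toReal_ofReal h0, ENNReal.ofReal_of_nonpos (neg_nonpos.2 h0)]; simp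
    · rw [ENNReal.toReal_ofReal (neg_nonneg.2 h0), ENNReal.ofReal_of_nonpos h0]; simp
  obtain ⟨A', hA', rfl⟩ := countAlgebra_le_comap D A hA
  rw [integral_eq_lintegral_pos_part_sub_lintegral_neg_part hu.integrableOn,
    ← withDensity_apply _ (hR hA'), ← withDensity_apply _ (hR hA'), ← Measure.map_apply hR hA',
    ← Measure.map_apply hR hA', hEq, sub_self]

variable {ℓ : ℂ → ℂ}

theorem SimpleTest.normExp_mem_lpMeas (hη : IsPoissonProcess η lam Pr)
    (hℓ : ∀ z, z ≠ 0 → Complex.exp (ℓ z) = z) (hℓ1 : ℓ 1 = 0) (φ : SimpleTest lam D) :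
    φ.normExp ℓ η Pr ∈ lpMeas ℂ ℂ (countAlgebra η D) 2 Pr := by
  rw [mem_lpMeas_iff_aestronglyMeasurable]
  refine ⟨fun ω => Complex.exp (-∫ y, φ.toFun y ∂lam) *
    ∏ x ∈ φ.toFun.range, Complex.exp (ℓ (1 + x)) ^ count (η ω) (φ.toFun ⁻¹' {x}),
    Measurable.stronglyMeasurable ?_, ?_⟩
  · refine Measurable.const_mul (Finset.measurable_prod _ fun x _ => ?_) _
    by_cases hx : x = 0
    · simp only [hx, add_zero, hℓ1, Complex.exp_zero, one_pow]
      exact measurable_const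
    · have h1 : φ.toFun ⁻¹' {x} ⊆ D := fun y hy => by
        by_contra hyD
        exact hx (hy.symm.trans (φ.eq_zero y hyD))
      exact (measurable_of_countable fun n : ℕ => Complex.exp (ℓ (1 + x)) ^ n).comp
        (Nat.measurable_floor.comp
          (measurable_eval_countAlgebra (φ.toFun.measurableSet_fiber x) h1).ennreal_toReal)
  · filter_upwards [φ.coeFn_normExp hη hℓ hℓ1,
      hη.ae_exp_integral φ.toFun (k := fun z => ℓ (1 + z)) fun z hz =>
        φ.measure_fiber_ne_top fun h => hz (by rw [h, add_zero, hℓ1])] with ω e1 e2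
    rw [e1, ← e2.2]
    rfl

/-- The normalized exponentials of the simple functions on `D` span a dense subspace of `L²` of the
σ-algebra of the counts in `D`. -/
theorem IsPoissonProcess.isTotal_normExp [SigmaFinite lam] (hη : IsPoissonProcess η lam Pr)
    (hℓ : ∀ z, z ≠ 0 → Complex.exp (ℓ z) = z) (hℓ1 : ℓ 1 = 0) (hD : MeasurableSet D) :
    IsTotal fun φ : SimpleTest lam D =>
      (⟨φ.normExp ℓ η Pr, φ.normExp_mem_lpMeas hη hℓ hℓ1⟩ :
        lpMeas ℂ ℂ (countAlgebra η D) 2 Pr) := by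
  have hle := hη.countAlgebra_le D
  have : Fact (countAlgebra η D ≤ ‹MeasurableSpace Ω›) := ⟨hle⟩
  have : CompleteSpace (lpMeas ℂ ℂ (countAlgebra η D) 2 Pr) := inferInstance
  refine isTotal_of_inner_eq_zero fun v hv => ?_
  have hvi : Integrable (v : Lp ℂ 2 Pr) Pr := (Lp.memLp (v : Lp ℂ 2 Pr)).integrable (by norm_num)
  -- `v` is orthogonal to all characters
  have h1 : ∀ (t : Finset (Set Y)) (c : Set Y → ℝ), (∀ B ∈ t, MeasurableSet B ∧ lam B ≠ ∞) →
      ∫ ω, (v : Lp ℂ 2 Pr) ω *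
        Complex.exp ((∑ B ∈ t, c B * (η ω (B ∩ D)).toReal : ℝ) * Complex.I) ∂Pr = 0 := by
    intro t c ht
    obtain ⟨φ, hφ⟩ := hη.exists_expFun_eq_exp_sum (D := D) hℓ hℓ1 t (fun B => -c B)
      (fun B => B ∩ D) (fun B hB => (ht B hB).1.inter hD)
      (fun B hB => ne_top_of_le_ne_top (ht B hB).2 (measure_mono Set.inter_subset_left))
      fun B _ => Set.inter_subset_right
    have h2 := hv φ
    rw [Submodule.coe_inner, L2.inner_def] at h2
    have h3 : ∫ ω, conj (Complex.exp (-∫ y, φ.toFun y ∂lam)) * ((v : Lp ℂ 2 Pr) ω *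
        Complex.exp ((∑ B ∈ t, c B * (η ω (B ∩ D)).toReal : ℝ) * Complex.I)) ∂Pr = 0 := by
      rw [← h2]
      refine integral_congr_ae ?_
      filter_upwards [φ.coeFn_normExp hη hℓ hℓ1, hφ] with ω e1 e2
      rw [e1, e2, RCLike.inner_apply, map_mul, conj_exp_ofReal_mul_I]
      simp only [neg_mul, Finset.sum_neg_distrib, neg_neg]
      ring
    rw [integral_const_mul] at h3
    exact (mul_eq_zero.1 h3).resolve_left (by simp [Complex.exp_ne_zero])
  have hm : ∀ (t : Finset (Set Y)) (c : Set Y → ℝ), (∀ B ∈ t, MeasurableSet B ∧ lam B ≠ ∞) →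
      Measurable fun ω => ∑ B ∈ t, c B * (η ω (B ∩ D)).toReal := fun t c ht =>
    Finset.measurable_sum _ fun B hB =>
      ((hη.measurable_eval ((ht B hB).1.inter hD)).ennreal_toReal.const_mul _)
  have hvc : Integrable (fun ω => conj ((v : Lp ℂ 2 Pr) ω)) Pr :=
    (RCLike.conjCLE (K := ℂ)).toContinuousLinearMap.integrable_comp hvi
  have h2 : ∀ (t : Finset (Set Y)) (c : Set Y → ℝ), (∀ B ∈ t, MeasurableSet B ∧ lam B ≠ ∞) →
      ∫ ω, conj ((v : Lp ℂ 2 Pr) ω) *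
        Complex.exp ((∑ B ∈ t, c B * (η ω (B ∩ D)).toReal : ℝ) * Complex.I) ∂Pr = 0 := by
    intro t c ht
    have h3 := congrArg conj (h1 t (fun B => -c B) ht)
    rw [← integral_conj, map_zero] at h3
    rw [← h3]
    refine integral_congr_ae (ae_of_all _ fun ω => ?_)
    simp only [map_mul, conj_exp_ofReal_mul_I, neg_mul, Finset.sum_neg_distrib, neg_neg]
  have hre : ∀ z : ℂ, (z.re : ℂ) = (1 / 2) * (z + conj z) := fun z => by
    rw [Complex.add_conj]; push_cast; ring
  have him : ∀ z : ℂ, (z.im : ℂ) = (-Complex.I / 2) * (z - conj z) := fun z => by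
    rw [Complex.sub_conj]; push_cast
    linear_combination (z.im : ℂ) * Complex.I_sq
  have h0 : (v : Lp ℂ 2 Pr) =ᵐ[Pr] 0 := by
    refine lpMeas.ae_eq_zero_of_forall_setIntegral_eq_zero hle v (by norm_num) (by norm_num)
      (fun A _ _ => hvi.integrableOn) fun A hA _ => ?_
    refine Complex.ext ?_ ?_
    · have h4 := hη.setIntegral_eq_zero_of_characteristic hD (u := fun ω => ((v : Lp ℂ 2 Pr) ω).re)
        hvi.re (fun t c ht => by
          have h5 : ∀ ω (z : ℂ), (((v : Lp ℂ 2 Pr) ω).re : ℂ) * z =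
              (1 / 2) * ((v : Lp ℂ 2 Pr) ω * z + conj ((v : Lp ℂ 2 Pr) ω) * z) := fun ω z => by
            rw [hre]; ring
          simp only [h5]
          rw [integral_const_mul, integral_add (integrable_exp_I_mul (hm t c ht) hvi)
            (integrable_exp_I_mul (hm t c ht) hvc), h1 t c ht, h2 t c ht, add_zero, mul_zero]) hA
      have h6 := integral_re (𝕜 := ℂ) (hvi.integrableOn (s := A))
      simp only [RCLike.re_eq_complex_re] at h6
      rw [← h6, h4, Complex.zero_re]
    · have h4 := hη.setIntegral_eq_zero_of_characteristic hD (u := fun ω => ((v : Lp ℂ 2 Pr) ω).im)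
        hvi.im (fun t c ht => by
          have h5 : ∀ ω (z : ℂ), (((v : Lp ℂ 2 Pr) ω).im : ℂ) * z =
              (-Complex.I / 2) * ((v : Lp ℂ 2 Pr) ω * z - conj ((v : Lp ℂ 2 Pr) ω) * z) :=
            fun ω z => by
            rw [him]; ring
          simp only [h5]
          rw [integral_const_mul, integral_sub (integrable_exp_I_mul (hm t c ht) hvi)
            (integrable_exp_I_mul (hm t c ht) hvc), h1 t c ht, h2 t c ht, sub_zero, mul_zero]) hA
      have h6 := integral_im (𝕜 := ℂ) (hvi.integrableOn (s := A))
      simp only [RCLike.im_eq_complex_im] at h6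
      rw [← h6, h4, Complex.zero_im]
  exact Subtype.ext (Lp.eq_zero_iff_ae_eq_zero.2 h0)

end Totality

/-! ### Shifts of the Poisson process -/

section ShiftSpace

variable {Ω : Type v} [MeasurableSpace Ω] {Pr : Measure Ω} [IsProbabilityMeasure Pr]

theorem isTotal_indicator :
    IsTotal fun A : {A : Set Ω // MeasurableSet A} =>
      indicatorConstLp 2 A.2 (measure_ne_top Pr A.1) (1 : ℂ) := by
  refine isTotal_of_inner_eq_zero fun v hv => ?_
  have hvi : Integrable v Pr := (Lp.memLp v).integrable (by norm_num)
  refine Lp.eq_zero_iff_ae_eq_zero.2 (Lp.ae_eq_zero_of_forall_setIntegral_eq_zero v (by norm_num)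
    (by norm_num) (fun A _ _ => hvi.integrableOn) fun A hA _ => ?_)
  rw [← L2.inner_indicatorConstLp_one (𝕜 := ℂ) hA (measure_ne_top Pr A)]
  exact hv ⟨A, hA⟩

variable {Y : Type u} [MeasurableSpace Y] {lam : Measure Y} {η : Ω → Measure Y}

theorem IsGeneratedBy.mem_lpMeas (hΩ : IsGeneratedBy η Pr) (hη : IsPoissonProcess η lam Pr)
    (f : Lp ℂ 2 Pr) : f ∈ lpMeas ℂ ℂ (countAlgebra η Set.univ) 2 Pr := by
  refine isTotal_indicator.mem_of_isClosed
    (p := lpMeas ℂ ℂ (countAlgebra η Set.univ) 2 Pr)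
    (isClosed_aestronglyMeasurable (hη.countAlgebra_le _)) (fun A => ?_) f
  obtain ⟨A', hA', h⟩ := hΩ A.1 A.2
  rw [mem_lpMeas_iff_aestronglyMeasurable]
  refine ⟨A'.indicator fun _ => 1, ?_, ?_⟩
  · apply StronglyMeasurable.indicator
    · exact stronglyMeasurable_const
    · exact hA'
  · exact indicatorConstLp_coeFn.trans (indicator_ae_eq_of_ae_eq_set h)

theorem IsGeneratedBy.isTotal_normExp [SigmaFinite lam] (hΩ : IsGeneratedBy η Pr)
    (hη : IsPoissonProcess η lam Pr) {ℓ : ℂ → ℂ}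
    (hℓ : ∀ z, z ≠ 0 → Complex.exp (ℓ z) = z) (hℓ1 : ℓ 1 = 0) :
    IsTotal fun φ : SimpleTest lam Set.univ => φ.normExp ℓ η Pr := by
  have : Fact (countAlgebra η Set.univ ≤ ‹MeasurableSpace Ω›) := ⟨hη.countAlgebra_le _⟩
  refine isTotal_of_inner_eq_zero fun v hv => ?_
  have h := (hη.isTotal_normExp hℓ hℓ1 MeasurableSet.univ).ext_inner
    (v := ⟨v, hΩ.mem_lpMeas hη v⟩) (w := 0) fun φ => by
      rw [Submodule.coe_inner, inner_zero_right]
      exact hv φ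
  exact congrArg Subtype.val h

theorem measurePreserving_id_map (hη : Measurable η) : MeasurePreserving η Pr (Pr.map η) :=
  ⟨hη, rfl⟩

/-- If `η` generates the σ-algebra of `Ω`, then every element of `L²(Ω)` is a function of `η`. -/
theorem IsGeneratedBy.surjective_comp (hΩ : IsGeneratedBy η Pr) (hη : Measurable η) :
    Function.Surjective (Lp.compMeasurePreservingₗᵢ ℂ (p := 2) (E := ℂ) η
      (measurePreserving_id_map (Pr := Pr) hη)) := by
  set W := Lp.compMeasurePreservingₗᵢ ℂ (p := 2) (E := ℂ) η
      (measurePreserving_id_map (Pr := Pr) hη)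
  have hcl : IsClosed (LinearMap.range W.toLinearMap : Set (Lp ℂ 2 Pr)) := by
    rw [LinearMap.coe_range]
    exact W.isometry.isClosedEmbedding.isClosed_range
  intro f
  refine isTotal_indicator.mem_of_isClosed hcl (fun A => ?_) f
  obtain ⟨A', hA', h⟩ := hΩ A.1 A.2
  obtain ⟨C, hC, rfl⟩ := countAlgebra_le_comap Set.univ A' hA'
  simp only [Measure.restrict_univ] at h
  have _ : IsProbabilityMeasure (Pr.map η) := Measure.isProbabilityMeasure_map hη.aemeasurable
  refine ⟨indicatorConstLp 2 hC (measure_ne_top _ _) 1, ?_⟩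
  change W _ = _
  refine Lp.ext ?_
  refine (Lp.coeFn_compMeasurePreserving _ (measurePreserving_id_map (Pr := Pr) hη)).trans ?_
  refine EventuallyEq.trans ?_ indicatorConstLp_coeFn.symm
  refine ((measurePreserving_id_map (Pr := Pr) hη).quasiMeasurePreserving.ae_eq_comp
    indicatorConstLp_coeFn).trans ?_
  exact (indicator_ae_eq_of_ae_eq_set (f := fun _ => (1 : ℂ)) h).symm

end ShiftSpace

section Shift

variable {d : ℕ} {Y : Type u} [MeasurableSpace Y] [AddAction (EuclideanSpace ℝ (Fin d)) Y]
  [MeasurableVAdd₂ (EuclideanSpace ℝ (Fin d)) Y] {lam : Measure Y}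
  [VAddInvariantMeasure (EuclideanSpace ℝ (Fin d)) Y lam]

/-- The measure `B ↦ m(B + a)`. -/
def shiftMeasure (a : EuclideanSpace ℝ (Fin d)) (m : Measure Y) : Measure Y :=
  m.map fun y => -a +ᵥ y

theorem shiftMeasure_apply (a : EuclideanSpace ℝ (Fin d)) (m : Measure Y) {B : Set Y}
    (hB : MeasurableSet B) : shiftMeasure a m B = m (a +ᵥ B) := by
  rw [shiftMeasure, Measure.map_apply (measurable_const_vadd _) hB, Set.preimage_vadd_neg]

theorem measurable_shiftMeasure (a : EuclideanSpace ℝ (Fin d)) :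
    Measurable (shiftMeasure a : Measure Y → Measure Y) :=
  Measure.measurable_map _ (measurable_const_vadd _)

theorem shiftMeasure_neg (a : EuclideanSpace ℝ (Fin d)) (m : Measure Y) :
    shiftMeasure (-a) (shiftMeasure a m) = m := by
  refine Measure.ext fun B hB => ?_
  rw [shiftMeasure_apply _ _ hB, shiftMeasure_apply _ _ (measurableSet_translate hB _),
    vadd_vadd, add_neg_cancel, zero_vadd]

variable {Ω : Type v} [MeasurableSpace Ω] {Pr : Measure Ω} [IsProbabilityMeasure Pr]
  {η : Ω → Measure Y}

/-- The law of a Poisson process with invariant intensity measure is invariant. -/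
theorem IsPoissonProcess.measurePreserving_shift [SigmaFinite lam]
    (hη : IsPoissonProcess η lam Pr) (a : EuclideanSpace ℝ (Fin d)) :
    MeasurePreserving (shiftMeasure a) (Pr.map η) (Pr.map η) := by
  refine ⟨measurable_shiftMeasure a, ?_⟩
  have hs := measurable_shiftMeasure (Y := Y) a
  have hlam : ∀ B : Set Y, lam (a +ᵥ B) = lam B := fun B => measure_vadd lam a B
  have _ : IsProbabilityMeasure (Pr.map η) :=
    Measure.isProbabilityMeasure_map hη.measurable.aemeasurable
  have _ : IsProbabilityMeasure ((Pr.map η).map (shiftMeasure a)) :=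
    Measure.isProbabilityMeasure_map hs.aemeasurable
  have hfin : ∀ B, MeasurableSet B → MeasurableSet {m : Measure Y | m B ≠ ∞} := fun B hB =>
    (Measure.measurable_coe hB) (measurableSet_singleton ∞).compl
  rw [Measure.map_map hs hη.measurable] at *
  refine measure_ext_of_characteristic lam (fun B hB hB' => ?_) (fun B hB hB' => ?_)
    fun t c ht => ?_
  · rw [ae_map_iff (hs.comp hη.measurable).aemeasurable (hfin B hB)]
    filter_upwards [hη.ae_ne_top (measurableSet_translate hB a) (by rwa [hlam])] with ω hω
    rwa [Function.comp, shiftMeasure_apply a _ hB]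
  · rw [ae_map_iff hη.measurable.aemeasurable (hfin B hB)]
    exact hη.ae_ne_top hB hB'
  · have hm : Measurable fun m : Measure Y =>
        Complex.exp ((∑ B ∈ t, c B * (m B).toReal : ℝ) * Complex.I) :=
      Complex.measurable_exp.comp ((Complex.measurable_ofReal.comp
        (Finset.measurable_sum _ fun B hB =>
          ((Measure.measurable_coe (ht B hB).1).ennreal_toReal.const_mul _))).mul_const _)
    rw [integral_map (hs.comp hη.measurable).aemeasurable hm.aestronglyMeasurable,
      integral_map hη.measurable.aemeasurable hm.aestronglyMeasurable]
    obtain ⟨p, hp⟩ := exists_simpleFunc_sum_indicator t c (fun B => B) fun B hB => (ht B hB).1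
    let q : SimpleFunc Y ℝ := p.comp (fun y => -a +ᵥ y) (measurable_const_vadd _)
    have hq : ∀ y, q y = ∑ B ∈ t, (a +ᵥ B).indicator (fun _ => c B) y := fun y => by
      change p (-a +ᵥ y) = _
      rw [hp]
      refine Finset.sum_congr rfl fun B _ => ?_
      classical
      simp only [Set.indicator_apply, Set.mem_vadd_set_iff_neg_vadd_mem]
    have h1 := hη.integral_exp_sum (t := t) (c := c) (s := fun B => a +ᵥ B)
      (fun B hB => measurableSet_translate (ht B hB).1 a) (fun B hB => by
        rw [hlam]; exact (ht B hB).2) hq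
    have h2 : ∀ ω, ∑ B ∈ t, c B * ((shiftMeasure a ∘ η) ω B).toReal =
        ∑ B ∈ t, c B * (η ω (a +ᵥ B)).toReal := fun ω =>
      Finset.sum_congr rfl fun B hB => by rw [Function.comp, shiftMeasure_apply a _ (ht B hB).1]
    simp only [h2]
    rw [h1, hη.integral_exp_sum (t := t) (c := c) (s := fun B => B) (fun B hB => (ht B hB).1)
      (fun B hB => (ht B hB).2) hp]
    congr 1
    exact integral_vadd_eq_self (μ := lam) (fun y => Complex.exp ((p y : ℂ) * Complex.I) - 1)

/-- The shifts exist: `L²(Ω)` is `L²` of the law of `η`, which the translations preserve. -/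
theorem exists_isShift [SigmaFinite lam] (P : PointedCone ℝ (EuclideanSpace ℝ (Fin d)))
    (hη : IsPoissonProcess η lam Pr) (hΩ : IsGeneratedBy η Pr) : ∃ S, IsShift P η Pr S := by
  have hmp := measurePreserving_id_map (Pr := Pr) hη.measurable
  let W := LinearIsometryEquiv.ofSurjective _ (hΩ.surjective_comp hη.measurable)
  let R : EuclideanSpace ℝ (Fin d) → (Lp ℂ 2 (Pr.map η) →ₗᵢ[ℂ] Lp ℂ 2 (Pr.map η)) := fun a =>
    Lp.compMeasurePreservingₗᵢ ℂ (shiftMeasure a) (hη.measurePreserving_shift a)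
  have hR : ∀ a G, R a G =ᵐ[Pr.map η] G ∘ shiftMeasure a := fun a G =>
    Lp.coeFn_compMeasurePreserving G (hη.measurePreserving_shift a)
  have hW : ∀ G, W G =ᵐ[Pr] G ∘ η := fun G => Lp.coeFn_compMeasurePreserving G hmp
  have hsurj : ∀ a, Function.Surjective (R a) := fun a G => by
    refine ⟨R (-a) G, Lp.ext ?_⟩
    filter_upwards [hR a (R (-a) G),
      (hη.measurePreserving_shift a).quasiMeasurePreserving.ae (hR (-a) G)] with m h1 h2
    rw [h1, Function.comp, h2, Function.comp, shiftMeasure_neg]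
  refine ⟨fun a => W.symm.trans ((LinearIsometryEquiv.ofSurjective _
    (hsurj (a : EuclideanSpace ℝ (Fin d)))).trans W), ?_⟩
  intro a n B F hB hF g hg
  let G : Measure Y → ℂ := fun m => F fun i => m (B i)
  have hG : Measurable G :=
    hF.comp (measurable_pi_lambda _ fun i => Measure.measurable_coe (hB i))
  have hG2 : MemLp G 2 (Pr.map η) := by
    rw [memLp_map_measure_iff hG.aestronglyMeasurable hη.measurable.aemeasurable]
    exact (Lp.memLp g).ae_eq hg
  have hg2 : W (hG2.toLp G) = g := by
    refine Lp.ext ?_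
    exact (hW _).trans ((hmp.quasiMeasurePreserving.ae_eq_comp hG2.coeFn_toLp).trans hg.symm)
  have hg3 : W.symm g = hG2.toLp G := by rw [← hg2, W.symm_apply_apply]
  change W (R a (W.symm g)) =ᵐ[Pr] _
  rw [hg3]
  filter_upwards [hW (R a (hG2.toLp G)),
    hmp.quasiMeasurePreserving.ae (hR a (hG2.toLp G)),
    (hmp.quasiMeasurePreserving.ae ((hη.measurePreserving_shift (a : EuclideanSpace ℝ (Fin d))
      ).quasiMeasurePreserving.ae hG2.coeFn_toLp))] with ω h1 h2 h3
  rw [h1, Function.comp, h2, Function.comp, h3]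
  refine congrArg F (funext fun i => ?_)
  exact shiftMeasure_apply _ _ (hB i)

variable {P : PointedCone ℝ (EuclideanSpace ℝ (Fin d))}
  {S : P → (Lp ℂ 2 Pr ≃ₗᵢ[ℂ] Lp ℂ 2 Pr)} {ℓ : ℂ → ℂ}

theorem IsShift.apply_normExp (hS : IsShift P η Pr S) (hη : IsPoissonProcess η lam Pr)
    (hℓ : ∀ z, z ≠ 0 → Complex.exp (ℓ z) = z) (hℓ1 : ℓ 1 = 0) {X X' : Set Y} (a : P)
    (φ : SimpleTest lam X) (ψ : SimpleTest lam X')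
    (hψ : ∀ y, ψ.toFun y = φ.toFun (-(a : EuclideanSpace ℝ (Fin d)) +ᵥ y)) :
    S a (φ.normExp ℓ η Pr) = ψ.normExp ℓ η Pr := by
  have hfun : ∀ {X : Set Y} (φ : SimpleTest lam X), φ.normExp ℓ η Pr =ᵐ[Pr] fun ω =>
      Complex.exp (-∫ y, φ.toFun y ∂lam) * ∏ x ∈ φ.toFun.range,
        Complex.exp (ℓ (1 + x)) ^ count (η ω) (φ.toFun ⁻¹' {x}) := by
    intro X φ
    filter_upwards [φ.coeFn_normExp hη hℓ hℓ1,
      hη.ae_exp_integral φ.toFun (k := fun z => ℓ (1 + z)) fun z hz =>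
        φ.measure_fiber_ne_top fun h => hz (by rw [h, add_zero, hℓ1])] with ω e1 e2
    rw [e1, ← e2.2]
    rfl
  let e := φ.toFun.range.equivFin
  let F : (Fin φ.toFun.range.card → ℝ≥0∞) → ℂ := fun v =>
    Complex.exp (-∫ y, φ.toFun y ∂lam) *
      ∏ i, Complex.exp (ℓ (1 + (e.symm i : ℂ))) ^ ⌊(v i).toReal⌋₊
  have hF : Measurable F := (Finset.measurable_prod _ fun i _ =>
    (measurable_of_countable fun n : ℕ => Complex.exp (ℓ (1 + (e.symm i : ℂ))) ^ n).comp
      (Nat.measurable_floor.comp (measurable_pi_apply i).ennreal_toReal)).const_mul _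
  have hprod : ∀ f : ℂ → ℂ, ∏ i, f (e.symm i : ℂ) = ∏ x ∈ φ.toFun.range, f x := fun f => by
    rw [← Finset.prod_coe_sort φ.toFun.range f]
    exact e.symm.prod_comp fun x : φ.toFun.range => f x
  have h1 := hS a _ (fun i => φ.toFun ⁻¹' {(e.symm i : ℂ)}) F
    (fun i => φ.toFun.measurableSet_fiber _) hF (φ.normExp ℓ η Pr) ((hfun φ).trans
      (ae_of_all _ fun ω => congrArg _ (hprod fun x =>
        Complex.exp (ℓ (1 + x)) ^ count (η ω) (φ.toFun ⁻¹' {x})).symm))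
  refine Lp.ext (h1.trans (EventuallyEq.trans (ae_of_all _ fun ω => ?_) (hfun ψ).symm))
  have hr : ψ.toFun.range = φ.toFun.range := by
    ext x
    simp only [SimpleFunc.mem_range, Set.mem_range]
    constructor
    · rintro ⟨y, rfl⟩
      exact ⟨_, (hψ y).symm⟩
    · rintro ⟨y, rfl⟩
      exact ⟨(a : EuclideanSpace ℝ (Fin d)) +ᵥ y, by rw [hψ, neg_vadd_vadd]⟩
  have hpre : ∀ x,
      ψ.toFun ⁻¹' {x} = (a : EuclideanSpace ℝ (Fin d)) +ᵥ φ.toFun ⁻¹' {x} := fun x => by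
    ext y
    rw [Set.mem_vadd_set_iff_neg_vadd_mem, Set.mem_preimage, Set.mem_preimage, hψ]
  have hint : ∫ y, ψ.toFun y ∂lam = ∫ y, φ.toFun y ∂lam := by
    simp only [hψ]
    exact integral_vadd_eq_self (μ := lam) (fun y => φ.toFun y)
  simp only [hint, hr, hpre]
  exact congrArg (fun z => Complex.exp (-∫ y, φ.toFun y ∂lam) * z) (hprod fun x =>
    Complex.exp (ℓ (1 + x)) ^ count (η ω) ((a : EuclideanSpace ℝ (Fin d)) +ᵥ φ.toFun ⁻¹' {x}))

/-- The simple function `y ↦ φ(y - a)`. -/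
def SimpleTest.translate {X : Set Y} (φ : SimpleTest lam X) (a : EuclideanSpace ℝ (Fin d))
    (ha : ∀ x ∈ X, a +ᵥ x ∈ X) : SimpleTest lam X where
  toFun := φ.toFun.comp (fun y => -a +ᵥ y) (measurable_const_vadd _)
  eq_zero y hy := φ.eq_zero _ fun h => hy (by simpa using ha _ h)
  memLp := φ.memLp.comp_measurePreserving (measurePreserving_vadd (-a) lam)
  ne_neg_one y := φ.ne_neg_one _

/-- The unitaries `Sₐ` are determined by their values on the normalized exponentials of all simple
functions on `Y`, which are total in `L²(Ω)`. -/
theorem IsShift.unique [SigmaFinite lam] {S' : P → (Lp ℂ 2 Pr ≃ₗᵢ[ℂ] Lp ℂ 2 Pr)}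
    (hS : IsShift P η Pr S)
    (hS' : IsShift P η Pr S') (hη : IsPoissonProcess η lam Pr) (hΩ : IsGeneratedBy η Pr)
    (hℓ : ∀ z, z ≠ 0 → Complex.exp (ℓ z) = z) (hℓ1 : ℓ 1 = 0) : S = S' := by
  funext a
  refine LinearIsometryEquiv.ext fun g => ?_
  have h := (hΩ.isTotal_normExp hη hℓ hℓ1).clm_ext
    (S := (S a).toContinuousLinearEquiv.toContinuousLinearMap)
    (T := (S' a).toContinuousLinearEquiv.toContinuousLinearMap) fun φ => by
      let ψ := φ.translate (a : EuclideanSpace ℝ (Fin d)) fun _ _ => Set.mem_univ _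
      exact (hS.apply_normExp hη hℓ hℓ1 a φ ψ fun _ => rfl).trans
        (hS'.apply_normExp hη hℓ hℓ1 a φ ψ fun _ => rfl).symm
  exact congrArg (fun T => T g) h

variable {X : Set Y} (hX : MeasurableSet X) (hXP : ∀ a ∈ P, ∀ x ∈ X, a +ᵥ x ∈ X)

theorem translation_toL2 (a : P) (φ : SimpleTest lam X) :
    translation (lam := lam) hX hXP a φ.toL2 =
      (φ.translate (a : EuclideanSpace ℝ (Fin d)) (hXP a a.2)).toL2 := by
  refine Lp.ext ((coeFn_translation hX hXP a φ.toL2).trans (EventuallyEq.trans ?_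
    (MemLp.coeFn_toLp
      ((φ.translate (a : EuclideanSpace ℝ (Fin d)) (hXP a a.2)).memLp.restrict X)).symm))
  refine (translateFun_congr hX (hXP a a.2) (MemLp.coeFn_toLp (φ.memLp.restrict X))).trans
    (ae_of_all _ fun y => ?_)
  rw [translateFun]
  split_ifs with h
  · rfl
  · exact (φ.eq_zero _ h).symm

theorem IsShift.apply_expIsometry (hS : IsShift P η Pr S) (hη : IsPoissonProcess η lam Pr)
    (hℓ : ∀ z, z ≠ 0 → Complex.exp (ℓ z) = z) (hℓ1 : ℓ 1 = 0)
    {J : Fock (Lp ℂ 2 (lam.restrict X)) →ₗᵢ[ℂ] Lp ℂ 2 Pr}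
    (hJ : ∀ φ : SimpleTest lam X, J (expVec φ.toL2) = φ.normExp ℓ η Pr) (a : P)
    (f : Lp ℂ 2 (lam.restrict X)) :
    S a (J (expVec f)) = J (expVec (translation (lam := lam) hX hXP a f)) := by
  have h1 : Continuous fun f => S a (J (expVec f)) :=
    (S a).continuous.comp (J.continuous.comp continuous_expVec)
  have h2 : Continuous fun f => J (expVec (translation (lam := lam) hX hXP a f)) :=
    J.continuous.comp (continuous_expVec.comp (translation (lam := lam) hX hXP a).continuous)
  have h := (SimpleTest.denseRange_toL2 (lam := lam) hX).equalizer h1 h2 (funext fun φ => by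
      simp only [Function.comp_apply]
      rw [hJ, translation_toL2, hJ]
      exact hS.apply_normExp hη hℓ hℓ1 a φ _ fun _ => rfl)
  exact congrFun h f

end Shift

/-! ### The product of exponential vectors -/

section SlabApproximation

variable {Y : Type u} [MeasurableSpace Y] {lam : Measure Y} {X D : Set Y}

/-- A simple function on `D`, regarded as a simple function on a larger set. -/
def SimpleTest.mono (φ : SimpleTest lam D) (h : D ⊆ X) : SimpleTest lam X where
  toFun := φ.toFun
  eq_zero y hy := φ.eq_zero y fun hyD => hy (h hyD)
  memLp := φ.memLp
  ne_neg_one := φ.ne_neg_one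

/-- The restriction of a simple function to `D`. -/
def SimpleTest.cut (φ : SimpleTest lam X) (hD : MeasurableSet D) : SimpleTest lam D where
  toFun := SimpleFunc.piecewise D hD φ.toFun 0
  eq_zero y hy := by simp [hy]
  memLp := by
    have : ⇑(SimpleFunc.piecewise D hD φ.toFun 0) = D.indicator φ.toFun := by
      funext y; by_cases hy : y ∈ D <;> simp [hy]
    rw [this]
    exact φ.memLp.indicator hD
  ne_neg_one y := by
    by_cases hy : y ∈ D
    · simpa [hy] using φ.ne_neg_one y
    · simp [hy]

theorem SimpleTest.cut_apply (φ : SimpleTest lam X) (hD : MeasurableSet D) (y : Y) :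
    (φ.cut hD).toFun y = D.indicator φ.toFun y := by
  by_cases hy : y ∈ D <;> simp [cut, hy]

theorem mem_closure_range_mono (hX : MeasurableSet X) (hD : MeasurableSet D) (hDX : D ⊆ X)
    {f : Lp ℂ 2 (lam.restrict X)} (hf : ∀ᵐ y ∂(lam.restrict X), y ∉ D → f y = 0) :
    f ∈ closure (Set.range fun φ : SimpleTest lam D => (φ.mono hDX).toL2) := by
  rw [Metric.mem_closure_iff]
  intro ε hε
  obtain ⟨_, ⟨φ, rfl⟩, hφ⟩ := Metric.mem_closure_iff.1
    (SimpleTest.denseRange_toL2 (lam := lam) hX f) ε hε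
  refine ⟨_, ⟨φ.cut hD, rfl⟩, lt_of_le_of_lt ?_ hφ⟩
  rw [dist_eq_norm, dist_eq_norm]
  refine Lp.norm_le_norm_of_ae_le ?_
  filter_upwards [hf, Lp.coeFn_sub f φ.toL2, Lp.coeFn_sub f ((φ.cut hD).mono hDX).toL2,
    MemLp.coeFn_toLp (φ.memLp.restrict X),
    MemLp.coeFn_toLp (((φ.cut hD).mono hDX).memLp.restrict X)]
    with y h1 h2 h3 h4 h5
  rw [h2, h3, Pi.sub_apply, Pi.sub_apply, SimpleTest.toL2, SimpleTest.toL2, h4, h5]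
  change ‖f y - (φ.cut hD).toFun y‖ ≤ _
  rw [φ.cut_apply]
  by_cases hy : y ∈ D
  · rw [Set.indicator_of_mem hy]
  · rw [Set.indicator_of_notMem hy, h1 hy, sub_zero, norm_zero]
    exact norm_nonneg _

end SlabApproximation

section PointwiseProduct

variable {Ω : Type v} [MeasurableSpace Ω] (Pr : Measure Ω) [IsProbabilityMeasure Pr]

/-- The pointwise product `L² × L² → L¹`. -/
def mulL1 : Lp ℂ 2 Pr →L[ℂ] Lp ℂ 2 Pr →L[ℂ] Lp ℂ 1 Pr :=
  (ContinuousLinearMap.mul ℂ ℂ).holderL Pr 2 2 1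

variable {Pr}

theorem coeFn_mulL1 (f g : Lp ℂ 2 Pr) : mulL1 Pr f g =ᵐ[Pr] fun ω => f ω * g ω :=
  (ContinuousLinearMap.mul ℂ ℂ).coeFn_holder f g

/-- Pointwise products in `L²` as an identity in `L¹`, where the product is continuous. The factor
`1` embeds `L²` into `L¹`. -/
theorem mulL1_eq_iff (f g k : Lp ℂ 2 Pr) :
    mulL1 Pr k (Lp.const 2 Pr 1) = mulL1 Pr f g ↔ k =ᵐ[Pr] fun ω => f ω * g ω := by
  have h1 : mulL1 Pr k (Lp.const 2 Pr 1) =ᵐ[Pr] k := by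
    filter_upwards [coeFn_mulL1 k (Lp.const 2 Pr 1), Lp.coeFn_const (p := 2) (μ := Pr) (1 : ℂ)]
      with ω e1 e2
    rw [e1, e2, Function.const, mul_one]
  rw [Lp.ext_iff]
  exact ⟨fun h => h1.symm.trans (h.trans (coeFn_mulL1 f g)),
    fun h => h1.trans (h.trans (coeFn_mulL1 f g).symm)⟩

end PointwiseProduct

section DensityExtension

variable {H : Type u} [NormedAddCommGroup H] [InnerProductSpace ℂ H]
  {K : Type v} [NormedAddCommGroup K] [NormedSpace ℂ K]
  {L : Type w} [NormedAddCommGroup L] [NormedSpace ℂ L] (M : K →L[ℂ] K →L[ℂ] L) (u : K)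

/-- The multiplication rule `E(f + W g) = E(f) E(W g)` passes to closures. The bilinear map `M`
plays the part of the product and `u` that of the unit, as the product of two vectors of `K` lies in
`L`. -/
theorem eq_mul_of_mem_closure {W : H → H} (hW : Continuous W) {E : H → K} (hE : Continuous E)
    {s t : Set H} (h : ∀ f ∈ s, ∀ g ∈ t, M (E (f + W g)) u = M (E f) (E (W g))) {f g : H}
    (hf : f ∈ closure s) (hg : g ∈ closure t) : M (E (f + W g)) u = M (E f) (E (W g)) := by
  have h1 : (f, g) ∈ closure (s ×ˢ t) := by rw [closure_prod_eq]; exact ⟨hf, hg⟩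
  have hc1 : Continuous fun p : H × H => M (E (p.1 + W p.2)) u :=
    (M.flip u).continuous.comp (hE.comp (continuous_fst.add (hW.comp continuous_snd)))
  have hc2 : Continuous fun p : H × H => M (E p.1) (E (W p.2)) :=
    (M.continuous.comp (hE.comp continuous_fst)).clm_apply (hE.comp (hW.comp continuous_snd))
  exact Set.EqOn.closure (s := s ×ˢ t) (fun p hp => h _ hp.1 _ hp.2) hc1 hc2 h1

/-- A bilinear identity for intertwiners holds if it holds for those that come from exponential
vectors. -/
theorem fiber_mul_eq_of_expVec [CompleteSpace H] [TopologicalSpace.SeparableSpace H] {d : ℕ}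
    {P : PointedCone ℝ (EuclideanSpace ℝ (Fin d))} {V : P → (H →ₗᵢ[ℂ] H)}
    {hV : IsIsometricRepresentation V} {hV' : ∀ f, Continuous fun a => coisom (V a) f}
    (J : Fock H →L[ℂ] K) (A : K →L[ℂ] K) {a b : P}
    (h : ∀ (f : perp (V a)) (g : perp (V b)),
      M (J (expVec (f + V a g))) u = M (J (expVec f)) (A (J (expVec g))))
    (T : (ccrFlow V hV hV').fiber a) (R : (ccrFlow V hV hV').fiber b) :
    M (J (T.1 (R.1 (expVec 0)))) u = M (J (T.1 (expVec 0))) (A (J (R.1 (expVec 0)))) := by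
  have h1 : ∀ (f : perp (V a)) (g : perp (V b)),
      M (J (fockMul (V a) (expVec f) (fockMul (V b) (expVec g) (expVec 0)))) u =
        M (J (fockMul (V a) (expVec f) (expVec 0)))
          (A (J (fockMul (V b) (expVec g) (expVec 0)))) := fun f g => by
    simp only [fockMul_expVec, map_zero, add_zero]
    exact h f g
  have h2 : ∀ (f : perp (V a)) (R : (ccrFlow V hV hV').fiber b),
      M (J (fockMul (V a) (expVec f) (R.1 (expVec 0)))) u =
        M (J (fockMul (V a) (expVec f) (expVec 0))) (A (J (R.1 (expVec 0)))) := by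
    intro f R
    have := (isTotal_fiber V hV hV' (a := b)).clm_ext
      (S := M.flip u ∘L J ∘L fockMul (V a) (expVec f) ∘L
        ContinuousLinearMap.apply ℂ _ (expVec 0) ∘L ((ccrFlow V hV hV').fiber b).subtypeL)
      (T := M (J (fockMul (V a) (expVec f) (expVec 0))) ∘L A ∘L J ∘L
        ContinuousLinearMap.apply ℂ _ (expVec 0) ∘L ((ccrFlow V hV hV').fiber b).subtypeL)
      fun g => h1 f g
    exact congrArg (fun L => L R) this
  have := (isTotal_fiber V hV hV' (a := a)).clm_ext
    (S := M.flip u ∘L J ∘L ContinuousLinearMap.apply ℂ _ (R.1 (expVec 0)) ∘L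
      ((ccrFlow V hV hV').fiber a).subtypeL)
    (T := M.flip (A (J (R.1 (expVec 0)))) ∘L J ∘L ContinuousLinearMap.apply ℂ _ (expVec 0) ∘L
      ((ccrFlow V hV hV').fiber a).subtypeL) fun f => h2 f R
  exact congrArg (fun L => L T) this

end DensityExtension

section PoissonProduct

variable {d : ℕ} {Y : Type u} [MeasurableSpace Y] [AddAction (EuclideanSpace ℝ (Fin d)) Y]
  [MeasurableVAdd₂ (EuclideanSpace ℝ (Fin d)) Y] {lam : Measure Y}
  [VAddInvariantMeasure (EuclideanSpace ℝ (Fin d)) Y lam]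
  {Ω : Type v} [MeasurableSpace Ω] {Pr : Measure Ω} [IsProbabilityMeasure Pr]
  {η : Ω → Measure Y} {P : PointedCone ℝ (EuclideanSpace ℝ (Fin d))}
  {S : P → (Lp ℂ 2 Pr ≃ₗᵢ[ℂ] Lp ℂ 2 Pr)} {ℓ : ℂ → ℂ} {X : Set Y}
  (hX : MeasurableSet X) (hXP : ∀ a ∈ P, ∀ x ∈ X, a +ᵥ x ∈ X)
  (hη : IsPoissonProcess η lam Pr) (hℓ : ∀ z, z ≠ 0 → Complex.exp (ℓ z) = z) (hℓ1 : ℓ 1 = 0)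
  {J : Fock (Lp ℂ 2 (lam.restrict X)) →ₗᵢ[ℂ] Lp ℂ 2 Pr}
  (hJ : ∀ φ : SimpleTest lam X, J (expVec φ.toL2) = φ.normExp ℓ η Pr)

theorem measurableSet_slab (hX : MeasurableSet X) (a : EuclideanSpace ℝ (Fin d)) :
    MeasurableSet (slab X a) := hX.diff (measurableSet_translate hX a)

theorem slab_subset (a : EuclideanSpace ℝ (Fin d)) : slab X a ⊆ X := Set.sdiff_subset

theorem toL2_mono_mem_slabL2 (a : EuclideanSpace ℝ (Fin d)) (φ : SimpleTest lam (slab X a)) :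
    (φ.mono (slab_subset a)).toL2 ∈ slabL2 lam X a := by
  change ∀ᵐ y ∂lam.restrict X, _
  filter_upwards [MemLp.coeFn_toLp ((φ.mono (slab_subset a)).memLp.restrict X)] with y h1 hy
  rw [SimpleTest.toL2, h1]
  exact φ.eq_zero y hy

include hX hη hℓ hℓ1 hJ

theorem expIsometry_mem_poissonFiber (a : P) {f : Lp ℂ 2 (lam.restrict X)}
    (hf : f ∈ slabL2 lam X (a : EuclideanSpace ℝ (Fin d))) :
    J (expVec f) ∈ poissonFiber η Pr X a := by
  have hcl : IsClosed (poissonFiber η Pr X a : Set (Lp ℂ 2 Pr)) :=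
    isClosed_aestronglyMeasurable (hη.countAlgebra_le _)
  have h1 := map_mem_closure (t := (poissonFiber η Pr X a : Set (Lp ℂ 2 Pr)))
    (J.continuous.comp continuous_expVec)
    (mem_closure_range_mono hX (measurableSet_slab hX _) (slab_subset _) hf) (by
      rintro _ ⟨φ, rfl⟩
      simp only [Function.comp_apply]
      rw [hJ]
      exact φ.normExp_mem_lpMeas hη hℓ hℓ1)
  rwa [hcl.closure_eq] at h1

omit hJ in
/-- Multiplicativity for simple functions: `φ` on `X \ (X + a)` and the translate of `ψ` have
disjoint supports, so `u_{φ + Vψ} = u_φ + u_{Vψ}`, and `φ + Vψ` still avoids the value `-1`. -/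
theorem coeFn_normExp_mono_add (a : P) (φ : SimpleTest lam (slab X (a : EuclideanSpace ℝ (Fin d))))
    (ψ : SimpleTest lam X) :
    ∃ χ : SimpleTest lam X, χ.toL2 =
      (φ.mono (slab_subset _)).toL2 + translation (lam := lam) hX hXP a ψ.toL2 ∧
    χ.normExp ℓ η Pr =ᵐ[Pr] fun ω => (φ.mono (slab_subset _)).normExp ℓ η Pr ω *
      (ψ.translate (a : EuclideanSpace ℝ (Fin d)) (hXP a a.2)).normExp ℓ η Pr ω := by
  let ψ' := ψ.translate (a : EuclideanSpace ℝ (Fin d)) (hXP a a.2)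
  have hdisj : ∀ y, φ.toFun y = 0 ∨ ψ'.toFun y = 0 := fun y => by
    by_cases hy : y ∈ (a : EuclideanSpace ℝ (Fin d)) +ᵥ X
    · exact Or.inl (φ.eq_zero y fun h => h.2 hy)
    · exact Or.inr (ψ.eq_zero _ fun h => hy (Set.mem_vadd_set_iff_neg_vadd_mem.2 h))
  let χ : SimpleTest lam X :=
    { toFun := φ.toFun + ψ'.toFun
      eq_zero := fun y hy => by
        rw [SimpleFunc.coe_add, Pi.add_apply, φ.eq_zero y fun h => hy h.1,
          ψ'.eq_zero y hy, add_zero]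
      memLp := φ.memLp.add ψ'.memLp
      ne_neg_one := fun y => by
        rw [SimpleFunc.coe_add, Pi.add_apply]
        rcases hdisj y with h | h
        · rw [h, zero_add]; exact ψ'.ne_neg_one y
        · rw [h, add_zero]; exact φ.ne_neg_one y }
  refine ⟨χ, ?_, SimpleTest.coeFn_normExp_add hη hℓ hℓ1 (φ.mono (slab_subset _)) ψ' χ
    (fun _ => rfl) hdisj⟩
  rw [translation_toL2, SimpleTest.toL2, SimpleTest.toL2, SimpleTest.toL2, ← MemLp.toLp_add]
  rfl

/-- Multiplicativity `Σ_{f + Vₐ g} = Σ_f · Σ_{Vₐ g}` for `f` supported in `X \ (X + a)`. -/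
theorem coeFn_expIsometry_add (a : P) {f : Lp ℂ 2 (lam.restrict X)}
    (hf : f ∈ slabL2 lam X (a : EuclideanSpace ℝ (Fin d))) (g : Lp ℂ 2 (lam.restrict X)) :
    J (expVec (f + translation (lam := lam) hX hXP a g)) =ᵐ[Pr] fun ω =>
      J (expVec f) ω * J (expVec (translation (lam := lam) hX hXP a g)) ω := by
  rw [← mulL1_eq_iff]
  -- both sides depend continuously on `f` and `g`, as elements of `L¹`
  refine eq_mul_of_mem_closure (mulL1 Pr) (Lp.const 2 Pr 1)
    (translation (lam := lam) hX hXP a).continuous (E := fun f => J (expVec f))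
    (J.continuous.comp continuous_expVec) ?_
    (mem_closure_range_mono hX (measurableSet_slab hX _) (slab_subset _) hf)
    (SimpleTest.denseRange_toL2 hX g)
  rintro _ ⟨φ, rfl⟩ _ ⟨ψ, rfl⟩
  obtain ⟨χ, h1, h2⟩ := coeFn_normExp_mono_add hX hXP hη hℓ hℓ1 a φ ψ
  dsimp only
  rw [mulL1_eq_iff, ← h1, translation_toL2, hJ, hJ, hJ]
  exact h2

variable [SigmaFinite lam] [MeasurableSpace.CountablyGenerated Y]
  {hV : IsIsometricRepresentation (translation (lam := lam) (P := P) hX hXP)}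
  {hV' : ∀ f, Continuous fun a => coisom (translation (lam := lam) (P := P) hX hXP a) f}

/-- The value at the vacuum vector carries the composition of intertwiners to the product
`f · S_a g`. -/
theorem coeFn_expIsometry_mul (hS : IsShift P η Pr S) {a b : P}
    (T : (ccrFlow _ hV hV').fiber a) (R : (ccrFlow _ hV hV').fiber b) :
    J (T.1 (R.1 (expVec 0))) =ᵐ[Pr] fun ω =>
      J (T.1 (expVec 0)) ω * S a (J (R.1 (expVec 0))) ω := by
  rw [← mulL1_eq_iff]
  refine fiber_mul_eq_of_expVec (mulL1 Pr) (Lp.const 2 Pr 1) J.toContinuousLinearMap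
    (S a).toContinuousLinearEquiv.toContinuousLinearMap (fun f g => ?_) T R
  change mulL1 Pr (J _) _ = mulL1 Pr (J _) (S a (J _))
  rw [hS.apply_expIsometry hX hXP hη hℓ hℓ1 hJ, mulL1_eq_iff]
  refine coeFn_expIsometry_add hX hXP hη hℓ hℓ1 hJ a ?_ (g : Lp ℂ 2 (lam.restrict X))
  rw [slabL2_eq_perp hX hXP]
  exact f.2

/-- The unitary from the intertwiner space at `a` onto `E(a)`, which is the evaluation at the
vacuum vector followed by the isometry `J`. -/
theorem exists_fiberEquiv (a : P) :
    ∃ θ : (ccrFlow _ hV hV').fiber a ≃ₗᵢ[ℂ] poissonFiber η Pr X a,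
      ∀ T, (θ T : Lp ℂ 2 Pr) = J (T.1 (expVec 0)) := by
  set V := translation (lam := lam) (P := P) hX hXP with hVdef
  have hK := slabL2_eq_perp (lam := lam) hX hXP a
  have hle := hη.countAlgebra_le (slab X (a : EuclideanSpace ℝ (Fin d)))
  have : Fact (countAlgebra η (slab X (a : EuclideanSpace ℝ (Fin d))) ≤ ‹MeasurableSpace Ω›) :=
    ⟨hle⟩
  have : CompleteSpace (poissonFiber η Pr X a) := inferInstance
  let y : perp (V a) → poissonFiber η Pr X a := fun f => ⟨J (expVec f),
    expIsometry_mem_poissonFiber hX hη hℓ hℓ1 hJ a (by rw [hK]; exact f.2)⟩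
  have hy : IsTotal y := by
    refine (hη.isTotal_normExp hℓ hℓ1 (measurableSet_slab hX
      (a : EuclideanSpace ℝ (Fin d)))).of_closure fun φ => ?_
    refine subset_closure (Submodule.subset_span
      ⟨⟨(φ.mono (slab_subset _)).toL2, hK ▸ toL2_mono_mem_slabL2 _ φ⟩, ?_⟩)
    exact Subtype.ext (hJ (φ.mono (slab_subset _)))
  have hC : CompleteSpace ((ccrFlow V hV hV').fiber a) := inferInstance
  obtain ⟨θ, hθ⟩ := (isTotal_fiber V hV hV' (a := a)).exists_equiv hy fun f g => by
    rw [← inner_apply_vacuum]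
    simp only [fockMul_expVec, map_zero, add_zero]
    exact J.inner_map_map _ _
  refine ⟨θ, fun T => ?_⟩
  have h := (isTotal_fiber V hV hV' (a := a)).clm_ext
    (S := (poissonFiber η Pr X a).subtypeL ∘L θ.toContinuousLinearEquiv.toContinuousLinearMap)
    (T := J.toContinuousLinearMap ∘L ContinuousLinearMap.apply ℂ _ (expVec 0) ∘L
      ((ccrFlow V hV hV').fiber a).subtypeL) fun f => by
        refine (congrArg Subtype.val (hθ f)).trans ?_
        change J (expVec (f : Lp ℂ 2 (lam.restrict X))) =
          J (fockMul (V a) (expVec f) (expVec 0))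
        rw [fockMul_expVec, map_zero, add_zero]
  exact congrArg (fun L => L T) h

end PoissonProduct

/-! ### The isomorphism of product systems -/

section Isomorphism

variable {d : ℕ} {Y : Type u} [MeasurableSpace Y] [AddAction (EuclideanSpace ℝ (Fin d)) Y]
  [MeasurableVAdd₂ (EuclideanSpace ℝ (Fin d)) Y] {lam : Measure Y}
  [VAddInvariantMeasure (EuclideanSpace ℝ (Fin d)) Y lam]
  {Ω : Type v} [MeasurableSpace Ω] {Pr : Measure Ω} [IsProbabilityMeasure Pr]
  {η : Ω → Measure Y} {P : PointedCone ℝ (EuclideanSpace ℝ (Fin d))}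
  {S : P → (Lp ℂ 2 Pr ≃ₗᵢ[ℂ] Lp ℂ 2 Pr)} {X : Set Y}

theorem coeFn_poissonMul {a b : P} {f : poissonFiber η Pr X a} {g : poissonFiber η Pr X b}
    (k : poissonFiber η Pr X (a + b)) (hk : ((k : Lp ℂ 2 Pr) : Ω → ℂ) =ᵐ[Pr]
        fun ω => (f : Lp ℂ 2 Pr) ω * (S a (g : Lp ℂ 2 Pr) : Lp ℂ 2 Pr) ω) :
    ((poissonMul η Pr X S f g : Lp ℂ 2 Pr) : Ω → ℂ) =ᵐ[Pr]
      fun ω => (f : Lp ℂ 2 Pr) ω * (S a (g : Lp ℂ 2 Pr) : Lp ℂ 2 Pr) ω := by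
  have h : ∃ k : poissonFiber η Pr X (a + b), ((k : Lp ℂ 2 Pr) : Ω → ℂ) =ᵐ[Pr]
        fun ω => (f : Lp ℂ 2 Pr) ω * (S a (g : Lp ℂ 2 Pr) : Lp ℂ 2 Pr) ω := ⟨k, hk⟩
  rw [poissonMul, dif_pos h]
  exact h.choose_spec

theorem eq_poissonMul {a b : P} {f : poissonFiber η Pr X a} {g : poissonFiber η Pr X b}
    (k : poissonFiber η Pr X (a + b)) (hk : ((k : Lp ℂ 2 Pr) : Ω → ℂ) =ᵐ[Pr]
        fun ω => (f : Lp ℂ 2 Pr) ω * (S a (g : Lp ℂ 2 Pr) : Lp ℂ 2 Pr) ω) :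
    k = poissonMul η Pr X S f g :=
  Subtype.ext (Lp.ext (hk.trans (coeFn_poissonMul k hk).symm))

theorem measurable_poisson_iff {β : Type*} [MeasurableSpace β]
    {f : β → (poissonSystem η Pr X S).Total} :
    Measurable f ↔ Measurable (fun b => (f b).1) ∧
      Measurable[_, borel (Lp ℂ 2 Pr)] fun b => poissonVec (f b).2 := by
  let _ : MeasurableSpace (Lp ℂ 2 Pr) := borel _
  exact measurable_comap_iff.trans
    ⟨fun h => ⟨measurable_fst.comp h, measurable_snd.comp h⟩, fun h => h.1.prodMk h.2⟩

variable {H : Type w} [NormedAddCommGroup H] [InnerProductSpace ℂ H] [CompleteSpace H]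
  [TopologicalSpace.SeparableSpace H] {V : P → (H →ₗᵢ[ℂ] H)}
  {hV : IsIsometricRepresentation V} {hV' : ∀ f, Continuous fun a => coisom (V a) f}
  {J : Fock H →ₗᵢ[ℂ] Lp ℂ 2 Pr}
  (θ : ∀ a, (ccrFlow V hV hV').fiber a ≃ₗᵢ[ℂ] poissonFiber η Pr X a)
  (hθ : ∀ a T, (θ a T : Lp ℂ 2 Pr) = J (T.1 (expVec 0)))
  (hmul : ∀ {a b : P} (T : (ccrFlow V hV hV').fiber a) (R : (ccrFlow V hV hV').fiber b),
    J (T.1 (R.1 (expVec 0))) =ᵐ[Pr] fun ω => J (T.1 (expVec 0)) ω * S a (J (R.1 (expVec 0))) ω)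

include hθ hmul

theorem coeFn_fiberEquiv_mul {a b : P} (T : (ccrFlow V hV hV').fiber a)
    (R : (ccrFlow V hV hV').fiber b) :
    ((θ (a + b) ((ccrFlow V hV hV').productSystem.mul (a := a) (b := b) T R) : Lp ℂ 2 Pr) :
      Ω → ℂ) =ᵐ[Pr] fun ω => (θ a T : Lp ℂ 2 Pr) ω * (S a (θ b R : Lp ℂ 2 Pr)) ω := by
  rw [hθ a T, hθ b R]
  have h := hθ (a + b) ((ccrFlow V hV hV').productSystem.mul (a := a) (b := b) T R)
  rw [h]
  exact hmul T R

theorem coeFn_poissonMul_of_fiberEquiv {a b : P} (f : poissonFiber η Pr X a)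
    (g : poissonFiber η Pr X b) :
    ((poissonMul η Pr X S f g : Lp ℂ 2 Pr) : Ω → ℂ) =ᵐ[Pr]
      fun ω => (f : Lp ℂ 2 Pr) ω * (S a (g : Lp ℂ 2 Pr) : Lp ℂ 2 Pr) ω := by
  have h := coeFn_fiberEquiv_mul θ hθ hmul ((θ a).symm f) ((θ b).symm g)
  rw [LinearIsometryEquiv.apply_symm_apply, LinearIsometryEquiv.apply_symm_apply] at h
  exact coeFn_poissonMul _ h

/-- A fibrewise unitary, given on intertwiners by `T ↦ J (T e(0))` for an isometry `J` and turning
composition into the product `f · Sₐ g`, is an isomorphism of product systems. -/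
theorem exists_iso_poissonSystem :
    ∃ Θ : (ccrFlow V hV hV').productSystem.Iso (poissonSystem η Pr X S),
      ∀ (a : P) (T : (ccrFlow V hV hV').fiber a),
        poissonVec (Θ.toEquiv a T) = J (T.1 (expVec 0)) := by
  let _ : MeasurableSpace (Lp ℂ 2 Pr) := borel _
  have _ : BorelSpace (Lp ℂ 2 Pr) := ⟨rfl⟩
  have hsymm : ∀ a (ξ : poissonFiber η Pr X a),
      (ξ : Lp ℂ 2 Pr) = J (((θ a).symm ξ).1 (expVec 0)) := fun a ξ => by
    rw [← hθ, LinearIsometryEquiv.apply_symm_apply]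
  refine ⟨⟨θ, fun {a b} T R => ?_, ?_, ?_⟩, fun a T => hθ a T⟩
  · exact eq_poissonMul _ (coeFn_fiberEquiv_mul θ hθ hmul T R)
  · have h1 := (measurable_ccr_iff (hV := hV) (hV' := hV')).1 (measurable_id
      (α := (ccrFlow V hV hV').productSystem.Total))
    refine measurable_poisson_iff.2 ⟨h1.1, ?_⟩
    have h2 := J.continuous.measurable.comp h1.2
    have h3 : (fun x : (ccrFlow V hV hV').productSystem.Total =>
        poissonVec (S := S) (θ x.1 x.2)) = fun x =>
          J ((ccrFlow V hV hV').op x (expVec 0)) := funext fun x => hθ x.1 x.2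
    exact h3 ▸ h2
  · have h1 := measurable_poisson_iff.1 (measurable_id
      (α := (poissonSystem η Pr X S).Total))
    refine (measurable_ccr_iff (hV := hV) (hV' := hV')).2
      ⟨h1.1, isTotal_expVec.measurable fun h => ?_⟩
    -- the matrix elements are inner products with the images of the exponential vectors
    have h2 : ∀ y : (poissonSystem η Pr X S).Total,
        inner ℂ (expVec h) (((θ y.1).symm y.2).1 (expVec 0)) =
          (inner ℂ (J (expVec h)) (poissonVec y.2) : ℂ) := fun y => by
      rw [← J.inner_map_map]
      exact congrArg (inner ℂ (J (expVec h))) (hsymm y.1 y.2).symm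
    have h4 : Measurable fun y : (poissonSystem η Pr X S).Total =>
        (inner ℂ (J (expVec h)) (poissonVec y.2) : ℂ) :=
      (innerSL ℂ (J (expVec h))).continuous.measurable.comp h1.2
    have h5 := funext h2
    exact h5 ▸ h4

end Isomorphism

section Identification

variable {d : ℕ} {P : PointedCone ℝ (EuclideanSpace ℝ (Fin d))}
  {H : Type w} [NormedAddCommGroup H] [InnerProductSpace ℂ H] [CompleteSpace H]
  [TopologicalSpace.SeparableSpace H] {V : P → (H →ₗᵢ[ℂ] H)}
  (hV : IsIsometricRepresentation V) (hV' : ∀ f, Continuous fun a => coisom (V a) f)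

theorem exists_fockFiber_of_eq_perp (a : P) {K : Submodule ℂ H} (hK : K = perp (V a)) :
    ∃ κ : Fock K ≃ₗᵢ[ℂ] (ccrFlow V hV hV').fiber a, ∀ (f : K) (g : H),
      (κ (expVec f) : Fock H →L[ℂ] Fock H) (expVec g) = expVec ((f : H) + V a g) := by
  subst hK
  exact ⟨fockFiber V hV hV' a, fun f g => by rw [coe_fockFiber, fockMul_expVec]⟩

end Identification

end PoissonProductSystem

end

theorem mainTheorem2 {d : ℕ}
    (P : PointedCone ℝ (EuclideanSpace ℝ (Fin d)))
    (hP_closed : IsClosed (P : Set (EuclideanSpace ℝ (Fin d))))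
    (hP_spanning : ∀ x : EuclideanSpace ℝ (Fin d), ∃ p ∈ P, ∃ q ∈ P, x = p - q)
    (hP_pointed : ∀ x ∈ P, -x ∈ P → x = 0)
    {Y : Type*} [MeasurableSpace Y] [MeasurableSpace.CountablyGenerated Y]
    [AddAction (EuclideanSpace ℝ (Fin d)) Y] [MeasurableVAdd₂ (EuclideanSpace ℝ (Fin d)) Y]
    (lam : Measure Y) [SigmaFinite lam] [VAddInvariantMeasure (EuclideanSpace ℝ (Fin d)) Y lam]
    (X : Set Y) (hX : MeasurableSet X) (hXP : ∀ a ∈ P, ∀ x ∈ X, a +ᵥ x ∈ X)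
    (hX_pure : ⋂ a ∈ P, (a +ᵥ X) = ∅)
    {Ω : Type*} [MeasurableSpace Ω] (Pr : Measure Ω) [IsProbabilityMeasure Pr]
    (η : Ω → Measure Y) (hη : IsPoissonProcess η lam Pr) (hΩ : IsGeneratedBy η Pr)
    (ℓ : ℂ → ℂ) (hℓ : Measurable ℓ) (hℓ_exp : ∀ z, z ≠ 0 → Complex.exp (ℓ z) = z)
    (hℓ_log : ∀ x : ℝ, 0 < x → ℓ x = Real.log x) :
    -- the normalized exponentials, the isometries `V_a` and the shifts `S_a` are well defined
    NormExpWellDefined lam X ℓ η Pr ∧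
    IsIsometricRepresentation (translation (lam := lam) (P := P) hX hXP) ∧
    (∃! S, IsShift P η Pr S) ∧
    ∀ S, IsShift P η Pr S →
      -- `E` is a product system with the product `f · S_a g`
      (∀ (a b : P) (f : poissonFiber η Pr X a) (g : poissonFiber η Pr X b),
        ((poissonMul η Pr X S f g : Lp ℂ 2 Pr) : Ω → ℂ) =ᵐ[Pr]
          fun ω => (f : Lp ℂ 2 Pr) ω * (S a (g : Lp ℂ 2 Pr) : Lp ℂ 2 Pr) ω) ∧
      (poissonSystem η Pr X S).IsProductSystem ∧
      -- the CCR flow `α` of `V`, and its product system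
      ∃ α : E0Semigroup P (Fock (Lp ℂ 2 (lam.restrict X))),
        IsCCRFlow (translation (lam := lam) (P := P) hX hXP) α ∧
        α.productSystem.IsProductSystem ∧
        -- the identification of `Γ(L²(X \ (X + a)))` with the fibre at `a` of that system
        ∃ κ : ∀ a : P, Fock (slabL2 lam X (a : EuclideanSpace ℝ (Fin d))) ≃ₗᵢ[ℂ] α.fiber a,
          (∀ (a : P) (f : slabL2 lam X (a : EuclideanSpace ℝ (Fin d)))
              (g : Lp ℂ 2 (lam.restrict X)),
            (κ a (expVec f) : Fock (Lp ℂ 2 (lam.restrict X)) →L[ℂ]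
                Fock (Lp ℂ 2 (lam.restrict X))) (expVec g) =
              expVec ((f : Lp ℂ 2 (lam.restrict X)) +
                translation (lam := lam) (P := P) hX hXP a g)) ∧
          -- the isomorphism of product systems, which maps `e(f)` to `Σ_f`
          ∃ θ : α.productSystem.Iso (poissonSystem η Pr X S),
            ∀ (a : P) (f : slabL2 lam X (a : EuclideanSpace ℝ (Fin d))),
              poissonVec (θ.toEquiv a (κ a (expVec f))) =
                normExp ℓ η Pr (f : Lp ℂ 2 (lam.restrict X)) := by
  have hℓ1 : ℓ 1 = 0 := by simpa using hℓ_log 1 one_pos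
  have hV := isIsometricRepresentation_translation (lam := lam) (P := P) hX hXP
  have hV' := continuous_coisom_translation (lam := lam) (P := P) hX hXP
  obtain ⟨J, hJ⟩ := exists_expIsometry hη hℓ_exp hℓ1 hX
  refine ⟨normExpWellDefined hη hℓ_exp hℓ1 hX, hV, ?_, fun S hS => ?_⟩
  · obtain ⟨S, hS⟩ := exists_isShift P hη hΩ
    exact ⟨S, hS, fun S' hS' => hS'.unique hS hη hΩ hℓ_exp hℓ1⟩
  choose θ hθ using exists_fiberEquiv hX hXP hη hℓ_exp hℓ1 hJ (hV := hV) (hV' := hV')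
  have hmul := fun {a b : P} => coeFn_expIsometry_mul hX hXP hη hℓ_exp hℓ1 hJ (hV := hV)
    (hV' := hV') hS (a := a) (b := b)
  obtain ⟨Θ, hΘ⟩ := exists_iso_poissonSystem θ hθ hmul
  have hα := isProductSystem_ccrFlow hV hV' hP_closed
  choose κ hκ using fun a : P => exists_fockFiber_of_eq_perp hV hV' a
    (slabL2_eq_perp (lam := lam) hX hXP a)
  refine ⟨fun a b f g => coeFn_poissonMul_of_fiberEquiv θ hθ hmul f g, hα.of_iso Θ,
    ccrFlow _ hV hV', fun a h => fockEndo_weyl _ h, hα, κ, hκ, Θ, fun a f => ?_⟩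
  rw [hΘ, hκ, map_zero, add_zero, normExp_eq_expIsometry hJ hX]
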